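/- Let $k$ be an algebraically closed field of characteristic zero, let $G_1\subset SL_2(k)$ be a finite non-abelian subgroup (so $-1\in G_1$), let $m\ge 1$, and let $G=(2m,2m;G_1,G_1)=\mu_{2m}G_1\subset GL_2(k)$ be the image of $\mu_{2m}\times G_1$ under scalar multiplication of matrices. Then there is an isomorphism $$\Phi: H^2(G,k^*)\;\simeq\;\operatorname{Hom}\bigl(\mu_m,(G_1/\langle -1\rangle)^{\vee}\bigr),$$ where $A^\vee=\operatorname{Hom}(A,k^*)$ and $k^*$ is a trivial $G$-module, such that the following holds for every class with image $\eta$ under $\Phi$ and every central extension $1\to k^*\to\widetilde G\to G\to 1$ defined by a 2-cocycle in this class. (a) For $z\in\mu_{2m}$ and $g\in G_1$, any lifts $\tilde z,\tilde g\in\widetilde G$ of the scalar matrix $z$ and of $g$ satisfy $\tilde z\tilde g=\eta(z^2)(g)\,\tilde g\tilde z$. (b) Let $\zeta_{2m}$ be a primitive $2m$-th root of unity, $\zeta_m=\zeta_{2m}^2$, let $\chi=\eta(\zeta_m)$, considered as a character of $G_1$, have order $e$ (a divisor of $m$), put $\zeta_e=\zeta_{2m}^{2m/e}$ and $H=\ker\chi$,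 and let $g_1\in G_1$ be any element with $\chi(g_1)=\zeta_e$ and $g_1^e=-1$. Then there is an isomorphism of quivers $$\operatorname{McK}_\eta(G)\;\simeq\;(\mathbb Z\times\Delta_H)^{ev}/\langle[+2m/e]\times\rho\rangle .$$ Here, for a group $\Gamma$ with a finite-dimensional representation $V$, the McKay quiver $\operatorname{McK}(\Gamma,V)$ has as vertices the isomorphism classes of finite-dimensional irreducible representations of $\Gamma$, and the number of arrows $\lambda\to\lambda'$ is the multiplicity of $\lambda'$ in $\lambda\otimes V$. The quiver $\operatorname{McK}_\eta(G)$ is the full subquiver of $\operatorname{McK}(\widetilde G,k^2)$ on the classes on which $k^*\subset\widetilde G$ acts by scalar multiplication, and $\Delta_H=\operatorname{McK}(H,k^2)$. The quiver $\mathbb Z$ has one arrow $i\to i+1$ for each $i\in\mathbb Z$; arrows of a product quiver are pairs of arrows; $(\mathbb Z\times\Delta_H)^{ev}$ is the full subquiver of $\mathbb Z\times\Delta_H$ on the vertices $(i,\lambda)$ for which $-1\in H$ acts on $\lambda$ as $(-1)^i$. The automorphism $[+n]$ of $\mathbb Z$ is addition of $n$, and $\rho$ is the automorphism of $\Delta_H$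 induced by conjugation by $g_1$, sending the class of $\lambda$ to the class of $h\mapsto\lambda(g_1^{-1}hg_1)$. The quotient quiver has as vertices and arrows the orbits of the vertices and arrows. -/

import Mathlib

open scoped TensorProduct MatrixGroups

universe u

noncomputable section

namespace McKayGL2

/-! ### Quivers: isomorphisms, full subquivers, products, quotients -/

section Quivers

/-- An isomorphism of quivers: a bijection on vertices together with compatible bijections on
arrows. -/
structure QuiverIso (V : Type*) [Quiver V] (W : Type*) [Quiver W] where
  /-- the bijection on vertices -/
  onVert : V ≃ W
  /-- the bijections on arrows -/
  onHom : ∀ a b : V, (a ⟶ b) ≃ (onVert a ⟶ onVert b)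

/-- The full subquiver on the vertices which satisfy `P`. -/
def FullSubquiver {V : Type*} [Quiver V] (P : V → Prop) : Type _ := {v : V // P v}

instance {V : Type*} [Quiver V] (P : V → Prop) : Quiver (FullSubquiver P) where
  Hom a b := a.1 ⟶ b.1

/-- An automorphism which preserves `P` restricts to the full subquiver. -/
def QuiverIso.restrict {V : Type*} [Quiver V] (θ : QuiverIso V V) (P : V → Prop)
    (h : ∀ v, P v ↔ P (θ.onVert v)) : QuiverIso (FullSubquiver P) (FullSubquiver P) where
  onVert := θ.onVert.subtypeEquiv h
  onHom a b := θ.onHom a.1 b.1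

/-- The product of two quivers: an arrow `(v₁, v₂) ⟶ (w₁, w₂)` is a pair of arrows
`v₁ ⟶ w₁` and `v₂ ⟶ w₂`. -/
def ProdQuiver (V W : Type*) : Type _ := V × W

instance (V W : Type*) [Quiver V] [Quiver W] : Quiver (ProdQuiver V W) where
  Hom a b := (a.1 ⟶ b.1) × (a.2 ⟶ b.2)

/-- The product of two automorphisms of quivers. -/
def QuiverIso.prod {V W : Type*} [Quiver V] [Quiver W] (θ : QuiverIso V V) (τ : QuiverIso W W) :
    QuiverIso (ProdQuiver V W) (ProdQuiver V W) where
  onVert := Equiv.prodCongr θ.onVert τ.onVert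
  onHom a b := Equiv.prodCongr (θ.onHom a.1 b.1) (τ.onHom a.2 b.2)

/-- The quiver with vertices the integers and exactly one arrow `i ⟶ i + 1` for each `i`. -/
structure IntQuiver : Type where
  /-- the integer -/
  val : ℤ

instance : Quiver IntQuiver where
  Hom i j := PLift (j.val = i.val + 1)

/-- The automorphism `[+n]` of the quiver of integers. -/
def intShift (n : ℤ) : QuiverIso IntQuiver IntQuiver where
  onVert := ⟨fun i => ⟨i.val + n⟩, fun i => ⟨i.val - n⟩, fun _ => by simp, fun _ => by simp⟩
  onHom i j := Equiv.plift.trans ((Equiv.ofIff (by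
    change j.val = i.val + 1 ↔ j.val + n = i.val + n + 1
    omega)).trans Equiv.plift.symm)

/-- Two vertices are identified when some power of the automorphism `θ` maps one to the other:
`Quot` divides by the equivalence relation generated by `v ~ θ v`. -/
def QuotQuiver {V : Type*} [Quiver V] (θ : QuiverIso V V) : Type _ :=
  Quot fun v w : V => θ.onVert v = w

/-- The action of an automorphism on the set of all arrows. -/
def QuiverIso.onTotal {V : Type*} [Quiver V] (θ : QuiverIso V V) (a : Quiver.Total V) :
    Quiver.Total V :=
  ⟨θ.onVert a.left, θ.onVert a.right, θ.onHom a.left a.right a.hom⟩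

/-- The set of orbits of arrows under the group generated by `θ`. -/
def ArrowOrbit {V : Type*} [Quiver V] (θ : QuiverIso V V) : Type _ :=
  Quot fun a b : Quiver.Total V => θ.onTotal a = b

/-- The source of an orbit of arrows. -/
def ArrowOrbit.source {V : Type*} [Quiver V] {θ : QuiverIso V V} (a : ArrowOrbit θ) :
    QuotQuiver θ :=
  Quot.lift (fun a : Quiver.Total V => (Quot.mk _ a.left : QuotQuiver θ))
    (by rintro b _ rfl; exact Quot.sound rfl) a

/-- The target of an orbit of arrows. -/
def ArrowOrbit.target {V : Type*} [Quiver V] {θ : QuiverIso V V} (a : ArrowOrbit θ) :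
    QuotQuiver θ :=
  Quot.lift (fun a : Quiver.Total V => (Quot.mk _ a.right : QuotQuiver θ))
    (by rintro b _ rfl; exact Quot.sound rfl) a

/-- The quotient quiver by the group `⟨θ⟩`: its vertices and its arrows are the orbits of `⟨θ⟩`
on vertices and on arrows. -/
instance {V : Type*} [Quiver V] (θ : QuiverIso V V) : Quiver (QuotQuiver θ) where
  Hom x y := {a : ArrowOrbit θ // a.source = x ∧ a.target = y}

end Quivers

/-! ### McKay quivers -/

section McKay

variable {k : Type u} [Field k] {Γ : Type u} [Group Γ]

/-- A finite-dimensional irreducible representation of `Γ` over `k`. -/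
structure IrrRep (k : Type u) [Field k] (Γ : Type u) [Group Γ] where
  /-- the underlying vector space -/
  carrier : Type u
  [addCommGroup : AddCommGroup carrier]
  [module : Module k carrier]
  [finite : Module.Finite k carrier]
  /-- the action -/
  ρ : Representation k Γ carrier
  irreducible : ρ.IsIrreducible

attribute [instance] IrrRep.addCommGroup IrrRep.module IrrRep.finite

/-- Isomorphism of irreducible representations. -/
instance IrrRep.setoid (k : Type u) [Field k] (Γ : Type u) [Group Γ] : Setoid (IrrRep k Γ) where
  r M N := Nonempty (M.ρ.Equiv N.ρ)
  iseqv := ⟨fun _ => ⟨.refl _⟩, fun ⟨e⟩ => ⟨e.symm⟩, fun ⟨e⟩ ⟨f⟩ => ⟨e.trans f⟩⟩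

/-- The multiplicity of `N` in `M ⊗ V`, as the dimension of `Hom_Γ(N, M ⊗ V)`. -/
def multRep {W : Type u} [AddCommGroup W] [Module k W] (V : Representation k Γ W)
    (M N : IrrRep k Γ) : ℕ :=
  Module.finrank k (Representation.IntertwiningMap N.ρ (M.ρ.tprod V))

/-- Transport of the space `Hom_Γ(N, X)` along a linear isomorphism of `N`, a linear isomorphism
of `X` and an automorphism of `Γ`. -/
def homTransport {A B X Y : Type u} [AddCommGroup A] [Module k A] [AddCommGroup B] [Module k B]
    [AddCommGroup X] [Module k X] [AddCommGroup Y] [Module k Y]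
    (α : Representation k Γ A) (β : Representation k Γ B)
    (ξ : Representation k Γ X) (υ : Representation k Γ Y) (φ : Γ ≃* Γ)
    (e : A ≃ₗ[k] B) (he : ∀ g a, e (α g a) = β (φ g) (e a))
    (f : X ≃ₗ[k] Y) (hf : ∀ g x, f (ξ g x) = υ (φ g) (f x)) :
    Representation.IntertwiningMap α ξ ≃ₗ[k] Representation.IntertwiningMap β υ where
  toFun t := ⟨f.toLinearMap ∘ₗ t.toLinearMap ∘ₗ e.symm.toLinearMap, fun g => by
    ext b
    obtain ⟨g, rfl⟩ := φ.surjective g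
    obtain ⟨a, rfl⟩ := e.surjective b
    have ht := LinearMap.congr_fun (t.isIntertwining' g) a
    simp only [LinearMap.comp_apply, LinearEquiv.coe_coe] at ht ⊢
    rw [← he, e.symm_apply_apply, e.symm_apply_apply, ← hf, ht]⟩
  invFun t := ⟨f.symm.toLinearMap ∘ₗ t.toLinearMap ∘ₗ e.toLinearMap, fun g => by
    ext a
    have ht := LinearMap.congr_fun (t.isIntertwining' (φ g)) (e a)
    simp only [LinearMap.comp_apply, LinearEquiv.coe_coe] at ht ⊢
    rw [he, ht, LinearEquiv.symm_apply_eq, hf, f.apply_symm_apply]⟩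
  map_add' s t := by
    apply Representation.IntertwiningMap.ext
    ext b
    exact map_add f _ _
  map_smul' c t := by
    apply Representation.IntertwiningMap.ext
    ext b
    exact map_smul f c _
  left_inv t := by
    apply Representation.IntertwiningMap.ext
    ext b
    simp
  right_inv t := by
    apply Representation.IntertwiningMap.ext
    ext b
    simp

/-- The vertices of the McKay quiver of `(Γ, V)`: isomorphism classes of irreducible
representations of `Γ`. -/
def McK {W : Type u} [AddCommGroup W] [Module k W] (_V : Representation k Γ W) : Type (u + 1) :=
  Quotient (IrrRep.setoid k Γ)

variable {W : Type u} [AddCommGroup W] [Module k W]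

lemma multRep_congr (V : Representation k Γ W) (M N M' N' : IrrRep k Γ) (hM : M ≈ M')
    (hN : N ≈ N') : multRep V M N = multRep V M' N' := by
  obtain ⟨e⟩ := hM
  obtain ⟨f⟩ := hN
  refine (homTransport N.ρ N'.ρ (M.ρ.tprod V) (M'.ρ.tprod V) (MulEquiv.refl Γ) f.toLinearEquiv
    (fun g a => ?_) (TensorProduct.congr e.toLinearEquiv (LinearEquiv.refl k W))
    (fun g x => ?_)).finrank_eq
  · exact LinearMap.congr_fun (f.isIntertwining' g) a
  · induction x using TensorProduct.induction_on with
    | zero => simp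
    | add x y hx hy => simp only [map_add, hx, hy]
    | tmul m w =>
      simp only [Representation.tprod_apply, TensorProduct.map_tmul, TensorProduct.congr_tmul,
        LinearEquiv.refl_apply, MulEquiv.refl_apply]
      congr 1
      exact LinearMap.congr_fun (e.isIntertwining' g) m

/-- The multiplicity of the class `μ` in `l ⊗ V`. -/
def mult (V : Representation k Γ W) (l μ : McK V) : ℕ :=
  Quotient.liftOn₂ l μ (multRep V) (multRep_congr V)

/-- The McKay quiver: there are as many arrows `l ⟶ μ` as the multiplicity of `μ` in
`l ⊗ V`. -/
instance (V : Representation k Γ W) : Quiver (McK V) where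
  Hom l μ := Fin (mult V l μ)

/-- On the irreducible representations in the class `l`, the element `h` acts as the
scalar `c`. -/
def ActsAs {V : Representation k Γ W} (l : McK V) (h : Γ) (c : k) : Prop :=
  Quotient.liftOn l (fun M => ∀ v, M.ρ h v = c • v) (by
    rintro M N ⟨e⟩
    have he : ∀ a, e.toLinearEquiv (M.ρ h a) = N.ρ h (e.toLinearEquiv a) :=
      fun a => LinearMap.congr_fun (e.isIntertwining' h) a
    refine propext ⟨fun H v => ?_, fun H v => ?_⟩
    · obtain ⟨a, rfl⟩ := e.toLinearEquiv.surjective v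
      rw [← he, H, map_smul]
    · apply e.toLinearEquiv.injective
      rw [he, H, map_smul])

/-- The twist of an irreducible representation by an automorphism `φ` of the group: `g` acts on
the twist as `φ⁻¹ g` acts on the original. -/
def IrrRep.twist (φ : Γ ≃* Γ) (M : IrrRep k Γ) : IrrRep k Γ where
  carrier := M.carrier
  ρ := M.ρ.comp φ.symm.toMonoidHom
  irreducible := by
    have := M.irreducible
    let o : Subrepresentation M.ρ ≃o Subrepresentation
        (show Representation k Γ M.carrier from M.ρ.comp φ.symm.toMonoidHom) :=
      { toFun := fun S => ⟨S.toSubmodule, fun g v hv => S.apply_mem_toSubmodule (φ.symm g) hv⟩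
        invFun := fun S => ⟨S.toSubmodule, fun g v hv => by
          have := S.apply_mem_toSubmodule (φ g) hv
          simpa using this⟩
        left_inv := fun S => rfl
        right_inv := fun S => rfl
        map_rel_iff' := Iff.rfl }
    exact o.symm.isSimpleOrder

lemma finrank_hom_twist {A B : Type u} [AddCommGroup A] [Module k A] [AddCommGroup B]
    [Module k B] (α : Representation k Γ A) (β : Representation k Γ B)
    (V : Representation k Γ W) (φ : Γ ≃* Γ) (T : W ≃ₗ[k] W)
    (hT : ∀ g w, T (V g w) = V (φ g) (T w)) (α' : Representation k Γ A)
    (β' : Representation k Γ B) (hα : ∀ g, α' (φ g) = α g) (hβ : ∀ g, β' (φ g) = β g) :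
    Module.finrank k (Representation.IntertwiningMap β (α.tprod V)) =
      Module.finrank k (Representation.IntertwiningMap β' (α'.tprod V)) := by
  refine (homTransport β β' (α.tprod V) (α'.tprod V) φ (LinearEquiv.refl k B) (fun g a => ?_)
    (TensorProduct.congr (LinearEquiv.refl k A) T) (fun g x => ?_)).finrank_eq
  · simp [hβ]
  · induction x using TensorProduct.induction_on with
    | zero => simp
    | add x y hx hy => simp only [map_add, hx, hy]
    | tmul m w => simp [Representation.tprod_apply, hT, hα]

lemma multRep_twist (V : Representation k Γ W) (φ : Γ ≃* Γ) (T : W ≃ₗ[k] W)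
    (hT : ∀ g w, T (V g w) = V (φ g) (T w)) (M N : IrrRep k Γ) :
    multRep V M N = multRep V (M.twist φ) (N.twist φ) :=
  finrank_hom_twist M.ρ N.ρ V φ T hT (M.twist φ).ρ (N.twist φ).ρ
    (fun g => congrArg M.ρ (φ.symm_apply_apply g)) (fun g => congrArg N.ρ (φ.symm_apply_apply g))

/-- The permutation of the vertices of the McKay quiver given by twisting with `φ`. -/
def twistVert (V : Representation k Γ W) (φ : Γ ≃* Γ) : McK V ≃ McK V where
  toFun := Quotient.map (IrrRep.twist φ) (by
    rintro M N ⟨e⟩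
    exact ⟨.mk e.toLinearEquiv fun g => e.isIntertwining' (φ.symm g)⟩)
  invFun := Quotient.map (IrrRep.twist φ.symm) (by
    rintro M N ⟨e⟩
    exact ⟨.mk e.toLinearEquiv fun g => e.isIntertwining' (φ g)⟩)
  left_inv l := by
    induction l using Quotient.inductionOn with
    | h M =>
      refine Quotient.sound ⟨.mk (LinearEquiv.refl k M.carrier) fun g => ?_⟩
      exact congrArg M.ρ (φ.symm_apply_apply g)
  right_inv l := by
    induction l using Quotient.inductionOn with
    | h M =>
      refine Quotient.sound ⟨.mk (LinearEquiv.refl k M.carrier) fun g => ?_⟩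
      exact congrArg M.ρ (φ.apply_symm_apply g)

/-- The automorphism of the McKay quiver of `(Γ, V)` induced by an automorphism `φ` of `Γ` for
which the twist of `V` by `φ` is isomorphic to `V` (through `T`). -/
def twistAut (V : Representation k Γ W) (φ : Γ ≃* Γ) (T : W ≃ₗ[k] W)
    (hT : ∀ g w, T (V g w) = V (φ g) (T w)) : QuiverIso (McK V) (McK V) where
  onVert := twistVert V φ
  onHom l μ := finCongr (by
    induction l, μ using Quotient.inductionOn₂ with
    | h M N => exact multRep_twist V φ T hT M N)

lemma actsAs_twist (V : Representation k Γ W) (φ : Γ ≃* Γ) (h : Γ) (hφ : φ.symm h = h) (c : k)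
    (l : McK V) : ActsAs l h c ↔ ActsAs (V := V) (twistVert V φ l) h c := by
  induction l using Quotient.inductionOn with
  | h M =>
    change (∀ v, M.ρ h v = c • v) ↔ ∀ v : M.carrier, M.ρ (φ.symm h) v = c • v
    rw [hφ]

end McKay

/-! ### Subgroups of `GL₂` and the quiver `(ℤ × Δ_H)^ev` -/

section Groups

variable {k : Type u} [Field k]

/-- The representation of `Γ` on `k²` given by a homomorphism to `GL₂`. -/
def stdRep {Γ : Type u} [Group Γ] (f : Γ →* GL (Fin 2) k) : Representation k Γ (Fin 2 → k) where
  toFun g := Matrix.toLin' (f g : Matrix (Fin 2) (Fin 2) k)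
  map_one' := by simp [Module.End.one_eq_id]
  map_mul' g h := by simp [Matrix.toLin'_mul, Module.End.mul_eq_comp]

/-- The homomorphism `k* × SL₂ → GL₂` given by scalar multiplication of matrices. -/
def scalarMul (k : Type u) [Field k] : kˣ × SL(2, k) →* GL (Fin 2) k where
  toFun p := Matrix.GeneralLinearGroup.scalar (Fin 2) p.1 * Matrix.SpecialLinearGroup.toGL p.2
  map_one' := by simp
  map_mul' p q := by
    have h : Commute (Matrix.SpecialLinearGroup.toGL p.2)
        (Matrix.GeneralLinearGroup.scalar (Fin 2) q.1) := by
      ext i j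
      simp [Matrix.GeneralLinearGroup.scalar, mul_comm]
    simp only [Prod.fst_mul, Prod.snd_mul, map_mul]
    exact (h.symm.mul_mul_mul_comm _ _)

/-- The group `(2m, 2m; G₁, G₁)`: the image in `GL₂` of `μ_{2m} × G₁`. -/
def coxeterGroup (m : ℕ) (G₁ : Subgroup SL(2, k)) : Subgroup (GL (Fin 2) k) :=
  ((rootsOfUnity (2 * m) k).prod G₁).map (scalarMul k)

/-- The subgroup `⟨-1⟩` of `G₁` (for `G₁` containing `-1`). -/
def negOneSubgroup (G₁ : Subgroup SL(2, k)) : Subgroup G₁ :=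
  (Subgroup.zpowers (-1 : SL(2, k))).subgroupOf G₁

lemma negOne_central (g : SL(2, k)) : g * (-1) * g⁻¹ = -1 := by simp

instance (G₁ : Subgroup SL(2, k)) : (negOneSubgroup G₁).Normal := by
  have : (Subgroup.zpowers (-1 : SL(2, k))).Normal := ⟨by
    rintro _ ⟨i, rfl⟩ g
    refine ⟨i, ?_⟩
    change (-1 : SL(2, k)) ^ i = g * (-1) ^ i * g⁻¹
    rw [← conj_zpow, negOne_central]⟩
  exact Subgroup.normal_subgroupOf

variable {G₁ : Subgroup SL(2, k)}

/-- The representation `k²` of a subgroup `H` of `G₁ ≤ SL₂`. -/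
def natRep (H : Subgroup G₁) : Representation k H (Fin 2 → k) :=
  stdRep (Matrix.SpecialLinearGroup.toGL.comp (G₁.subtype.comp H.subtype))

/-- The McKay quiver `Δ_H` of a subgroup `H` of `G₁ ≤ SL₂`. -/
abbrev Delta (H : Subgroup G₁) : Type (u + 1) := McK (natRep H)

/-- The automorphism of `Δ_H` induced by conjugation by `g`, where `H` is normalized by `g`: it
maps the class of `M` to the class of the representation `h ↦ M (g⁻¹ h g)`. -/
def outerAut (H : Subgroup G₁) [H.Normal] (g : G₁) : QuiverIso (Delta H) (Delta H) :=
  twistAut (natRep H) (MulAut.conjNormal g)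
    (Matrix.SpecialLinearGroup.toLin' (g : SL(2, k))) (fun h w => by
      have e : ((MulAut.conjNormal g h : H) : G₁) * g = g * (h : G₁) := by
        rw [MulAut.conjNormal_apply, inv_mul_cancel_right]
      have e' := congrArg (fun x : G₁ => ((x : SL(2, k)) : Matrix (Fin 2) (Fin 2) k)) e
      simp only [Subgroup.coe_mul, Matrix.SpecialLinearGroup.coe_mul] at e'
      change ((g : SL(2, k)) : Matrix (Fin 2) (Fin 2) k).mulVec
          ((((h : G₁) : SL(2, k)) : Matrix (Fin 2) (Fin 2) k).mulVec w) =
        ((((MulAut.conjNormal g h : H) : G₁) : SL(2, k)) : Matrix (Fin 2) (Fin 2) k).mulVec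
          (((g : SL(2, k)) : Matrix (Fin 2) (Fin 2) k).mulVec w)
      rw [Matrix.mulVec_mulVec, Matrix.mulVec_mulVec, e'])

/-- A vertex `(i, l)` of `ℤ × Δ_H` is even when `(-1, -1) ∈ k* × H` acts trivially on the
corresponding representation, in other words when `-1 ∈ H` acts on `l` as the
scalar `(-1)^i`. -/
def IsEvenVertex (H : Subgroup G₁) (p : ProdQuiver IntQuiver (Delta H)) : Prop :=
  ∀ h : H, ((h : G₁) : SL(2, k)) = -1 → ActsAs p.2 h (((-1 : kˣ) ^ p.1.val : kˣ) : k)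

/-- The quiver `(ℤ × Δ_H)^ev`. -/
abbrev EvenQuiver (H : Subgroup G₁) : Type (u + 1) := FullSubquiver (IsEvenVertex H)

/-- The automorphism `[+2d] × ρ` of `(ℤ × Δ_H)^ev`, where `ρ` is induced by conjugation
by `g`. Since `-1` is central, `ρ` preserves the scalar by which `-1` acts, so that a shift by an
even number preserves even vertices. -/
def evenAut (H : Subgroup G₁) [H.Normal] (g : G₁) (d : ℤ) :
    QuiverIso (EvenQuiver H) (EvenQuiver H) :=
  ((intShift (2 * d)).prod (outerAut H g)).restrict (IsEvenVertex H) (by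
    rintro ⟨i, l⟩
    have hp : (-1 : kˣ) ^ (i.val + 2 * d) = (-1 : kˣ) ^ i.val := by
      rw [zpow_add, zpow_mul]; simp
    refine forall_congr' fun h => imp_congr_right fun hh => ?_
    change ActsAs l h (((-1 : kˣ) ^ i.val : kˣ) : k) ↔
      ActsAs (V := natRep H) (twistVert (natRep H) (MulAut.conjNormal g) l) h
        (((-1 : kˣ) ^ (i.val + 2 * d) : kˣ) : k)
    rw [hp]
    refine actsAs_twist (natRep H) (MulAut.conjNormal g) h ?_ _ l
    rw [MulEquiv.symm_apply_eq]
    ext1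
    ext1
    rw [MulAut.conjNormal_apply]
    push_cast
    rw [hh, negOne_central])

end Groups

/-! ### The second cohomology group and central extensions -/

section Extensions

variable {k : Type u} [Field k] (G : Subgroup (GL (Fin 2) k))

/-- The trivial `G`-module `k*`, written additively. The coefficient ring is `ℤ`, lifted to the
universe of `k`. -/
abbrev unitsRep : Rep.{u} (ULift.{u} ℤ) G := Rep.trivial (ULift.{u} ℤ) G (Additive kˣ)

/-- The group `H²(G, k*)`. -/
abbrev HTwo : Type u := groupCohomology.H2 (unitsRep G)

variable {G}

/-- The value of a 2-cocycle, as an element of `k*`. -/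
def cocycleVal (α : groupCohomology.cocycles₂ (unitsRep G)) (g h : G) : kˣ :=
  Additive.toMul (α (g, h) : Additive kˣ)

lemma cocycleVal_assoc (α : groupCohomology.cocycles₂ (unitsRep G)) (g h j : G) :
    cocycleVal α (g * h) j * cocycleVal α g h = cocycleVal α h j * cocycleVal α g (h * j) :=
  congrArg Additive.toMul ((groupCohomology.mem_cocycles₂_iff α.1).1 α.2 g h j)

/-- The central extension of `G` by `k*` defined by a 2-cocycle `α`: pairs `(a, g)` with the
product `(a, g) (b, h) = (a b α(g, h), g h)`. -/
@[ext]
structure CentralExt (α : groupCohomology.cocycles₂ (unitsRep G)) : Type u where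
  /-- the coefficient -/
  coeff : kˣ
  /-- the image in `G` -/
  base : G

namespace CentralExt

variable {α : groupCohomology.cocycles₂ (unitsRep G)}

instance : Mul (CentralExt α) where
  mul x y := ⟨x.coeff * y.coeff * cocycleVal α x.base y.base, x.base * y.base⟩

instance : One (CentralExt α) where
  one := ⟨(cocycleVal α 1 1)⁻¹, 1⟩

instance : Inv (CentralExt α) where
  inv x := ⟨(cocycleVal α 1 1)⁻¹ * (x.coeff * cocycleVal α x.base⁻¹ x.base)⁻¹, x.base⁻¹⟩

lemma val_one_left (g : G) : cocycleVal α 1 g = cocycleVal α 1 1 := by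
  have h := cocycleVal_assoc α 1 1 g
  simp only [one_mul] at h
  exact (mul_left_cancel h).symm

lemma val_one_right (g : G) : cocycleVal α g 1 = cocycleVal α 1 1 := by
  have h := cocycleVal_assoc α g 1 1
  simp only [mul_one] at h
  exact mul_right_cancel h

instance : Group (CentralExt α) :=
  Group.ofLeftAxioms
    (fun x y z => CentralExt.ext (by
      change x.coeff * y.coeff * cocycleVal α x.base y.base * z.coeff *
          cocycleVal α (x.base * y.base) z.base =
        x.coeff * (y.coeff * z.coeff * cocycleVal α y.base z.base) *
          cocycleVal α x.base (y.base * z.base)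
      have h := cocycleVal_assoc α x.base y.base z.base
      calc _ = x.coeff * y.coeff * z.coeff *
            (cocycleVal α (x.base * y.base) z.base * cocycleVal α x.base y.base) := by
              ac_rfl
        _ = _ := by rw [h]; simp only [mul_assoc]) (mul_assoc _ _ _))
    (fun x => CentralExt.ext (by
      change (cocycleVal α 1 1)⁻¹ * x.coeff * cocycleVal α 1 x.base = x.coeff
      rw [val_one_left x.base, mul_right_comm, inv_mul_cancel, one_mul]) (one_mul _))
    (fun x => CentralExt.ext (by
      change (cocycleVal α 1 1)⁻¹ * (x.coeff * cocycleVal α x.base⁻¹ x.base)⁻¹ * x.coeff *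
        cocycleVal α x.base⁻¹ x.base = (cocycleVal α 1 1)⁻¹
      rw [mul_assoc, inv_mul_cancel_right]) (inv_mul_cancel _))

/-- The projection of the extension onto `G`. -/
def proj (α : groupCohomology.cocycles₂ (unitsRep G)) : CentralExt α →* G where
  toFun x := x.base
  map_one' := rfl
  map_mul' _ _ := rfl

/-- The embedding of `k*` in the extension. -/
def incl (α : groupCohomology.cocycles₂ (unitsRep G)) : kˣ →* CentralExt α where
  toFun a := ⟨a * (cocycleVal α 1 1)⁻¹, 1⟩
  map_one' := CentralExt.ext (one_mul _) rfl
  map_mul' a b := CentralExt.ext (by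
    change a * b * (cocycleVal α 1 1)⁻¹ =
      a * (cocycleVal α 1 1)⁻¹ * (b * (cocycleVal α 1 1)⁻¹) * cocycleVal α 1 1
    simp only [mul_assoc, inv_mul_cancel, mul_one]
    rw [mul_comm (cocycleVal α 1 1)⁻¹ b]) (one_mul _).symm

end CentralExt

/-- The McKay quiver of the pair `(G, η)`, where the class `η` is represented by the 2-cocycle
`α`: the full subquiver of the McKay quiver of the central extension (acting on `k²` through `G`)
on the irreducible representations on which `k*` acts by scalar multiplication. -/
abbrev McKTwisted (α : groupCohomology.cocycles₂ (unitsRep G)) : Type (u + 1) :=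
  FullSubquiver fun l : McK (stdRep (G.subtype.comp (CentralExt.proj α))) =>
    ∀ c : kˣ, ActsAs l (CentralExt.incl α c) (c : k)

end Extensions

end McKayGL2

end

/-!
# The cohomology of `μ_{2m} G₁` and its twisted McKay quivers

The computation of `H²(G, kˣ)` for `G = μ_{2m} G₁` rests on the vanishing of `H²(L, kˣ)` for the
finite subgroups `L` of `SL₂`, in the form that every central extension of `L` by `kˣ` splits
(`centralExtensionsSplit_of_finite`). By transfer, it suffices to treat the Sylow subgroups. A
finite `p`-subgroup of `SL₂` is cyclic or generalized quaternion, because a non-scalar element which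
is central modulo `±1` has a cyclic centralizer, of index at most two; in both cases the lifts of
generators can be rescaled so as to satisfy the defining relations. The same holds for the cyclic
group `μ_{2m}`. Hence both `G₁` and `μ_{2m}` lift to any central extension of `G`, and, after a
change of sign by the tautological character of `μ_{2m}`, the two lifts of `-1` agree
(`exists_lifts`). The extension is then determined by the commutators of the lifts, which form a
bimultiplicative map on `μ_{2m} × G₁` trivial on `-1` on both sides, in other words a homomorphism
`η` from `μ_m` to the characters of `G₁ / ⟨-1⟩`. Conversely, `η` defines the cocycle
`(z g, z' g') ↦ η(z²)(g')`, whose extension has commutator pairing `η`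
(`commutator_of_pairingClass`). This gives the isomorphism `pairingEquiv` and the commutator
formula. That `-1` lies in `G₁` is `neg_one_mem_of_nonabelian`.

For the McKay quiver, let `τ` be the lift of `ζ = ζ_{2m}`, so that `τ` commutes with the lift of
`g ∈ G₁` up to the scalar `χ g`. If `kˣ` acts on an irreducible representation `M` of the extension
by scalars, then `G₁` permutes the eigenspaces of `τ` through `χ`, and `H = ker χ` preserves each of
them. The nonzero eigenspaces are irreducible for `H` (`weightRep_irreducible`), and homomorphisms
out of `M` are determined by their restriction to any one of them (`finrank_intertwiningMap`).
Moreover, an irreducible representation of `H` on which `-1` acts as `(-1)^i` is the eigenspace for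
`ζ^i` of some `M`, by coinduction (`exists_irrRep`). Thus `M` corresponds to the set of pairs `(i, l)` such that
the eigenspace for `ζ^i` is nonzero and in the class `l`. These pairs form one orbit under the shift
by `2m/e` combined with conjugation by `g₁`, as the lift of `g₁` maps the eigenspace for `ζ^i` to
the one for `χ(g₁) ζ^i = ζ^(i + 2m/e)`. Since `τ` acts on `k²` as `ζ`, tensoring with `k²` raises
`i` by one, so that the arrows from `M` to `M'` are the arrows of `ℤ × Δ_H` from the pairs of `M` to
a fixed pair of `M'`. As the shift acts freely, these are the arrows of the quotient quiver
(`nonempty_quiverIso_quotQuiver`).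
-/

noncomputable section

namespace McKayGL2

/-! ### Splitting of central extensions -/

section Splitting

variable {k : Type u} [Field k]

/-- `1 → kˣ → U → L → 1` is a central extension, with maps `ι` and `f`. -/
structure IsCentralExtension {U L : Type u} [Group U] [Group L] (ι : kˣ →* U) (f : U →* L) :
    Prop where
  injective : Function.Injective ι
  surjective : Function.Surjective f
  map_incl : ∀ c, f (ι c) = 1
  exists_incl : ∀ x, f x = 1 → ∃ c, ι c = x
  central : ∀ c x, ι c * x = x * ι c

/-- Every central extension of `L` by `kˣ` splits, in other words `H²(L, kˣ) = 0`. The splitting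
is expressed by a retraction onto `kˣ`. -/
def CentralExtensionsSplit (k : Type u) [Field k] (L : Type u) [Group L] : Prop :=
  ∀ (U : Type u) [Group U] (ι : kˣ →* U) (f : U →* L), IsCentralExtension ι f →
    ∃ r : U →* kˣ, ∀ c, r (ι c) = c

variable {U L : Type u} [Group U] [Group L] {ι : kˣ →* U} {f : U →* L}

lemma IsCentralExtension.exists_section (h : IsCentralExtension ι f) (r : U →* kˣ)
    (hr : ∀ c, r (ι c) = c) : ∃ s : L →* U, ∀ l, f (s l) = l := by
  have key : ∀ x y, f x = f y → r x = r y → x = y := by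
    intro x y h1 h2
    obtain ⟨c, hc⟩ := h.exists_incl (x * y⁻¹) (by simp [h1])
    have : c = 1 := by rw [← hr c, hc]; simp [h2]
    rw [this, map_one] at hc
    exact (mul_inv_eq_one.mp hc.symm)
  have ex : ∀ l, ∃ x, f x = l ∧ r x = 1 := fun l => by
    obtain ⟨x, hx⟩ := h.surjective l
    exact ⟨ι (r x)⁻¹ * x, by rw [map_mul, h.map_incl, one_mul, hx], by simp [hr]⟩
  choose s hs hs' using ex
  exact ⟨MonoidHom.mk' s fun a b => key _ _ (by simp [hs]) (by simp [hs']), hs⟩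

lemma IsCentralExtension.exists_retraction_of_section (h : IsCentralExtension ι f)
    (s : L →* U) (hs : ∀ l, f (s l) = l) : ∃ r : U →* kˣ, ∀ c, r (ι c) = c := by
  have ex : ∀ x, ∃ c, ι c * s (f x) = x := fun x => by
    obtain ⟨c, hc⟩ := h.exists_incl (x * (s (f x))⁻¹) (by simp [hs])
    exact ⟨c, by rw [hc, inv_mul_cancel_right]⟩
  choose r hr using ex
  refine ⟨MonoidHom.mk' r fun x y => h.injective ?_, fun c => h.injective ?_⟩
  · apply mul_right_cancel (b := s (f (x * y)))
    rw [hr, map_mul, map_mul, map_mul]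
    conv_lhs => rw [← hr x, ← hr y]
    rw [mul_assoc, ← mul_assoc (s _), ← h.central, mul_assoc, mul_assoc]
  · have := hr (ι c)
    rw [h.map_incl, map_one, mul_one] at this
    exact this

/-- A subgroup of the extension which maps bijectively onto the quotient splits the extension. -/
lemma IsCentralExtension.exists_retraction_of_complement (h : IsCentralExtension ι f)
    (S : Subgroup U) (h1 : ∀ x ∈ S, f x = 1 → x = 1) (h2 : ∀ l, ∃ x ∈ S, f x = l) :
    ∃ r : U →* kˣ, ∀ c, r (ι c) = c := by
  choose s hs hs' using h2
  refine h.exists_retraction_of_section (MonoidHom.mk' s fun a b => ?_) hs'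
  rw [← mul_inv_eq_one]
  exact h1 _ (S.mul_mem (hs _) (S.inv_mem (S.mul_mem (hs _) (hs _)))) (by simp [hs'])

/-- If the central extensions of `L` split, homomorphisms from `L` lift along central
extensions of other groups: apply the splitting to the fibre product. -/
lemma IsCentralExtension.exists_lift (h : IsCentralExtension ι f) {M : Type u} [Group M]
    (hM : CentralExtensionsSplit k M) (q : M →* L) : ∃ s : M →* U, ∀ l, f (s l) = q l := by
  let W : Subgroup (U × M) := (f.comp (MonoidHom.fst U M)).eqLocus (q.comp (MonoidHom.snd U M))
  have hW : ∀ x : W, f x.1.1 = q x.1.2 := fun x => x.2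
  let ι' : kˣ →* W := (ι.prod 1).codRestrict W fun c => by
    change f (ι c) = q 1
    rw [h.map_incl, map_one]
  let f' : W →* M := (MonoidHom.snd U M).comp W.subtype
  have hext : IsCentralExtension ι' f' :=
    { injective := fun a b hab => h.injective (congrArg (fun x : W => x.1.1) hab)
      surjective := fun l => by
        obtain ⟨x, hx⟩ := h.surjective (q l)
        exact ⟨⟨(x, l), hx⟩, rfl⟩
      map_incl := fun c => rfl
      exists_incl := fun x hx => by
        have hx' : x.1.2 = 1 := hx
        obtain ⟨c, hc⟩ := h.exists_incl x.1.1 (by rw [hW, hx', map_one])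
        exact ⟨c, Subtype.ext (Prod.ext hc hx'.symm)⟩
      central := fun c x => Subtype.ext (Prod.ext (h.central c x.1.1)
        ((one_mul x.1.2).trans (mul_one x.1.2).symm)) }
  obtain ⟨r, hr⟩ := hM W ι' f' hext
  obtain ⟨s, hs⟩ := hext.exists_section r hr
  refine ⟨(MonoidHom.fst U M).comp (W.subtype.comp s), fun l => ?_⟩
  have := hW (s l)
  have h2 : (s l).1.2 = l := hs l
  rw [h2] at this
  exact this

lemma exists_units_pow_eq [IsAlgClosed k] (d : kˣ) {n : ℕ} (hn : 0 < n) : ∃ c : kˣ, c ^ n = d := by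
  obtain ⟨e, he⟩ := IsAlgClosed.exists_pow_nat_eq (d : k) hn
  have he0 : e ≠ 0 := by
    rintro rfl
    rw [zero_pow hn.ne'] at he
    exact d.ne_zero he.symm
  exact ⟨Units.mk0 e he0, Units.ext (by simpa using he)⟩

/-- If `x` is a lift of a generator of order `n` and `c ^ n = x ^ n`, the lift `c⁻¹ x` of the
generator has order `n` and splits the extension. -/
lemma centralExtensionsSplit_of_isCyclic [IsAlgClosed k] (L : Type u) [Group L]
    [Finite L] [IsCyclic L] : CentralExtensionsSplit k L := by
  intro U _ ι f h
  obtain ⟨g, hg⟩ := IsCyclic.exists_generator (α := L)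
  obtain ⟨x, hx⟩ := h.surjective g
  obtain ⟨d, hd⟩ := h.exists_incl (x ^ orderOf g) (by rw [map_pow, hx, pow_orderOf_eq_one])
  obtain ⟨c, hc⟩ := exists_units_pow_eq d (orderOf_pos g)
  have hcomm : Commute (ι c⁻¹) x := h.central _ _
  have hpow : (ι c⁻¹ * x) ^ orderOf g = 1 := by
    rw [hcomm.mul_pow, ← hd, ← map_pow, ← map_mul, inv_pow, hc, inv_mul_cancel, map_one]
  refine h.exists_retraction_of_section (monoidHomOfForallMemZpowers hg
    (orderOf_dvd_of_pow_eq_one hpow)) fun l => ?_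
  obtain ⟨n, rfl⟩ := Subgroup.mem_zpowers_iff.mp (hg l)
  rw [map_zpow, map_zpow, monoidHomOfForallMemZpowers_apply_gen, map_mul, h.map_incl, one_mul, hx]

/-- Central extensions of generalized quaternion groups split. The group is given by a cyclic
subgroup `⟨a⟩` of index two and even order `2 * l` and by an element `b` outside it, with
`b a b⁻¹ = a⁻¹` and `b² = a ^ l`. After rescaling, the same relations hold for lifts `x` of `a`
and `y` of `b`, and imply `x ^ (2 * l) = 1`. -/
lemma centralExtensionsSplit_of_quaternion [IsAlgClosed k] (L : Type u) [Group L]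
    (a b : L) (l : ℕ) (ha : orderOf a = 2 * l) (hb : b ∉ Subgroup.zpowers a)
    (hab : b * a * b⁻¹ = a⁻¹) (hbb : b ^ 2 = a ^ l)
    (hgen : ∀ g : L, g ∈ Subgroup.zpowers a ∨ g * b⁻¹ ∈ Subgroup.zpowers a) :
    CentralExtensionsSplit k L := by
  intro U _ ι f h
  have hcomm : ∀ c x, Commute (ι c) x := h.central
  have sq : ∀ d : kˣ, ∃ c : kˣ, c ^ 2 = d := fun d => exists_units_pow_eq d two_pos
  -- scaling the lift of `a` by `c` changes the relation `b a b⁻¹ = a⁻¹` by `c ^ 2`, and likewise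
  -- for the lift of `b` and the relation `b ^ 2 = a ^ l`
  obtain ⟨x₀, hx₀⟩ := h.surjective a
  obtain ⟨y₀, hy₀⟩ := h.surjective b
  obtain ⟨d, hd⟩ := h.exists_incl (y₀ * x₀ * y₀⁻¹ * x₀) (by simp [hx₀, hy₀, hab])
  obtain ⟨c, hc⟩ := sq d⁻¹
  obtain ⟨x, hx, hxy₀⟩ : ∃ x, f x = a ∧ y₀ * x * y₀⁻¹ = x⁻¹ := by
    refine ⟨ι c * x₀, by rw [map_mul, h.map_incl, one_mul, hx₀], ?_⟩
    rw [eq_inv_iff_mul_eq_one]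
    calc y₀ * (ι c * x₀) * y₀⁻¹ * (ι c * x₀) = ι c * ι c * (y₀ * x₀ * y₀⁻¹ * x₀) := by
          rw [← mul_assoc y₀, ← h.central c y₀]
          simp only [mul_assoc]
          rw [← mul_assoc y₀⁻¹, ← h.central c y₀⁻¹]
          simp only [mul_assoc]
          rw [← mul_assoc x₀ (ι c), ← h.central c x₀]
          simp only [mul_assoc]
          rw [← mul_assoc y₀ (ι c), ← h.central c y₀]
          simp only [mul_assoc]
      _ = 1 := by rw [← hd, ← map_mul, ← map_mul, ← pow_two, hc, inv_mul_cancel, map_one]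
  obtain ⟨d', hd'⟩ := h.exists_incl ((y₀ ^ 2)⁻¹ * x ^ l) (by simp [hx, hy₀, hbb])
  obtain ⟨c', hc'⟩ := sq d'
  obtain ⟨y, hy, hxy, hyy⟩ : ∃ y, f y = b ∧ y * x * y⁻¹ = x⁻¹ ∧ y ^ 2 = x ^ l := by
    refine ⟨ι c' * y₀, by rw [map_mul, h.map_incl, one_mul, hy₀], ?_, ?_⟩
    · rw [← hxy₀, mul_inv_rev, ← map_inv, ← h.central, mul_assoc, mul_assoc, ← mul_assoc x,
        ← h.central, mul_assoc, ← mul_assoc y₀, ← h.central, mul_assoc, ← mul_assoc, ← map_mul]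
      simp [mul_assoc]
    · rw [(hcomm c' y₀).mul_pow, ← map_pow, hc', (hcomm d' (y₀ ^ 2)).eq, hd',
        mul_inv_cancel_left]
  -- `y` commutes with `y ^ 2 = x ^ l` and inverts it
  have hxl : x ^ (2 * l) = 1 := by
    have h1 : y * x ^ l * y⁻¹ = (x ^ l)⁻¹ := by rw [← conj_pow, hxy, inv_pow]
    have h2 : y * x ^ l * y⁻¹ = x ^ l := by rw [← hyy]; group
    rw [two_mul, pow_add, ← eq_inv_iff_mul_eq_one, ← h1, h2]
  have hyx : ∀ i : ℤ, y * x ^ i = x ^ (-i) * y := fun i => by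
    rw [← mul_inv_eq_iff_eq_mul, ← conj_zpow, hxy, inv_zpow, zpow_neg]
  have hyy' : y * y = x ^ (l : ℤ) := by rw [← pow_two, hyy, zpow_natCast]
  -- the subgroup generated by `x` and `y` is a complement of `kˣ`
  let S : Subgroup U :=
    { carrier := {z | ∃ i : ℤ, z = x ^ i ∨ z = x ^ i * y}
      one_mem' := ⟨0, by simp⟩
      mul_mem' := by
        rintro _ _ ⟨i, rfl | rfl⟩ ⟨j, rfl | rfl⟩
        · exact ⟨i + j, .inl (zpow_add _ _ _).symm⟩
        · exact ⟨i + j, .inr (by rw [zpow_add, mul_assoc])⟩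
        · exact ⟨i - j, .inr (by rw [mul_assoc, hyx, ← mul_assoc, ← zpow_add, sub_eq_add_neg])⟩
        · exact ⟨i - j + l, .inl (by
            rw [mul_assoc, ← mul_assoc y, hyx, mul_assoc, hyy', ← zpow_add, ← zpow_add]
            congr 1; ring)⟩
      inv_mem' := by
        rintro _ ⟨i, rfl | rfl⟩
        · exact ⟨-i, .inl (zpow_neg _ _).symm⟩
        · refine ⟨i - l, .inr ?_⟩
          rw [inv_eq_iff_mul_eq_one, mul_assoc, ← mul_assoc y, hyx, mul_assoc, hyy', ← zpow_add,
            ← zpow_add, show i + (-(i - l) + l) = ((2 * l : ℕ) : ℤ) by push_cast; ring,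
            zpow_natCast, hxl] }
  refine h.exists_retraction_of_complement S ?_ fun g => ?_
  · rintro _ ⟨i, rfl | rfl⟩ h1
    · rw [map_zpow, hx, ← orderOf_dvd_iff_zpow_eq_one, ha] at h1
      obtain ⟨j, rfl⟩ := h1
      rw [zpow_mul, zpow_natCast, hxl, one_zpow]
    · rw [map_mul, map_zpow, hx, hy] at h1
      exact absurd ⟨-i, (zpow_neg a i).trans (inv_eq_of_mul_eq_one_right h1)⟩ hb
  · rcases hgen g with ⟨i, hi⟩ | ⟨i, hi⟩
    · exact ⟨x ^ i, ⟨i, .inl rfl⟩, by rw [map_zpow, hx]; exact hi⟩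
    · refine ⟨x ^ i * y, ⟨i, .inr rfl⟩, ?_⟩
      rw [map_mul, map_zpow, hx, hy, ← eq_mul_inv_iff_mul_eq]; exact hi

/-- The vanishing of `H²(L, kˣ)` can be checked on the Sylow subgroups of `L`: the transfer of a
retraction over a Sylow subgroup restricts to `kˣ` as the power by the index, and the indices of
the Sylow subgroups have no common prime factor. -/
lemma centralExtensionsSplit_of_sylow (L : Type u) [Group L] [Finite L]
    (hL : ∀ p : ℕ, p.Prime → ∀ P : Sylow p L, CentralExtensionsSplit k P) :
    CentralExtensionsSplit k L := by
  intro U _ ι f h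
  -- the exponents of the restrictions to `kˣ` of homomorphisms `U → kˣ`
  let I : AddSubgroup ℤ :=
    { carrier := {n | ∃ r : U →* kˣ, ∀ c, r (ι c) = c ^ n}
      zero_mem' := ⟨1, fun c => by simp⟩
      add_mem' := by
        rintro a b ⟨r, hr⟩ ⟨r', hr'⟩
        exact ⟨r * r', fun c => by simp [hr, hr', zpow_add]⟩
      neg_mem' := by
        rintro a ⟨r, hr⟩
        exact ⟨r⁻¹, fun c => by simp [hr]⟩ }
  have hI : ∀ p : ℕ, p.Prime → ∃ n : ℕ, (n : ℤ) ∈ I ∧ ¬ p ∣ n := by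
    intro p hp
    have : Fact p.Prime := ⟨hp⟩
    obtain ⟨P⟩ : Nonempty (Sylow p L) := inferInstance
    let W : Subgroup U := (P : Subgroup L).comap f
    let ι' : kˣ →* W := ι.codRestrict W fun c => by
      change f (ι c) ∈ (P : Subgroup L)
      rw [h.map_incl]; exact one_mem _
    let f' : W →* P := (f.comp W.subtype).codRestrict (P : Subgroup L) fun x => x.2
    have hext : IsCentralExtension ι' f' :=
      { injective := fun a b hab => h.injective (congrArg (fun x : W => x.1) hab)
        surjective := fun l => by
          obtain ⟨x, hx⟩ := h.surjective l.1
          exact ⟨⟨x, by change f x ∈ (P : Subgroup L); rw [hx]; exact l.2⟩, Subtype.ext hx⟩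
        map_incl := fun c => Subtype.ext (h.map_incl c)
        exists_incl := fun x hx => by
          obtain ⟨c, hc⟩ := h.exists_incl x.1 (congrArg Subtype.val hx)
          exact ⟨c, Subtype.ext hc⟩
        central := fun c x => Subtype.ext (h.central c x.1) }
    obtain ⟨r, hr⟩ := hL p hp P W ι' f' hext
    have hidx : W.index = (P : Subgroup L).index :=
      (P : Subgroup L).index_comap_of_surjective h.surjective
    have hndvd : ¬ p ∣ W.index := by rw [hidx]; exact P.not_dvd_index
    have : W.FiniteIndex := ⟨fun h0 => hndvd (by rw [h0]; exact dvd_zero p)⟩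
    refine ⟨W.index, ⟨MonoidHom.transfer r, fun c => ?_⟩, hndvd⟩
    rw [MonoidHom.transfer_eq_pow r (ι c) fun n g _ => by
      rw [← map_pow, mul_assoc, h.central, inv_mul_cancel_left]]
    rw [zpow_natCast, ← hr (c ^ W.index)]
    congr 1
    exact Subtype.ext (map_pow ι c _).symm
  have h1 : (1 : ℤ) ∈ I := by
    obtain ⟨n, hn⟩ := Int.subgroup_cyclic I
    rw [← AddSubgroup.zmultiples_eq_closure] at hn
    have hdvd : ∀ j ∈ I, n ∣ j := fun j hj => by
      rw [hn, Int.mem_zmultiples_iff] at hj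
      exact hj
    by_cases hn1 : n.natAbs = 1
    · rw [hn, Int.mem_zmultiples_iff]
      exact Int.isUnit_iff_natAbs_eq.mpr hn1 |>.dvd
    · obtain ⟨p, hp, hpn⟩ := Nat.exists_prime_and_dvd hn1
      obtain ⟨j, hj, hpj⟩ := hI p hp
      refine absurd ?_ hpj
      have := hdvd _ hj
      rw [← Int.natAbs_dvd_natAbs] at this
      exact hpn.trans this
  obtain ⟨r, hr⟩ := h1
  exact ⟨r, fun c => by rw [hr, zpow_one]⟩

end Splitting

/-! ### Finite subgroups of `SL₂` -/

section SLTwo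

variable {k : Type u} [Field k]

/-- The Cayley–Hamilton theorem for matrices of determinant one. -/
lemma sl2_mul_self (x : SL(2, k)) : (x : Matrix (Fin 2) (Fin 2) k) * x =
    (x : Matrix (Fin 2) (Fin 2) k).trace • (x : Matrix (Fin 2) (Fin 2) k) - 1 := by
  have h := x.det_coe
  rw [Matrix.det_fin_two] at h
  ext i j
  fin_cases i <;> fin_cases j <;>
    simp [Matrix.mul_apply, Fin.sum_univ_two, Matrix.trace_fin_two] <;>
    first | linear_combination -h | ring

lemma sl2_eq_one_or_neg_one_of_scalar (x : SL(2, k)) (c : k)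
    (h : (x : Matrix (Fin 2) (Fin 2) k) = c • (1 : Matrix (Fin 2) (Fin 2) k)) :
    x = 1 ∨ x = -1 := by
  have hd := x.det_coe
  rw [h, Matrix.det_smul, Matrix.det_one, mul_one, Fintype.card_fin, sq_eq_one_iff] at hd
  rcases hd with rfl | rfl
  · exact .inl (Subtype.ext (by simpa using h))
  · exact .inr (Subtype.ext (by simpa using h))

/-- The only involution of `SL₂` is `-1`. -/
lemma sl2_sq_eq_one [CharZero k] (x : SL(2, k)) (h : x ^ 2 = 1) : x = 1 ∨ x = -1 := by
  have h1 := sl2_mul_self x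
  have h2 : (x : Matrix (Fin 2) (Fin 2) k) * x = 1 := by
    have := congrArg (fun y : SL(2, k) => (y : Matrix (Fin 2) (Fin 2) k)) h
    simpa [pow_two] using this
  rw [h2, eq_sub_iff_add_eq] at h1
  have ht : (x : Matrix (Fin 2) (Fin 2) k).trace ≠ 0 := by
    intro ht
    rw [ht, zero_smul] at h1
    have := congrFun (congrFun h1 0) 0
    norm_num at this
  refine sl2_eq_one_or_neg_one_of_scalar x ((x : Matrix (Fin 2) (Fin 2) k).trace⁻¹ * 2) ?_
  rw [mul_smul, eq_inv_smul_iff₀ ht, ← h1, two_smul]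

lemma sl2_sq_of_trace_eq_zero (x : SL(2, k)) (h : (x : Matrix (Fin 2) (Fin 2) k).trace = 0) :
    x ^ 2 = -1 := by
  have h1 := sl2_mul_self x
  rw [h, zero_smul, zero_sub] at h1
  exact Subtype.ext (by simpa [pow_two] using h1)

/-- An element of finite order of `SL₂` which fixes a vector is unipotent, hence trivial. -/
lemma sl2_eq_one_of_fixed [CharZero k] (x : SL(2, k)) (n : ℕ) (hn : 0 < n) (hx : x ^ n = 1)
    (v : Fin 2 → k) (hv : v ≠ 0) (h : (x : Matrix (Fin 2) (Fin 2) k).mulVec v = v) : x = 1 := by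
  have hd : ((x : Matrix (Fin 2) (Fin 2) k) - 1).det = 0 :=
    Matrix.exists_mulVec_eq_zero_iff.mp ⟨v, hv, by rw [Matrix.sub_mulVec, h]; simp⟩
  have hx1 := x.det_coe
  have ht : (x : Matrix (Fin 2) (Fin 2) k).trace = 2 := by
    rw [Matrix.det_fin_two] at hd hx1
    rw [Matrix.trace_fin_two]
    simp at hd
    linear_combination hx1 - hd
  set N := (x : Matrix (Fin 2) (Fin 2) k) - 1 with hN
  have hxN : (x : Matrix (Fin 2) (Fin 2) k) = 1 + N := by rw [hN]; abel
  have hNN : N * N = 0 := by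
    have := sl2_mul_self x
    rw [ht, two_smul] at this
    rw [hN, sub_mul, mul_sub, mul_sub, this, mul_one, one_mul, mul_one]
    abel
  have hp : ∀ j : ℕ, (x : Matrix (Fin 2) (Fin 2) k) ^ j = 1 + j • N := by
    intro j
    induction j with
    | zero => simp
    | succ j ih =>
      rw [pow_succ, ih, hxN, mul_add, mul_one, add_mul, one_mul, smul_mul_assoc, hNN, smul_zero,
        add_zero, succ_nsmul, add_assoc]
  have h0 : n • N = 0 := by
    have := hp n
    rw [← Matrix.SpecialLinearGroup.coe_pow, hx] at this
    simpa using this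
  have : N = 0 := by
    rw [← Nat.cast_smul_eq_nsmul k, smul_eq_zero] at h0
    exact h0.resolve_left (by exact_mod_cast hn.ne')
  exact Subtype.ext (by rw [hxN, this]; simp)

/-- The eigenvectors of a non-scalar 2×2 matrix for a given eigenvalue are proportional. -/
lemma eigenvector_unique (z : Matrix (Fin 2) (Fin 2) k)
    (hz : ∀ c : k, z ≠ c • (1 : Matrix (Fin 2) (Fin 2) k)) (c : k) (v w : Fin 2 → k)
    (hv0 : v ≠ 0) (hv : z.mulVec v = c • v) (hw : z.mulVec w = c • w) :
    ∃ d : k, w = d • v := by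
  have hdet : v 0 * w 1 - v 1 * w 0 = 0 := by
    by_contra hne
    refine hz c ?_
    let M : Matrix (Fin 2) (Fin 2) k := !![v 0, w 0; v 1, w 1]
    have hM : IsUnit M.det := by
      rw [isUnit_iff_ne_zero, Matrix.det_fin_two_of]
      intro h0; exact hne (by linear_combination h0)
    have hzM : z * M = c • M := by
      have v0 := congrFun hv 0
      have v1 := congrFun hv 1
      have w0 := congrFun hw 0
      have w1 := congrFun hw 1
      simp [Matrix.mulVec, dotProduct, Fin.sum_univ_two] at v0 v1 w0 w1
      ext i j
      fin_cases i <;> fin_cases j <;>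
        simp [M, Matrix.mul_apply, Fin.sum_univ_two, v0, v1, w0, w1]
    calc z = z * M * M⁻¹ := (Matrix.mul_nonsing_inv_cancel_right _ _ hM).symm
      _ = c • (1 : Matrix (Fin 2) (Fin 2) k) := by
        rw [hzM, smul_mul_assoc, Matrix.mul_nonsing_inv _ hM]
  by_cases h0 : v 0 = 0
  · have h1 : v 1 ≠ 0 := by
      intro h1
      apply hv0
      ext i; fin_cases i <;> simp [h0, h1]
    refine ⟨w 1 / v 1, ?_⟩
    ext i
    fin_cases i
    · have : w 0 = 0 := by
        rw [h0, zero_mul, zero_sub, neg_eq_zero] at hdet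
        exact (mul_eq_zero.mp hdet).resolve_left h1
      simp [h0, this]
    · simp [h1]
  · refine ⟨w 0 / v 0, ?_⟩
    ext i
    fin_cases i
    · simp [h0]
    · simp
      field_simp
      linear_combination hdet

/-- A finite group of matrices in `SL₂` which commute with a non-scalar matrix acts faithfully on
a line of eigenvectors of that matrix. -/
lemma isCyclic_of_commute_nonscalar [IsAlgClosed k] [CharZero k] {A : Type*} [Group A] [Finite A]
    (j : A →* SL(2, k)) (hj : Function.Injective j) (z : Matrix (Fin 2) (Fin 2) k)
    (hz : ∀ c : k, z ≠ c • (1 : Matrix (Fin 2) (Fin 2) k))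
    (hcomm : ∀ a, (j a : Matrix (Fin 2) (Fin 2) k) * z = z * j a) : IsCyclic A := by
  obtain ⟨c, hc⟩ := Module.End.exists_eigenvalue (Matrix.toLin' z)
  obtain ⟨v, hv⟩ := hc.exists_hasEigenvector
  have hv0 : v ≠ 0 := hv.2
  have hzv : z.mulVec v = c • v := by simpa using hv.apply_eq_smul
  have ex : ∀ a, ∃ d : k, (j a : Matrix (Fin 2) (Fin 2) k).mulVec v = d • v := fun a =>
    eigenvector_unique z hz c v _ hv0 hzv (by
      rw [Matrix.mulVec_mulVec, ← hcomm, ← Matrix.mulVec_mulVec, hzv, Matrix.mulVec_smul])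
  choose d hd using ex
  have inj : ∀ x y : k, x • v = y • v → x = y := fun x y h => smul_left_injective k hv0 h
  let F : A →* k :=
    { toFun := d
      map_one' := inj _ _ (by rw [← hd]; simp)
      map_mul' := fun a b => inj _ _ (by
        rw [← hd, map_mul, Matrix.SpecialLinearGroup.coe_mul, ← Matrix.mulVec_mulVec, hd,
          Matrix.mulVec_smul, hd, smul_smul, mul_comm]) }
  refine isCyclic_of_injective_ringHom F ((injective_iff_map_eq_one F).mpr fun a ha => ?_)
  have ha' : d a = 1 := ha
  apply hj
  rw [map_one]
  refine sl2_eq_one_of_fixed (j a) (orderOf a) (orderOf_pos a)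
    (by rw [← map_pow, pow_orderOf_eq_one, map_one]) v hv0 (by rw [hd, ha', one_smul])

lemma neg_one_ne_one_sl2 [CharZero k] : (-1 : SL(2, k)) ≠ 1 := by
  intro h
  have := congrFun (congrFun (congrArg Subtype.val h) 0) 0
  simp at this
  norm_num [neg_eq_iff_add_eq_zero] at this

lemma mem_zpowers_neg_one (x : SL(2, k)) :
    x ∈ Subgroup.zpowers (-1 : SL(2, k)) ↔ x = 1 ∨ x = -1 := by
  constructor
  · rintro ⟨i, rfl⟩
    rcases Int.even_or_odd i with h | h
    · exact .inl h.neg_one_zpow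
    · exact .inr h.neg_one_zpow
  · rintro (rfl | rfl)
    · exact one_mem _
    · exact Subgroup.mem_zpowers _

/-- A finite `p`-group in `SL₂` is cyclic or generalized quaternion. A non-scalar element which is
central modulo `±1` has a cyclic centralizer of index at most two, and an element outside the
centralizer has trace zero. -/
lemma centralExtensionsSplit_of_isPGroup [IsAlgClosed k] [CharZero k] {P : Type u} [Group P]
    [Finite P] (j : P →* SL(2, k)) (hj : Function.Injective j) (p : ℕ) [Fact p.Prime]
    (hP : IsPGroup p P) : CentralExtensionsSplit k P := by
  by_cases hcyc : IsCyclic P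
  · exact centralExtensionsSplit_of_isCyclic P
  have hnormal : (Subgroup.zpowers (-1 : SL(2, k))).Normal := ⟨fun x hx g => by
    rw [mem_zpowers_neg_one] at hx ⊢
    rcases hx with rfl | rfl <;> simp⟩
  let Z : Subgroup P := (Subgroup.zpowers (-1 : SL(2, k))).comap j
  have hZ : ∀ x, x ∈ Z ↔ j x = 1 ∨ j x = -1 := fun x => mem_zpowers_neg_one (j x)
  have : Nontrivial (P ⧸ Z) := by
    rw [QuotientGroup.nontrivial_iff]
    intro htop
    refine hcyc (isCyclic_of_injective (j.codRestrict (Subgroup.zpowers (-1 : SL(2, k)))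
      fun x => ?_) fun x y hxy => hj (congrArg Subtype.val hxy))
    have : x ∈ Z := by rw [htop]; trivial
    exact this
  have := (hP.to_quotient Z).center_nontrivial
  obtain ⟨⟨q, hq⟩, hq1⟩ := exists_ne (1 : Subgroup.center (P ⧸ Z))
  obtain ⟨z, rfl⟩ := QuotientGroup.mk_surjective q
  have hz1 : z ∉ Z := fun hz => hq1 (Subtype.ext ((QuotientGroup.eq_one_iff z).mpr hz))
  have hzns : ∀ c : k, (j z : Matrix (Fin 2) (Fin 2) k) ≠ c • (1 : Matrix (Fin 2) (Fin 2) k) :=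
    fun c hc => hz1 ((hZ z).mpr (sl2_eq_one_or_neg_one_of_scalar _ c hc))
  have hpm : ∀ g, j g * j z = j z * j g ∨ j g * j z = -(j z * j g) := by
    intro g
    have h1 : (QuotientGroup.mk (g * z * (z * g)⁻¹) : P ⧸ Z) = 1 := by
      rw [QuotientGroup.mk_mul, QuotientGroup.mk_inv, mul_inv_eq_one, QuotientGroup.mk_mul,
        QuotientGroup.mk_mul]
      exact (Subgroup.mem_center_iff.mp hq) _
    rw [QuotientGroup.eq_one_iff, hZ, map_mul, map_inv, mul_inv_eq_one, mul_inv_eq_iff_eq_mul,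
      map_mul, map_mul] at h1
    simpa using h1
  let A : Subgroup P := Subgroup.centralizer {z}
  have hA : ∀ g, g ∈ A ↔ j g * j z = j z * j g := fun g => by
    rw [Subgroup.mem_centralizer_singleton_iff, ← map_mul, ← map_mul, hj.eq_iff, eq_comm]
  have hA' : ∀ g, g ∉ A → j g * j z = -(j z * j g) := fun g hg =>
    (hpm g).resolve_left fun h => hg ((hA g).mpr h)
  have hAcyc : IsCyclic A := isCyclic_of_commute_nonscalar (j.comp A.subtype)
    (hj.comp Subtype.val_injective) _ hzns fun a => by
      have := (hA a).mp a.2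
      exact congrArg Subtype.val this
  -- elements outside the centralizer square to `-1`
  have hsq : ∀ g, g ∉ A → j g ^ 2 = -1 := fun g hg => by
    apply sl2_sq_of_trace_eq_zero
    have h1 : j z * j g * (j z)⁻¹ = - j g := by
      rw [← neg_eq_iff_eq_neg.mpr (hA' g hg), neg_mul_eq_neg_mul, ← neg_mul_eq_neg_mul]
      simp
    have h2 := congrArg (fun y : SL(2, k) => (y : Matrix (Fin 2) (Fin 2) k).trace) h1
    simp only [Matrix.SpecialLinearGroup.coe_mul, Matrix.SpecialLinearGroup.coe_neg,
      Matrix.trace_neg] at h2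
    rw [Matrix.trace_mul_comm, ← mul_assoc, ← Matrix.SpecialLinearGroup.coe_mul,
      inv_mul_cancel, Matrix.SpecialLinearGroup.coe_one, one_mul] at h2
    exact self_eq_neg.mp h2
  obtain ⟨⟨a, haA⟩, ha⟩ := hAcyc.exists_generator
  have haA' : A = Subgroup.zpowers a := by
    ext x
    constructor
    · intro hx
      obtain ⟨i, hi⟩ := ha ⟨x, hx⟩
      exact ⟨i, congrArg Subtype.val hi⟩
    · rintro ⟨i, rfl⟩
      exact A.zpow_mem haA i
  -- `a` generates the centralizer and `b` lies outside it
  obtain ⟨b, hb⟩ : ∃ b, b ∉ A := by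
    by_contra! hall
    exact hcyc ⟨a, fun x => (haA' ▸ hall x : x ∈ Subgroup.zpowers a)⟩
  have hb2 : b ^ 2 ∈ Subgroup.zpowers a := by
    rw [← haA', hA, map_pow, hsq b hb]; simp
  have hb21 : b ^ 2 ≠ 1 := fun h => by
    have := hsq b hb
    rw [← map_pow, h, map_one] at this
    exact neg_one_ne_one_sl2 this.symm
  have hb4 : (b ^ 2) ^ 2 = 1 := hj (by rw [map_pow, map_pow, hsq b hb]; simp)
  classical
  rw [mem_zpowers_iff_mem_range_orderOf, Finset.mem_image] at hb2
  obtain ⟨l, hl, hbl⟩ := hb2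
  rw [Finset.mem_range] at hl
  have hl0 : l ≠ 0 := by rintro rfl; exact hb21 (by rw [← hbl, pow_zero])
  have hord : orderOf a = 2 * l := by
    have h1 : orderOf a ∣ 2 * l := by
      rw [orderOf_dvd_iff_pow_eq_one, mul_comm, pow_mul, hbl, hb4]
    obtain ⟨c, hc⟩ := h1
    have hc1 : c = 1 := by
      have : c < 2 := by
        by_contra! h2
        nlinarith
      have : c ≠ 0 := by rintro rfl; omega
      omega
    rw [hc, hc1, mul_one]
  have hgen : ∀ g : P, g ∈ A ∨ g * b⁻¹ ∈ A := fun g => by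
    by_cases hg : g ∈ A
    · exact .inl hg
    · refine .inr ((hA _).mpr ?_)
      have h1 := hA' g hg
      have h2 : (j b)⁻¹ * j z = -(j z * (j b)⁻¹) := by
        rw [inv_mul_eq_iff_eq_mul, mul_neg, ← mul_assoc, hA' b hb]
        simp
      rw [map_mul, map_inv, mul_assoc, h2, mul_neg, ← mul_assoc, h1]
      simp [mul_assoc]
  refine centralExtensionsSplit_of_quaternion P a b l hord (haA' ▸ hb) ?_ hbl.symm
    (haA' ▸ hgen)
  have hba : b * a ∉ A := fun h => hb (by
    have := A.mul_mem h (A.inv_mem haA)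
    rwa [mul_inv_cancel_right] at this)
  have h1 : (b * a) ^ 2 = b ^ 2 := hj (by rw [map_pow, map_pow, hsq _ hba, hsq _ hb])
  have h2 : a * b * a = b := by
    have : b * (a * b * a) = b * b := by rw [← pow_two b, ← h1, pow_two]; group
    exact mul_left_cancel this
  rw [mul_inv_eq_iff_eq_mul, eq_inv_mul_iff_mul_eq, ← mul_assoc, h2]

/-- The group `H²(L, kˣ)` vanishes for finite subgroups `L` of `SL₂`. -/
lemma centralExtensionsSplit_of_finite [IsAlgClosed k] [CharZero k] (G₁ : Subgroup SL(2, k))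
    [Finite G₁] : CentralExtensionsSplit k G₁ := by
  refine centralExtensionsSplit_of_sylow G₁ fun p hp P => ?_
  have : Fact p.Prime := ⟨hp⟩
  exact centralExtensionsSplit_of_isPGroup (G₁.subtype.comp (P : Subgroup G₁).subtype)
    (Subtype.val_injective.comp Subtype.val_injective) p P.isPGroup'

/-- A finite non-abelian subgroup of `SL₂` contains `-1`. Otherwise it has odd order, so that
squaring permutes it and `∑ tr(g²) = ∑ tr(g)`. As the representation on `k²` is irreducible, the
second sum vanishes and `∑ tr(g)²` is the order of the group, which contradicts
`tr(g²) = tr(g)² - 2`. -/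
lemma neg_one_mem_of_nonabelian [IsAlgClosed k] [CharZero k] (G₁ : Subgroup SL(2, k)) [Finite G₁]
    (hG₁ : ∃ x y : G₁, x * y ≠ y * x) : (-1 : SL(2, k)) ∈ G₁ := by
  classical
  by_contra hneg
  obtain ⟨x₀, y₀, hxy⟩ := hG₁
  have : Fintype G₁ := Fintype.ofFinite G₁
  let M : G₁ → Matrix (Fin 2) (Fin 2) k := fun g => (g : SL(2, k))
  have hM : ∀ g h, M (g * h) = M g * M h := fun g h => rfl
  have hM1 : M 1 = 1 := rfl
  have hodd : (Nat.card G₁).Coprime 2 := by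
    rw [Nat.coprime_comm, Nat.Prime.coprime_iff_not_dvd Nat.prime_two]
    intro h2
    have : Fact (Nat.Prime 2) := ⟨Nat.prime_two⟩
    obtain ⟨x, hx⟩ := exists_prime_orderOf_dvd_card' (G := G₁) 2 h2
    have hx2 : x ^ 2 = 1 := orderOf_dvd_iff_pow_eq_one.mp hx.dvd
    rcases sl2_sq_eq_one (x : SL(2, k)) (congrArg Subtype.val hx2) with h | h
    · have : x = 1 := Subtype.ext h
      rw [this, orderOf_one] at hx
      omega
    · exact hneg (h ▸ x.2)
  -- the columns of the sum are fixed vectors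
  have hsum : ∑ g, M g = 0 := by
    by_contra hS
    obtain ⟨i, j, hij⟩ : ∃ i j, (∑ g, M g) i j ≠ 0 := by
      by_contra! hall
      exact hS (Matrix.ext hall)
    have hfix : ∀ h : G₁, M h * ∑ g, M g = ∑ g, M g := fun h => by
      rw [Finset.mul_sum]
      exact Fintype.sum_equiv (Equiv.mulLeft h) _ _ fun g => (hM h g).symm
    have hone : ∀ h : G₁, h = 1 := fun h => by
      have hv : (∑ g, M g).mulVec (Pi.single j 1) ≠ 0 := fun h0 => hij (by
        have := congrFun h0 i
        rwa [Matrix.mulVec_single_one] at this)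
      have := sl2_eq_one_of_fixed (h : SL(2, k)) (orderOf h) (orderOf_pos h)
        (congrArg Subtype.val (pow_orderOf_eq_one h)) _ hv (by
          rw [Matrix.mulVec_mulVec]
          exact congrArg (fun N => Matrix.mulVec N (Pi.single j 1)) (hfix h))
      exact Subtype.ext this
    exact hxy (by rw [hone x₀, hone y₀])
  have hscalar : ∀ z : Matrix (Fin 2) (Fin 2) k, (∀ g, M g * z = z * M g) → ∃ c : k, z = c • 1 := by
    intro z hz
    by_contra! hall
    have := isCyclic_of_commute_nonscalar G₁.subtype Subtype.val_injective z hall hz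
    exact hxy (IsCyclic.commGroup.mul_comm x₀ y₀)
  -- the averages of the matrix units are scalar
  have havg : ∀ i j : Fin 2, ∃ c : k,
      ∑ g, M g * Matrix.single i j 1 * M g⁻¹ = c • (1 : Matrix (Fin 2) (Fin 2) k) := by
    intro i j
    refine hscalar _ fun h => ?_
    rw [Finset.mul_sum, Finset.sum_mul]
    refine Fintype.sum_equiv (Equiv.mulLeft h) _ _ fun g => ?_
    simp only [Equiv.coe_mulLeft, mul_inv_rev, hM, mul_assoc]
    rw [← hM h⁻¹ h, inv_mul_cancel, hM1, mul_one]
  choose c hc using havg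
  -- taking traces determines these scalars
  have hctr : ∀ i j, c i j * 2 = Fintype.card G₁ * if i = j then 1 else 0 := by
    intro i j
    have := congrArg Matrix.trace (hc i j)
    rw [Matrix.trace_smul, Matrix.trace_one, Matrix.trace_sum] at this
    simp only [Fintype.card_fin, smul_eq_mul, Nat.cast_ofNat] at this
    rw [← this]
    rw [Finset.sum_congr rfl fun g _ => (show _ = if i = j then (1 : k) else 0 by
      rw [Matrix.trace_mul_comm, ← mul_assoc, ← hM, inv_mul_cancel, hM1, one_mul]
      split_ifs with h
      · rw [h, Matrix.trace_single_eq_same]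
      · rw [Matrix.trace_single_eq_of_ne _ _ _ h])]
    simp
  have htr_inv : ∀ g, (M g⁻¹).trace = (M g).trace := fun g => by
    change (((g : SL(2, k))⁻¹ : SL(2, k)) : Matrix (Fin 2) (Fin 2) k).trace = _
    rw [Matrix.SpecialLinearGroup.coe_inv, Matrix.adjugate_fin_two, Matrix.trace_fin_two,
      Matrix.trace_fin_two]
    simp [M, add_comm]
  have h1 : ∑ g, (M g).trace * (M g).trace = Fintype.card G₁ := by
    have hentry : ∀ g, ∀ i j : Fin 2,
        (M g * Matrix.single i j 1 * M g⁻¹ : Matrix (Fin 2) (Fin 2) k) i j =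
        M g i i * M g⁻¹ j j := fun g i j => by
      fin_cases i <;> fin_cases j <;>
        simp [Matrix.mul_apply, Fin.sum_univ_two, Matrix.single_apply]
    have h2 : ∀ i j : Fin 2, ∑ g, M g i i * M g⁻¹ j j = if i = j then c i j else 0 := fun i j => by
      have := congrFun (congrFun (hc i j) i) j
      rw [Matrix.sum_apply] at this
      simp only [hentry] at this
      rw [this, Matrix.smul_apply, Matrix.one_apply, smul_eq_mul, mul_ite, mul_one, mul_zero]
    calc ∑ g, (M g).trace * (M g).trace = ∑ g, (M g).trace * (M g⁻¹).trace := by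
          simp only [htr_inv]
      _ = ∑ i, ∑ j, ∑ g, M g i i * M g⁻¹ j j := by
          simp only [Fin.sum_univ_two, ← Finset.sum_add_distrib, Matrix.trace_fin_two]
          exact Finset.sum_congr rfl fun g _ => by ring
      _ = c 0 0 + c 1 1 := by simp [h2, Fin.sum_univ_two]
      _ = Fintype.card G₁ := by
          have h00 := hctr 0 0
          have h11 := hctr 1 1
          simp only [if_true, mul_one] at h00 h11
          have : (2 : k) ≠ 0 := two_ne_zero
          apply mul_right_cancel₀ this
          rw [add_mul, h00, h11, mul_two]
  have h3 : ∑ g, ((M g).trace * (M g).trace - 2) = 0 := by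
    rw [← Matrix.trace_zero (n := Fin 2) (R := k), ← hsum, Matrix.trace_sum]
    refine Fintype.sum_equiv (powCoprime hodd) _ _ fun g => ?_
    change _ = (M (g ^ 2)).trace
    rw [pow_two, hM, sl2_mul_self, Matrix.trace_sub, Matrix.trace_smul, Matrix.trace_one]
    simp [M]
  rw [Finset.sum_sub_distrib, h1] at h3
  simp only [Finset.sum_const, Finset.card_univ, nsmul_eq_mul] at h3
  have : (Fintype.card G₁ : k) = 0 := by linear_combination -h3
  exact Fintype.card_ne_zero (Nat.cast_eq_zero.mp this)

end SLTwo

/-! ### Commutators and cohomology classes in central extensions -/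

section Cohomology

variable {k : Type u} [Field k]

namespace CentralExt

variable {G : Subgroup (GL (Fin 2) k)} {α : groupCohomology.cocycles₂ (unitsRep G)}

lemma incl_mul (c : kˣ) (x : CentralExt α) : incl α c * x = ⟨c * x.coeff, x.base⟩ := by
  refine CentralExt.ext ?_ (one_mul _)
  change c * (cocycleVal α 1 1)⁻¹ * x.coeff * cocycleVal α 1 x.base = c * x.coeff
  rw [val_one_left x.base]
  calc _ = c * x.coeff * ((cocycleVal α 1 1)⁻¹ * cocycleVal α 1 1) := by ac_rfl
    _ = _ := by rw [inv_mul_cancel, mul_one]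

lemma mul_incl (c : kˣ) (x : CentralExt α) : x * incl α c = ⟨c * x.coeff, x.base⟩ := by
  refine CentralExt.ext ?_ (mul_one _)
  change x.coeff * (c * (cocycleVal α 1 1)⁻¹) * cocycleVal α x.base 1 = c * x.coeff
  rw [val_one_right x.base]
  calc _ = c * x.coeff * ((cocycleVal α 1 1)⁻¹ * cocycleVal α 1 1) := by ac_rfl
    _ = _ := by rw [inv_mul_cancel, mul_one]

lemma isCentralExtension (α : groupCohomology.cocycles₂ (unitsRep G)) :
    IsCentralExtension (incl α) (proj α) where
  injective a b h := mul_right_cancel (congrArg CentralExt.coeff h)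
  surjective g := ⟨⟨1, g⟩, rfl⟩
  map_incl _ := rfl
  exists_incl x hx := ⟨x.coeff * cocycleVal α 1 1,
    CentralExt.ext (mul_inv_cancel_right _ _) (Eq.symm hx)⟩
  central c x := by rw [incl_mul, mul_incl]

/-- Lifts of commuting elements of `G` commute up to the antisymmetrization of the cocycle. -/
lemma mul_comm_of_base (x y : CentralExt α) (h : x.base * y.base = y.base * x.base) :
    x * y = incl α (cocycleVal α x.base y.base * (cocycleVal α y.base x.base)⁻¹) * (y * x) := by
  rw [incl_mul]
  refine CentralExt.ext ?_ h
  change x.coeff * y.coeff * cocycleVal α x.base y.base =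
    cocycleVal α x.base y.base * (cocycleVal α y.base x.base)⁻¹ *
      (y.coeff * x.coeff * cocycleVal α y.base x.base)
  calc _ = cocycleVal α x.base y.base * (y.coeff * x.coeff) *
        ((cocycleVal α y.base x.base)⁻¹ * cocycleVal α y.base x.base) := by
          rw [inv_mul_cancel, mul_one]; ac_rfl
    _ = _ := by ac_rfl

end CentralExt

/-- Two cocycles are cohomologous when their quotient is the coboundary of a function. -/
lemma h2π_eq_iff_exists {G : Subgroup (GL (Fin 2) k)}
    (α β : groupCohomology.cocycles₂ (unitsRep G)) :
    groupCohomology.H2π _ α = groupCohomology.H2π _ β ↔ ∃ a : G → kˣ, ∀ g h,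
      cocycleVal α g h = cocycleVal β g h * (a h * (a (g * h))⁻¹ * a g) := by
  rw [groupCohomology.H2π_eq_iff]
  constructor
  · rintro ⟨a, ha⟩
    refine ⟨fun g => Additive.toMul (a g : Additive kˣ), fun g h => ?_⟩
    have := congrArg Additive.toMul (congrFun ha (g, h) : (_ : Additive kˣ) = _)
    rw [← inv_mul_eq_iff_eq_mul, mul_comm]
    exact this.symm
  · rintro ⟨a, ha⟩
    refine ⟨fun g => (Additive.ofMul (a g) : Additive kˣ), funext fun ⟨g, h⟩ => ?_⟩
    have := ha g h
    rw [← inv_mul_eq_iff_eq_mul, mul_comm] at this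
    exact (congrArg Additive.ofMul this).symm

end Cohomology

/-! ### The cohomology of `μ_{2m} G₁` -/

section CoxeterGroup

variable {k : Type u} [Field k] {m : ℕ} {G₁ : Subgroup SL(2, k)}

/-- The surjection from `μ_{2m} × G₁` onto the group `μ_{2m} G₁`. -/
def coxeterMk (m : ℕ) (G₁ : Subgroup SL(2, k)) :
    rootsOfUnity (2 * m) k × G₁ →* coxeterGroup m G₁ :=
  ((scalarMul k).comp ((rootsOfUnity (2 * m) k).subtype.prodMap G₁.subtype)).codRestrict _
    fun p => ⟨(p.1, p.2), ⟨p.1.2, p.2.2⟩, rfl⟩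

lemma coe_coxeterMk (p : rootsOfUnity (2 * m) k × G₁) :
    (coxeterMk m G₁ p : GL (Fin 2) k) = Matrix.GeneralLinearGroup.scalar (Fin 2) (p.1 : kˣ) *
      Matrix.SpecialLinearGroup.toGL (p.2 : SL(2, k)) := rfl

lemma coxeterMk_surjective : Function.Surjective (coxeterMk m G₁) := by
  rintro ⟨_, ⟨⟨z, g⟩, ⟨hz, hg⟩, rfl⟩⟩
  exact ⟨(⟨z, hz⟩, ⟨g, hg⟩), rfl⟩

/-- The element `-1` of `μ_{2m}`. -/
def rootNegOne (k : Type u) [Field k] (m : ℕ) : rootsOfUnity (2 * m) k :=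
  ⟨-1, by rw [mem_rootsOfUnity, pow_mul]; simp⟩

/-- The kernel of `μ_{2m} × G₁ → μ_{2m} G₁` is generated by `(-1, -1)`. -/
lemma coxeterMk_eq_one (hneg : (-1 : SL(2, k)) ∈ G₁) (p : rootsOfUnity (2 * m) k × G₁)
    (h : coxeterMk m G₁ p = 1) : p = 1 ∨ p = (rootNegOne k m, ⟨-1, hneg⟩) := by
  obtain ⟨z, g⟩ := p
  have h1 : ((z : kˣ) : k) • ((g : SL(2, k)) : Matrix (Fin 2) (Fin 2) k) = 1 := by
    have := congrArg
      (fun x : coxeterGroup m G₁ => ((x : GL (Fin 2) k) : Matrix (Fin 2) (Fin 2) k)) h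
    simp only [coe_coxeterMk] at this
    rw [Matrix.smul_eq_diagonal_mul]
    exact this
  have h2 : ((g : SL(2, k)) : Matrix (Fin 2) (Fin 2) k) =
      ((z : kˣ) : k)⁻¹ • (1 : Matrix (Fin 2) (Fin 2) k) := by
    rw [← h1, inv_smul_smul₀ (Units.ne_zero _)]
  have key : ∀ e : k, ((g : SL(2, k)) : Matrix (Fin 2) (Fin 2) k) = e • 1 →
      ((z : kˣ) : k) * e = 1 := fun e he => by
    rw [he, smul_smul] at h1
    have := congrFun (congrFun h1 0) 0
    simpa using this
  rcases sl2_eq_one_or_neg_one_of_scalar _ _ h2 with hg | hg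
  · have := key 1 (by rw [hg]; simp)
    refine .inl (Prod.ext (Subtype.ext (Units.ext ?_)) (Subtype.ext hg))
    simpa using this
  · have := key (-1) (by rw [hg]; simp)
    refine .inr (Prod.ext (Subtype.ext (Units.ext ?_)) (Subtype.ext hg))
    change ((z : kˣ) : k) = -1
    linear_combination -this

lemma coxeterMk_eq_iff (hneg : (-1 : SL(2, k)) ∈ G₁) {p q : rootsOfUnity (2 * m) k × G₁}
    (h : coxeterMk m G₁ p = coxeterMk m G₁ q) : q = p ∨ q = p * (rootNegOne k m, ⟨-1, hneg⟩) := by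
  have h1 : coxeterMk m G₁ (p⁻¹ * q) = 1 := by rw [map_mul, map_inv, h, inv_mul_cancel]
  rcases coxeterMk_eq_one hneg _ h1 with h | h
  · exact .inl (inv_mul_eq_one.mp h).symm
  · exact .inr (inv_mul_eq_iff_eq_mul.mp h)

lemma coxeterMk_negOne (hneg : (-1 : SL(2, k)) ∈ G₁) :
    coxeterMk m G₁ (rootNegOne k m, 1) = coxeterMk m G₁ (1, ⟨-1, hneg⟩) := by
  apply Subtype.ext
  ext i j
  simp [coe_coxeterMk, rootNegOne, Matrix.GeneralLinearGroup.scalar]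

/-- The squaring map `μ_{2m} → μ_m`. -/
def rootSq (k : Type u) [Field k] (m : ℕ) : rootsOfUnity (2 * m) k →* rootsOfUnity m k :=
  ((powMonoidHom 2).comp (rootsOfUnity (2 * m) k).subtype).codRestrict _ fun z => by
    have := z.2
    rw [mem_rootsOfUnity, pow_mul] at this
    exact this

lemma coe_rootSq (z : rootsOfUnity (2 * m) k) : (rootSq k m z : kˣ) = (z : kˣ) ^ 2 := rfl

lemma rootSq_surjective [IsAlgClosed k] : Function.Surjective (rootSq k m) := by
  intro w
  obtain ⟨c, h⟩ := exists_units_pow_eq (w : kˣ) two_pos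
  refine ⟨⟨c, ?_⟩, Subtype.ext h⟩
  rw [mem_rootsOfUnity, pow_mul, h]
  exact w.2

lemma rootSq_eq_one (z : rootsOfUnity (2 * m) k) (h : rootSq k m z = 1) :
    z = 1 ∨ z = rootNegOne k m := by
  have h1 : (z : kˣ) ^ 2 = 1 := congrArg Subtype.val h
  have h2 : ((z : kˣ) : k) ^ 2 = 1 := by rw [← Units.val_pow_eq_pow_val, h1, Units.val_one]
  rcases sq_eq_one_iff.mp h2 with h | h
  · exact .inl (Subtype.ext (Units.ext h))
  · exact .inr (Subtype.ext (Units.ext h))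

/-- The pairing `(z, g) ↦ η(z²)(g)` on `μ_{2m} × G₁`. -/
def rootPairing (η : rootsOfUnity m k →* ((G₁ ⧸ negOneSubgroup G₁) →* kˣ))
    (z : rootsOfUnity (2 * m) k) (g : G₁) : kˣ :=
  η (rootSq k m z) (QuotientGroup.mk g)

section Pairing

variable (η : rootsOfUnity m k →* ((G₁ ⧸ negOneSubgroup G₁) →* kˣ))

lemma rootPairing_mul_left (z z' : rootsOfUnity (2 * m) k) (g : G₁) :
    rootPairing η (z * z') g = rootPairing η z g * rootPairing η z' g := by
  simp [rootPairing]

lemma rootPairing_mul_right (z : rootsOfUnity (2 * m) k) (g g' : G₁) :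
    rootPairing η z (g * g') = rootPairing η z g * rootPairing η z g' := by
  simp [rootPairing]

lemma rootPairing_one_left (g : G₁) : rootPairing η 1 g = 1 := by
  simp [rootPairing]

lemma rootPairing_negOne_left (g : G₁) : rootPairing η (rootNegOne k m) g = 1 := by
  have : rootSq k m (rootNegOne k m) = 1 :=
    Subtype.ext (by rw [coe_rootSq]; simp [rootNegOne])
  simp [rootPairing, this]

lemma rootPairing_negOne_right (hneg : (-1 : SL(2, k)) ∈ G₁) (z : rootsOfUnity (2 * m) k) :
    rootPairing η z ⟨-1, hneg⟩ = 1 := by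
  have : (QuotientGroup.mk (⟨-1, hneg⟩ : G₁) : G₁ ⧸ negOneSubgroup G₁) = 1 :=
    (QuotientGroup.eq_one_iff _).mpr (Subgroup.mem_zpowers (-1 : SL(2, k)))
  rw [rootPairing, this, map_one]

/-- The function `(z g, z' g') ↦ η(z²)(g')` on `μ_{2m} G₁`. It is defined by a choice of
preimages in `μ_{2m} × G₁`, on which it does not depend (`pairingVal_mk`). -/
def pairingVal (γ γ' : coxeterGroup m G₁) : kˣ :=
  rootPairing η (Function.surjInv coxeterMk_surjective γ).1
    (Function.surjInv coxeterMk_surjective γ').2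

lemma pairingVal_mk (hneg : (-1 : SL(2, k)) ∈ G₁) (p p' : rootsOfUnity (2 * m) k × G₁) :
    pairingVal η (coxeterMk m G₁ p) (coxeterMk m G₁ p') = rootPairing η p.1 p'.2 := by
  have h1 : ∀ q g, coxeterMk m G₁ p = coxeterMk m G₁ q →
      rootPairing η q.1 g = rootPairing η p.1 g := by
    intro q g h
    rcases coxeterMk_eq_iff hneg h with rfl | rfl
    · rfl
    · rw [Prod.fst_mul, rootPairing_mul_left, rootPairing_negOne_left, mul_one]
  have h2 : ∀ q z, coxeterMk m G₁ p' = coxeterMk m G₁ q →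
      rootPairing η z q.2 = rootPairing η z p'.2 := by
    intro q z h
    rcases coxeterMk_eq_iff hneg h with rfl | rfl
    · rfl
    · rw [Prod.snd_mul, rootPairing_mul_right, rootPairing_negOne_right, mul_one]
  rw [pairingVal, h1 _ _ (Function.surjInv_eq _ _).symm, h2 _ _ (Function.surjInv_eq _ _).symm]

/-- The 2-cocycle on `μ_{2m} G₁` defined by a pairing `η`. -/
def pairingCocycle (hneg : (-1 : SL(2, k)) ∈ G₁) :
    groupCohomology.cocycles₂ (unitsRep (coxeterGroup m G₁)) :=
  ⟨fun p => (Additive.ofMul (pairingVal η p.1 p.2) : Additive kˣ), by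
    rw [groupCohomology.mem_cocycles₂_iff]
    intro γ γ' γ''
    obtain ⟨p, rfl⟩ := coxeterMk_surjective γ
    obtain ⟨p', rfl⟩ := coxeterMk_surjective γ'
    obtain ⟨p'', rfl⟩ := coxeterMk_surjective γ''
    change Additive.ofMul (pairingVal η (_ * _) _ * pairingVal η _ _) =
      Additive.ofMul (pairingVal η _ _ * pairingVal η _ (_ * _))
    simp only [← map_mul, pairingVal_mk η hneg, Prod.fst_mul, Prod.snd_mul, rootPairing_mul_left,
      rootPairing_mul_right]
    ac_rfl⟩

lemma cocycleVal_pairingCocycle (hneg : (-1 : SL(2, k)) ∈ G₁)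
    (p p' : rootsOfUnity (2 * m) k × G₁) :
    cocycleVal (pairingCocycle η hneg) (coxeterMk m G₁ p) (coxeterMk m G₁ p') =
      rootPairing η p.1 p'.2 :=
  pairingVal_mk η hneg p p'

end Pairing

/-- The homomorphism from pairings to the second cohomology group. -/
def pairingClass (hneg : (-1 : SL(2, k)) ∈ G₁) :
    Additive (rootsOfUnity m k →* ((G₁ ⧸ negOneSubgroup G₁) →* kˣ)) →+
      HTwo (coxeterGroup m G₁) where
  toFun η := groupCohomology.H2π _ (pairingCocycle η.toMul hneg)
  map_zero' := by
    have h : pairingCocycle (m := m) (G₁ := G₁) 1 hneg = 0 := rfl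
    exact (congrArg _ h).trans (map_zero _)
  map_add' η η' := by
    rw [← map_add]
    rfl

/-- In the central extension of a cocycle cohomologous to the cocycle of `η`, the lifts of
`z ∈ μ_{2m}` and `g ∈ G₁` have the commutator `η(z²)(g)`. -/
lemma commutator_of_pairingClass (hneg : (-1 : SL(2, k)) ∈ G₁)
    (η : rootsOfUnity m k →* ((G₁ ⧸ negOneSubgroup G₁) →* kˣ))
    (α : groupCohomology.cocycles₂ (unitsRep (coxeterGroup m G₁)))
    (h : groupCohomology.H2π _ α = pairingClass hneg (Additive.ofMul η))
    (z : rootsOfUnity (2 * m) k) (g : G₁) (x y : CentralExt α)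
    (hx : CentralExt.proj α x = coxeterMk m G₁ (z, 1))
    (hy : CentralExt.proj α y = coxeterMk m G₁ (1, g)) :
    x * y = CentralExt.incl α (rootPairing η z g) * (y * x) := by
  have hx' : x.base = coxeterMk m G₁ (z, 1) := hx
  have hy' : y.base = coxeterMk m G₁ (1, g) := hy
  have hxy : x.base * y.base = y.base * x.base := by
    rw [hx', hy', ← map_mul, ← map_mul]; simp
  rw [CentralExt.mul_comm_of_base x y hxy]
  congr 2
  obtain ⟨a, ha⟩ := (h2π_eq_iff_exists α (pairingCocycle η hneg)).mp h
  rw [ha, ha, ← hxy, hx', hy', cocycleVal_pairingCocycle, cocycleVal_pairingCocycle,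
    rootPairing_one_left, one_mul, mul_inv_eq_iff_eq_mul]
  ac_rfl

/-- The commutators of lifts recover the pairing. -/
lemma pairingClass_injective [IsAlgClosed k] (hneg : (-1 : SL(2, k)) ∈ G₁) :
    Function.Injective (pairingClass (m := m) hneg) := by
  rw [injective_iff_map_eq_zero]
  intro η hη
  obtain ⟨η, rfl⟩ := Additive.ofMul.surjective η
  have h0 : groupCohomology.H2π _ (pairingCocycle (1 : rootsOfUnity m k →* _) hneg) =
      pairingClass hneg (Additive.ofMul η) := by
    rw [hη]
    exact map_zero (pairingClass (m := m) hneg)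
  have h1 : ∀ z g, rootPairing η z g = 1 := by
    intro z g
    have e1 := commutator_of_pairingClass hneg η _ h0 z g ⟨1, coxeterMk m G₁ (z, 1)⟩
      ⟨1, coxeterMk m G₁ (1, g)⟩ rfl rfl
    have e2 := commutator_of_pairingClass hneg 1 _ rfl z g ⟨1, coxeterMk m G₁ (z, 1)⟩
      ⟨1, coxeterMk m G₁ (1, g)⟩ rfl rfl
    have := mul_right_cancel (e1.symm.trans e2)
    exact (CentralExt.isCentralExtension _).injective this
  have h2 : η = 1 := by
    refine MonoidHom.ext fun w => MonoidHom.ext fun g => ?_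
    obtain ⟨z, rfl⟩ := rootSq_surjective w
    obtain ⟨g, rfl⟩ := QuotientGroup.mk_surjective g
    exact h1 z g
  rw [h2]
  rfl

/-- A bimultiplicative map on `μ_{2m} × G₁` which is trivial on `-1` on both sides comes from a
pairing of `μ_m` with `G₁ / ⟨-1⟩`. -/
lemma exists_rootPairing [IsAlgClosed k] (hneg : (-1 : SL(2, k)) ∈ G₁)
    (c : rootsOfUnity (2 * m) k →* (G₁ →* kˣ)) (h1 : ∀ g, c (rootNegOne k m) g = 1)
    (h2 : ∀ z, c z ⟨-1, hneg⟩ = 1) :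
    ∃ η : rootsOfUnity m k →* ((G₁ ⧸ negOneSubgroup G₁) →* kˣ),
      ∀ z g, rootPairing η z g = c z g := by
  have hker : ∀ z, negOneSubgroup G₁ ≤ (c z).ker := by
    intro z g hg
    have hg' : (g : SL(2, k)) ∈ Subgroup.zpowers (-1 : SL(2, k)) := hg
    rw [mem_zpowers_neg_one] at hg'
    rcases hg' with hg' | hg'
    · have : g = 1 := Subtype.ext hg'
      rw [this]; exact one_mem _
    · have : g = ⟨-1, hneg⟩ := Subtype.ext hg'
      rw [this]; exact h2 z
  let c' : rootsOfUnity (2 * m) k →* ((G₁ ⧸ negOneSubgroup G₁) →* kˣ) :=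
    { toFun := fun z => QuotientGroup.lift _ (c z) (hker z)
      map_one' := by
        refine MonoidHom.ext fun g => ?_
        obtain ⟨g, rfl⟩ := QuotientGroup.mk_surjective g
        simp
      map_mul' := fun z z' => by
        refine MonoidHom.ext fun g => ?_
        obtain ⟨g, rfl⟩ := QuotientGroup.mk_surjective g
        simp }
  have hc' : ∀ z g, c' z (QuotientGroup.mk g) = c z g := fun z g => rfl
  have hk : (rootSq k m).ker ≤ c'.ker := by
    intro z hz
    rcases rootSq_eq_one z hz with rfl | rfl
    · exact one_mem _
    · refine MonoidHom.ext fun g => ?_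
      obtain ⟨g, rfl⟩ := QuotientGroup.mk_surjective g
      exact (hc' _ _).trans (h1 g)
  refine ⟨MonoidHom.liftOfSurjective (rootSq k m) rootSq_surjective ⟨c', hk⟩, fun z g => ?_⟩
  have := MonoidHom.liftOfRightInverse_comp_apply (rootSq k m) _
    (Function.rightInverse_surjInv rootSq_surjective) ⟨c', hk⟩ z
  rw [rootPairing, MonoidHom.liftOfSurjective, this, hc']

/-- Both `G₁` and `μ_{2m}` lift to a central extension of `μ_{2m} G₁`, in such a way that the two
lifts of `-1` agree. -/
lemma exists_lifts [IsAlgClosed k] [CharZero k] [Finite G₁] (hm : 0 < m)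
    (hneg : (-1 : SL(2, k)) ∈ G₁)
    (α : groupCohomology.cocycles₂ (unitsRep (coxeterGroup m G₁))) :
    ∃ (s : G₁ →* CentralExt α) (t : rootsOfUnity (2 * m) k →* CentralExt α),
      (∀ g, CentralExt.proj α (s g) = coxeterMk m G₁ (1, g)) ∧
      (∀ z, CentralExt.proj α (t z) = coxeterMk m G₁ (z, 1)) ∧
      t (rootNegOne k m) = s ⟨-1, hneg⟩ := by
  have hE := CentralExt.isCentralExtension α
  have : NeZero (2 * m) := ⟨by omega⟩
  obtain ⟨s, hs⟩ := hE.exists_lift (centralExtensionsSplit_of_finite G₁)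
    ((coxeterMk m G₁).comp (MonoidHom.inr _ _))
  obtain ⟨t, ht⟩ := hE.exists_lift (centralExtensionsSplit_of_isCyclic (rootsOfUnity (2 * m) k))
    ((coxeterMk m G₁).comp (MonoidHom.inl _ _))
  have hs' : ∀ g, CentralExt.proj α (s g) = coxeterMk m G₁ (1, g) := hs
  have ht' : ∀ z, CentralExt.proj α (t z) = coxeterMk m G₁ (z, 1) := ht
  -- the two lifts of `-1` have trivial square, hence differ by a sign `c`
  obtain ⟨c, hc⟩ := hE.exists_incl (t (rootNegOne k m) * (s ⟨-1, hneg⟩)⁻¹) (by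
    rw [map_mul, map_inv, hs', ht', coxeterMk_negOne hneg, mul_inv_cancel])
  rw [eq_mul_inv_iff_mul_eq] at hc
  have hc2 : c ^ 2 = 1 := by
    have h1 : (t (rootNegOne k m)) ^ 2 = 1 := by
      rw [← map_pow, ← map_one t]
      congr 1
      exact Subtype.ext (by simp [rootNegOne])
    have h2 : (s ⟨-1, hneg⟩) ^ 2 = 1 := by
      rw [← map_pow, ← map_one s]
      congr 1
      exact Subtype.ext (by simp)
    have hcomm : Commute (CentralExt.incl α c) (s ⟨-1, hneg⟩) := hE.central _ _
    rw [← hc, hcomm.mul_pow, h2, mul_one, ← map_pow] at h1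
    exact hE.injective (by rw [h1, map_one])
  have hc3 : c = 1 ∨ c = -1 := by
    have h2 : (c : k) ^ 2 = 1 := by rw [← Units.val_pow_eq_pow_val, hc2, Units.val_one]
    exact (sq_eq_one_iff.mp h2).imp (fun h => Units.ext h) (fun h => Units.ext h)
  rcases hc3 with rfl | rfl
  · exact ⟨s, t, hs', ht', by rw [← hc, map_one, one_mul]⟩
  · -- the sign is corrected by the tautological character of `μ_{2m}`
    refine ⟨s, MonoidHom.mk' (fun z => CentralExt.incl α (z : kˣ) * t z) fun z z' => ?_, hs',
      fun z => ?_, ?_⟩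
    · rw [map_mul, Subgroup.coe_mul, map_mul, mul_assoc, mul_assoc, ← mul_assoc (t z),
        ← hE.central, mul_assoc]
    · change CentralExt.proj α (CentralExt.incl α (z : kˣ) * t z) = _
      rw [map_mul, hE.map_incl, one_mul, ht']
    · change CentralExt.incl α (-1 : kˣ) * t (rootNegOne k m) = _
      rw [← hc, ← mul_assoc, ← map_mul]
      simp

/-- A central extension is determined up to equivalence by the commutators of the lifts of
`μ_{2m}` and `G₁`. -/
lemma pairingClass_surjective [IsAlgClosed k] [CharZero k] [Finite G₁] (hm : 0 < m)
    (hneg : (-1 : SL(2, k)) ∈ G₁) : Function.Surjective (pairingClass (m := m) hneg) := by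
  intro x
  induction x using groupCohomology.H2_induction_on with | _ α
  obtain ⟨s, t, hs, ht, hst⟩ := exists_lifts hm hneg α
  have hE := CentralExt.isCentralExtension α
  have ex : ∀ z g, ∃ c, CentralExt.incl α c * (s g * t z) = t z * s g := fun z g => by
    obtain ⟨c, hc⟩ := hE.exists_incl (t z * s g * (s g * t z)⁻¹) (by
      rw [map_mul, map_inv, map_mul, map_mul, hs, ht, ← map_mul, ← map_mul, mul_inv_eq_one]
      simp)
    exact ⟨c, by rw [hc, inv_mul_cancel_right]⟩
  -- the commutators of the lifts define a pairing
  choose c hc using ex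
  have huniq : ∀ z g d, CentralExt.incl α d * (s g * t z) = t z * s g → c z g = d :=
    fun z g d hd => hE.injective (mul_right_cancel ((hc z g).trans hd.symm))
  let C : rootsOfUnity (2 * m) k →* (G₁ →* kˣ) :=
    MonoidHom.mk' (fun z => MonoidHom.mk' (c z) fun g g' => huniq _ _ _ (by
      rw [map_mul, map_mul s, ← mul_assoc (t z), ← hc z g,
        mul_assoc (CentralExt.incl α (c z g)) (s g * t z), mul_assoc (s g) (t z), ← hc z g',
        ← mul_assoc (s g) (CentralExt.incl α _), ← hE.central _ (s g)]
      simp only [mul_assoc])) fun z z' => MonoidHom.ext fun g => huniq _ _ _ (by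
      change CentralExt.incl α (c z g * c z' g) * _ = _
      rw [mul_comm (c z g), map_mul (CentralExt.incl α), map_mul t, mul_assoc (t z), ← hc z' g,
        ← mul_assoc (t z) (CentralExt.incl α _), ← hE.central _ (t z),
        mul_assoc (CentralExt.incl α _) (t z), ← mul_assoc (t z) (s g), ← hc z g]
      simp only [mul_assoc])
  obtain ⟨η, hη⟩ := exists_rootPairing hneg C (fun g => huniq _ _ _ (by
      rw [map_one, one_mul, hst, ← map_mul, ← map_mul]
      congr 1
      exact Subtype.ext (by simp))) (fun z => huniq _ _ _ (by
      rw [map_one, one_mul, ← hst, ← map_mul, ← map_mul, mul_comm z]))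
  have hη' : ∀ z g, CentralExt.incl α (rootPairing η z g) * (s g * t z) = t z * s g := fun z g => by
    rw [hη]; exact hc z g
  refine ⟨Additive.ofMul η, ?_⟩
  refine (((h2π_eq_iff_exists α (pairingCocycle η hneg)).mpr ?_)).symm
  -- since the lifts of `-1` agree, `z g ↦ s g * t z` is a well-defined section, and its cocycle
  -- is that of `η`
  let w : coxeterGroup m G₁ → CentralExt α := fun γ =>
    s (Function.surjInv coxeterMk_surjective γ).2 * t (Function.surjInv coxeterMk_surjective γ).1
  have hw : ∀ p, w (coxeterMk m G₁ p) = s p.2 * t p.1 := by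
    intro p
    have key : ∀ q, coxeterMk m G₁ p = coxeterMk m G₁ q → s q.2 * t q.1 = s p.2 * t p.1 := by
      intro q h
      rcases coxeterMk_eq_iff hneg h with rfl | rfl
      · rfl
      · have : (⟨-1, hneg⟩ * ⟨-1, hneg⟩ : G₁) = 1 := Subtype.ext (by simp)
        change s (p.2 * ⟨-1, hneg⟩) * t (p.1 * rootNegOne k m) = _
        rw [mul_comm p.1, map_mul t, hst, ← mul_assoc, ← map_mul s, mul_assoc p.2, this, mul_one]
    exact key _ (Function.surjInv_eq _ _).symm
  have hbase : ∀ γ, (w γ).base = γ := by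
    intro γ
    obtain ⟨p, rfl⟩ := coxeterMk_surjective γ
    rw [hw]
    change CentralExt.proj α (s p.2 * t p.1) = _
    rw [map_mul, hs, ht, ← map_mul]
    simp
  refine ⟨fun γ => (w γ).coeff⁻¹, fun γ γ' => ?_⟩
  have hmul : w γ * w γ' =
      CentralExt.incl α (cocycleVal (pairingCocycle η hneg) γ γ') * w (γ * γ') := by
    obtain ⟨p, rfl⟩ := coxeterMk_surjective γ
    obtain ⟨p', rfl⟩ := coxeterMk_surjective γ'
    rw [cocycleVal_pairingCocycle, ← map_mul, hw, hw, hw, Prod.fst_mul, Prod.snd_mul, map_mul,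
      map_mul, mul_assoc, ← mul_assoc (t p.1), ← hη', mul_assoc, ← mul_assoc (s p.2),
      ← hE.central]
    simp only [mul_assoc]
  rw [CentralExt.incl_mul] at hmul
  have := congrArg CentralExt.coeff hmul
  change (w γ).coeff * (w γ').coeff * cocycleVal α (w γ).base (w γ').base =
    cocycleVal (pairingCocycle η hneg) γ γ' * (w (γ * γ')).coeff at this
  rw [hbase, hbase] at this
  beta_reduce
  rw [inv_inv, ← mul_left_cancel_iff (a := (w γ).coeff * (w γ').coeff), this]
  calc _ = cocycleVal (pairingCocycle η hneg) γ γ' * (w (γ * γ')).coeff *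
        ((w γ).coeff * (w γ).coeff⁻¹) * ((w γ').coeff * (w γ').coeff⁻¹) := by
          rw [mul_inv_cancel, mul_inv_cancel, mul_one, mul_one]
    _ = _ := by ac_rfl

/-- The isomorphism of the second cohomology group with the group of pairings. -/
def pairingEquiv [IsAlgClosed k] [CharZero k] [Finite G₁] (hm : 0 < m)
    (hneg : (-1 : SL(2, k)) ∈ G₁) : HTwo (coxeterGroup m G₁) ≃+
      Additive (rootsOfUnity m k →* ((G₁ ⧸ negOneSubgroup G₁) →* kˣ)) :=
  (AddEquiv.ofBijective (pairingClass hneg)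
    ⟨pairingClass_injective hneg, pairingClass_surjective hm hneg⟩).symm

end CoxeterGroup

/-! ### Quotients of quivers by free actions -/

section FreeQuotient

lemma quot_mk_perm_eq_iff {X : Type*} (e : Equiv.Perm X) (a b : X) :
    Quot.mk (fun x y => e x = y) a = Quot.mk (fun x y => e x = y) b ↔
      ∃ n : ℤ, (e ^ n) a = b := by
  constructor
  · intro h
    replace h := Quot.eqvGen_exact h
    induction h with
    | rel x y h => exact ⟨1, by simpa using h⟩
    | refl x => exact ⟨0, by simp⟩
    | symm x y _ ih =>
      obtain ⟨n, rfl⟩ := ih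
      exact ⟨-n, by rw [← Equiv.Perm.mul_apply, ← zpow_add]; simp⟩
    | trans x y z _ _ ih₁ ih₂ =>
      obtain ⟨n, rfl⟩ := ih₁
      obtain ⟨n', rfl⟩ := ih₂
      exact ⟨n' + n, by rw [zpow_add, Equiv.Perm.mul_apply]⟩
  · rintro ⟨n, rfl⟩
    have step : ∀ x, Quot.mk (fun x y => e x = y) x = Quot.mk (fun x y => e x = y) (e x) :=
      fun x => Quot.sound rfl
    induction n using Int.induction_on with
    | zero => simp
    | succ n ih => rw [ih, step, ← Equiv.Perm.mul_apply, ← zpow_one_add, add_comm]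
    | pred n ih =>
      rw [ih, step ((e ^ (-(n : ℤ) - 1)) a), ← Equiv.Perm.mul_apply, ← zpow_one_add]
      congr 3; ring

variable {V W : Type*} [Quiver V] [Quiver W] (θ : QuiverIso W W)

lemma QuiverIso.onTotal_bijective : Function.Bijective θ.onTotal := by
  constructor
  · rintro ⟨a, b, f⟩ ⟨a', b', f'⟩ h
    simp only [QuiverIso.onTotal, Quiver.Total.mk.injEq, EmbeddingLike.apply_eq_iff_eq] at h
    obtain ⟨rfl, rfl, h⟩ := h
    rw [(θ.onHom a b).injective (eq_of_heq h)]
  · rintro ⟨a, b, f⟩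
    obtain ⟨a, rfl⟩ := θ.onVert.surjective a
    obtain ⟨b, rfl⟩ := θ.onVert.surjective b
    obtain ⟨f, rfl⟩ := (θ.onHom a b).surjective f
    exact ⟨⟨a, b, f⟩, rfl⟩

/-- The permutation of the set of all arrows given by an automorphism. -/
def QuiverIso.totalPerm : Equiv.Perm (Quiver.Total W) :=
  Equiv.ofBijective θ.onTotal θ.onTotal_bijective

lemma QuiverIso.totalPerm_zpow_right (n : ℤ) (a : Quiver.Total W) :
    ((θ.totalPerm ^ n) a).right = ((θ.onVert : Equiv.Perm W) ^ n) a.right := by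
  have h1 : ∀ b, (θ.totalPerm b).right = θ.onVert b.right := fun b => rfl
  induction n using Int.induction_on with
  | zero => rfl
  | succ n ih =>
    rw [add_comm, zpow_one_add, zpow_one_add, Equiv.Perm.mul_apply, Equiv.Perm.mul_apply, h1, ih]
  | pred n ih =>
    apply θ.onVert.injective
    rw [← h1, ← Equiv.Perm.mul_apply, ← Equiv.Perm.mul_apply, ← zpow_one_add, ← zpow_one_add]
    simpa using ih

/-- A relation between a set and the vertices of a quiver which is preserved by an automorphism
and determines its first argument is also preserved by the inverse of the automorphism. -/
lemma QuiverIso.rel_zpow_iff {V : Type*} (R : V → W → Prop) (exists_left : ∀ w, ∃ v, R v w)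
    (left_unique : ∀ v v' w, R v w → R v' w → v = v') (map : ∀ v w, R v w → R v (θ.onVert w))
    (v : V) (w : W) (n : ℤ) : R v (((θ.onVert : Equiv.Perm W) ^ n) w) ↔ R v w := by
  have map_iff : ∀ v w, R v (θ.onVert w) ↔ R v w := fun v w => ⟨fun h => by
    obtain ⟨v', h'⟩ := exists_left w
    rwa [left_unique v v' _ h (map _ _ h')], map v w⟩
  induction n using Int.induction_on with
  | zero => rfl
  | succ n ih =>
    rw [add_comm, zpow_one_add, Equiv.Perm.mul_apply]
    exact (map_iff _ _).trans ih
  | pred n ih =>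
    refine (map_iff _ _).symm.trans (Iff.trans (Eq.to_iff (congrArg (R v) ?_)) ih)
    have h := Equiv.Perm.mul_apply (θ.onVert : Equiv.Perm W)
      ((θ.onVert : Equiv.Perm W) ^ (-(n : ℤ) - 1)) w
    rw [← zpow_one_add] at h
    rw [show 1 + (-(n : ℤ) - 1) = -n by ring] at h
    exact h.symm

/-- A criterion for a quiver `V` to be isomorphic to the quotient of a quiver `W` by an
automorphism `θ` all of whose powers act freely. The bijection on vertices is given by a relation
between `V` and `W` which identifies the vertices of `V` with the orbits in `W`. As the action is
free, each orbit of arrows with target the orbit of `w'` has exactly one member with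
target `w'`. -/
theorem nonempty_quiverIso_quotQuiver (R : V → W → Prop) (exists_right : ∀ v, ∃ w, R v w)
    (exists_left : ∀ w, ∃ v, R v w) (left_unique : ∀ v v' w, R v w → R v' w → v = v')
    (orbit : ∀ v w w', R v w → R v w' → ∃ n : ℤ, ((θ.onVert : Equiv.Perm W) ^ n) w = w')
    (map : ∀ v w, R v w → R v (θ.onVert w))
    (free : ∀ w (n : ℤ), ((θ.onVert : Equiv.Perm W) ^ n) w = w → n = 0)
    (arrows : ∀ v v' w', R v' w' → Nonempty ((v ⟶ v') ≃ {p : Σ w, (w ⟶ w') // R v p.1})) :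
    Nonempty (QuiverIso V (QuotQuiver θ)) := by
  have map_zpow := θ.rel_zpow_iff R exists_left left_unique map
  choose F hF using exists_right
  let mk : W → QuotQuiver θ := Quot.mk _
  have mk_eq : ∀ w w', mk w = mk w' ↔ ∃ n : ℤ, ((θ.onVert : Equiv.Perm W) ^ n) w = w' :=
    fun w w' => quot_mk_perm_eq_iff (θ.onVert : Equiv.Perm W) w w'
  have mk_F : ∀ v w, mk w = mk (F v) ↔ R v w := by
    intro v w
    rw [mk_eq]
    constructor
    · rintro ⟨n, hn⟩
      rw [← map_zpow v w n, hn]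
      exact hF v
    · exact fun h => orbit v w _ h (hF v)
  have bij : Function.Bijective fun v => mk (F v) := by
    constructor
    · intro v v' h
      exact left_unique v v' (F v) (hF v) ((mk_F v' (F v)).mp h)
    · intro x
      obtain ⟨w, rfl⟩ := Quot.exists_rep x
      obtain ⟨v, hv⟩ := exists_left w
      exact ⟨v, ((mk_F v w).mpr hv).symm⟩
  have hom : ∀ v v', Nonempty ((v ⟶ v') ≃ (mk (F v) ⟶ mk (F v'))) := by
    intro v v'
    obtain ⟨e⟩ := arrows v v' (F v') (hF v')
    have htgt : ∀ t : Quiver.Total W,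
        ArrowOrbit.target (θ := θ) (Quot.mk _ t) = mk t.right := fun t => rfl
    have orb : ∀ t t' : Quiver.Total W,
        (Quot.mk _ t : ArrowOrbit θ) = Quot.mk _ t' ↔ ∃ n : ℤ, (θ.totalPerm ^ n) t = t' :=
      fun t t' => quot_mk_perm_eq_iff θ.totalPerm t t'
    let f : {p : Σ w, (w ⟶ F v') // R v p.1} → (mk (F v) ⟶ mk (F v')) := fun p =>
      ⟨Quot.mk _ ⟨p.1.1, F v', p.1.2⟩, (mk_F v _).mpr p.2, rfl⟩
    refine ⟨e.trans (Equiv.ofBijective f ⟨?_, ?_⟩)⟩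
    · rintro ⟨⟨w, a⟩, ha⟩ ⟨⟨w', a'⟩, ha'⟩ h
      obtain ⟨n, hn⟩ := (orb _ _).mp (congrArg Subtype.val h)
      have h0 := θ.totalPerm_zpow_right n ⟨w, F v', a⟩
      rw [hn] at h0
      rw [free _ n h0.symm, zpow_zero] at hn
      simp only [Equiv.Perm.coe_one, id, Quiver.Total.mk.injEq, true_and] at hn
      obtain ⟨rfl, hn⟩ := hn
      rw [eq_of_heq hn]
    · rintro ⟨a, ha, ha'⟩
      obtain ⟨t, rfl⟩ := Quot.exists_rep a
      obtain ⟨n, hn⟩ := (mk_eq _ _).mp ((htgt t).symm.trans ha')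
      have ht : (Quot.mk _ t : ArrowOrbit θ) = Quot.mk _ ((θ.totalPerm ^ n) t) :=
        (orb _ _).mpr ⟨n, rfl⟩
      have hr := (θ.totalPerm_zpow_right n t).trans hn
      generalize (θ.totalPerm ^ n) t = t' at ht hr
      obtain ⟨w, w', b⟩ := t'
      obtain rfl : w' = F v' := hr
      refine ⟨⟨⟨w, b⟩, ?_⟩, Subtype.ext ht.symm⟩
      rw [← mk_F, ← ha, ht]
      rfl
  exact ⟨⟨Equiv.ofBijective _ bij, fun v v' => (hom v v').some⟩⟩

end FreeQuotient

/-! ### Weight spaces of representations of a twisted product -/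

section WeightSpaces

variable {k : Type u} [Field k] {E Q : Type u} [Group E] [Group Q]

lemma IrrRep.nontrivial {Γ : Type u} [Group Γ] (M : IrrRep k Γ) : Nontrivial M.carrier := by
  by_contra hns
  rw [not_nontrivial_iff_subsingleton] at hns
  obtain ⟨U, U', hUU'⟩ := M.irreducible.exists_pair_ne
  exact hUU' (Subrepresentation.toSubmodule_injective (Subsingleton.elim _ _))

/-- A group `E` generated by a central image of `kˣ`, a group `Q` and an element `τ` whose `N`-th
power is trivial, where `τ` commutes with `g ∈ Q` up to the scalar `χ g`; moreover `ζ` is a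
primitive `N`-th root of unity. -/
structure IsTwistedProduct (ι : kˣ →* E) (s : Q →* E) (τ : E) (ζ : kˣ) (χ : Q →* kˣ) (N : ℕ) :
    Prop where
  pos : 0 < N
  prim : IsPrimitiveRoot ζ N
  central : ∀ c x, ι c * x = x * ι c
  comm : ∀ g, τ * s g = ι (χ g) * (s g * τ)
  pow : τ ^ N = 1
  gen : ∀ x, ∃ c g, ∃ n : ℕ, x = ι c * (s g * τ ^ n)

variable {ι : kˣ →* E} {s : Q →* E} {τ : E} {ζ : kˣ} {χ : Q →* kˣ} {N : ℕ}
variable {A B : Type u} [AddCommGroup A] [Module k A] [AddCommGroup B] [Module k B]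

/-- The group `kˣ` acts by scalar multiplication. -/
def IsScalarOn (ι : kˣ →* E) (ρ : Representation k E A) : Prop :=
  ∀ c v, ρ (ι c) v = (c : k) • v

/-- The eigenspace of `τ` for the eigenvalue `a`. -/
def weightSpace (τ : E) (ρ : Representation k E A) (a : kˣ) : Submodule k A :=
  Module.End.eigenspace (ρ τ) (a : k)

lemma mem_weightSpace {ρ : Representation k E A} {a : kˣ} {v : A} :
    v ∈ weightSpace τ ρ a ↔ ρ τ v = (a : k) • v := Module.End.mem_eigenspace_iff

lemma pow_apply_of_mem_weightSpace {ρ : Representation k E A} {a : kˣ} {v : A}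
    (hv : v ∈ weightSpace τ ρ a) (n : ℕ) : ρ (τ ^ n) v = (a : k) ^ n • v := by
  induction n with
  | zero => simp
  | succ n ih => rw [pow_succ', map_mul, Module.End.mul_apply, ih, map_smul,
      mem_weightSpace.mp hv, smul_smul, pow_succ]

/-- The averaging projection onto the eigenspace of `τ` for the eigenvalue `a`. -/
def weightProj (τ : E) (N : ℕ) (ρ : Representation k E A) (a : kˣ) : A →ₗ[k] A :=
  (N : k)⁻¹ • ∑ n ∈ Finset.range N, ((a⁻¹ : kˣ) : k) ^ n • ρ (τ ^ n)

lemma weightProj_apply (ρ : Representation k E A) (a : kˣ) (v : A) :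
    weightProj τ N ρ a v =
      (N : k)⁻¹ • ∑ n ∈ Finset.range N, ((a⁻¹ : kˣ) : k) ^ n • ρ (τ ^ n) v := by
  simp [weightProj, LinearMap.sum_apply]

namespace IsTwistedProduct

lemma weightProj_mem (hE : IsTwistedProduct ι s τ ζ χ N) (ρ : Representation k E A) {a : kˣ}
    (ha : a ^ N = 1) (v : A) : weightProj τ N ρ a v ∈ weightSpace τ ρ a := by
  rw [mem_weightSpace, weightProj_apply, map_smul, smul_comm (a : k)]
  congr 1
  rw [map_sum, Finset.smul_sum]
  have h1 : ∀ n, ρ τ (((a⁻¹ : kˣ) : k) ^ n • ρ (τ ^ n) v) =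
      (a : k) • (((a⁻¹ : kˣ) : k) ^ (n + 1) • ρ (τ ^ (n + 1)) v) := fun n => by
    rw [map_smul, pow_succ' τ, map_mul, Module.End.mul_apply, smul_smul, pow_succ',
      ← mul_assoc, Units.mul_inv, one_mul]
  simp only [h1]
  have h2 := Finset.sum_range_succ (fun n => (a : k) • (((a⁻¹ : kˣ) : k) ^ n • ρ (τ ^ n) v)) N
  rw [Finset.sum_range_succ'] at h2
  simp only [hE.pow, pow_zero, ← Units.val_pow_eq_pow_val, inv_pow, ha, inv_one] at h2
  simp only [← Units.val_pow_eq_pow_val, inv_pow]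
  exact add_right_cancel h2

lemma weightProj_of_mem [CharZero k] (hE : IsTwistedProduct ι s τ ζ χ N)
    {ρ : Representation k E A} {a : kˣ} {v : A} (hv : v ∈ weightSpace τ ρ a) :
    weightProj τ N ρ a v = v := by
  rw [weightProj_apply]
  have h1 : ∀ n, ((a⁻¹ : kˣ) : k) ^ n • ρ (τ ^ n) v = v := fun n => by
    rw [pow_apply_of_mem_weightSpace hv, smul_smul, ← mul_pow, Units.inv_mul, one_pow, one_smul]
  simp only [h1, Finset.sum_const, Finset.card_range]
  rw [← Nat.cast_smul_eq_nsmul k, smul_smul, inv_mul_cancel₀, one_smul]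
  exact_mod_cast hE.pos.ne'

lemma weightProj_of_mem_ne {ρ : Representation k E A} {a b : kˣ}
    (ha : a ^ N = 1) (hb : b ^ N = 1) (hab : b ≠ a) {v : A} (hv : v ∈ weightSpace τ ρ b) :
    weightProj τ N ρ a v = 0 := by
  rw [weightProj_apply]
  have h1 : ∀ n, ((a⁻¹ : kˣ) : k) ^ n • ρ (τ ^ n) v = ((a⁻¹ * b : kˣ) : k) ^ n • v := fun n => by
    rw [pow_apply_of_mem_weightSpace hv, smul_smul, ← mul_pow, Units.val_mul]
  simp only [h1, ← Finset.sum_smul]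
  have hne : ((a⁻¹ * b : kˣ) : k) ≠ 1 := fun h => hab (by
    have : a⁻¹ * b = 1 := Units.ext h
    exact (inv_mul_eq_one.mp this).symm)
  rw [geom_sum_eq hne, ← Units.val_pow_eq_pow_val, mul_pow, inv_pow, ha, hb]
  simp

/-- The elements of `Q` permute the eigenspaces of `τ` through the character `χ`. -/
lemma apply_mem (hE : IsTwistedProduct ι s τ ζ χ N) {ρ : Representation k E A}
    (hρ : IsScalarOn ι ρ) {a : kˣ} {v : A} (hv : v ∈ weightSpace τ ρ a) (g : Q) :
    ρ (s g) v ∈ weightSpace τ ρ (χ g * a) := by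
  rw [mem_weightSpace] at hv ⊢
  rw [← Module.End.mul_apply, ← map_mul, hE.comm, map_mul, map_mul, Module.End.mul_apply, hρ,
    Module.End.mul_apply, hv, map_smul, smul_smul, Units.val_mul]

lemma apply_mem_of_ker (hE : IsTwistedProduct ι s τ ζ χ N) {ρ : Representation k E A}
    (hρ : IsScalarOn ι ρ) (a : kˣ) (h : χ.ker) :
    ∀ v ∈ weightSpace τ ρ a, ρ (s h) v ∈ weightSpace τ ρ a := fun v hv => by
  have := hE.apply_mem hρ hv h
  rwa [show χ (h : Q) = 1 from h.2, one_mul] at this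

/-- The representation of `ker χ` on an eigenspace of `τ`. -/
def weightRep (hE : IsTwistedProduct ι s τ ζ χ N) {ρ : Representation k E A}
    (hρ : IsScalarOn ι ρ) (a : kˣ) : Representation k χ.ker (weightSpace τ ρ a) where
  toFun h := (ρ (s h)).restrict (hE.apply_mem_of_ker hρ a h)
  map_one' := by ext; simp
  map_mul' g h := by ext; simp

lemma coe_weightRep_apply (hE : IsTwistedProduct ι s τ ζ χ N) {ρ : Representation k E A}
    (hρ : IsScalarOn ι ρ) (a : kˣ) (h : χ.ker) (v : weightSpace τ ρ a) :
    (hE.weightRep hρ a h v : A) = ρ (s h) v := rfl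

/-- The character `χ` has values in the `N`-th roots of unity, as `τ ^ N = 1` is central. -/
lemma char_pow_eq_one (hE : IsTwistedProduct ι s τ ζ χ N) (hι : Function.Injective ι) (g : Q) :
    χ g ^ N = 1 := by
  have h1 : ∀ n : ℕ, τ ^ n * s g = ι (χ g ^ n) * (s g * τ ^ n) := fun n => by
    induction n with
    | zero => simp
    | succ n ih =>
      rw [pow_succ', mul_assoc, ih, ← mul_assoc, ← hE.central, mul_assoc, ← mul_assoc τ, hE.comm,
        mul_assoc, ← mul_assoc (ι _) (ι _), ← map_mul, ← pow_succ, mul_assoc (s g)]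
  have h2 := h1 N
  rw [hE.pow, one_mul, mul_one] at h2
  exact hι (by rw [map_one]; exact mul_eq_right.mp h2.symm)

/-- Irreducibility forces the translates of a nonzero subspace of an eigenspace of `τ` to span. -/
lemma iSup_map_eq_top (hE : IsTwistedProduct ι s τ ζ χ N) {ρ : Representation k E A}
    (hρ : IsScalarOn ι ρ) (hirr : ρ.IsIrreducible) {a : kˣ} (U : Submodule k A)
    (hU : U ≤ weightSpace τ ρ a) (hU0 : U ≠ ⊥) : ⨆ g : Q, U.map (ρ (s g)) = ⊤ := by
  have hτ : ∀ v ∈ ⨆ g : Q, U.map (ρ (s g)), ρ τ v ∈ ⨆ g : Q, U.map (ρ (s g)) := by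
    change (⨆ g : Q, U.map (ρ (s g))) ≤ (⨆ g : Q, U.map (ρ (s g))).comap (ρ τ)
    refine iSup_le fun g => ?_
    rintro _ ⟨u, hu, rfl⟩
    rw [Submodule.mem_comap, mem_weightSpace.mp (hE.apply_mem hρ (hU hu) g)]
    exact Submodule.smul_mem _ _ (Submodule.mem_iSup_of_mem g ⟨u, hu, rfl⟩)
  have hs : ∀ q, ∀ v ∈ ⨆ g : Q, U.map (ρ (s g)), ρ (s q) v ∈ ⨆ g : Q, U.map (ρ (s g)) := by
    intro q
    change (⨆ g : Q, U.map (ρ (s g))) ≤ (⨆ g : Q, U.map (ρ (s g))).comap (ρ (s q))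
    refine iSup_le fun g => ?_
    rintro _ ⟨u, hu, rfl⟩
    rw [Submodule.mem_comap, ← Module.End.mul_apply, ← map_mul, ← map_mul]
    exact Submodule.mem_iSup_of_mem (q * g) ⟨u, hu, rfl⟩
  let S : Subrepresentation ρ :=
    { toSubmodule := ⨆ g : Q, U.map (ρ (s g))
      apply_mem_toSubmodule := fun x v hv => by
        obtain ⟨c, g, n, rfl⟩ := hE.gen x
        rw [map_mul, map_mul, Module.End.mul_apply, Module.End.mul_apply, hρ]
        refine Submodule.smul_mem _ _ (hs _ _ ?_)
        induction n with
        | zero => simpa using hv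
        | succ n ih => rw [pow_succ', map_mul, Module.End.mul_apply]; exact hτ _ ih }
  have hUS : U ≤ S.toSubmodule := fun u hu => Submodule.mem_iSup_of_mem 1 ⟨u, hu, by simp⟩
  rcases hirr.eq_bot_or_eq_top S with h | h
  · refine absurd (le_bot_iff.mp ?_) hU0
    rw [h] at hUS
    exact hUS
  · exact congrArg Subrepresentation.toSubmodule h

/-- The eigenspaces of `τ` on an irreducible representation are irreducible for `ker χ`. -/
lemma weightRep_irreducible [CharZero k] (hE : IsTwistedProduct ι s τ ζ χ N)
    (hι : Function.Injective ι) {ρ : Representation k E A} (hρ : IsScalarOn ι ρ)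
    (hirr : ρ.IsIrreducible) {a : kˣ} (ha : a ^ N = 1) (h0 : weightSpace τ ρ a ≠ ⊥) :
    (hE.weightRep hρ a).IsIrreducible := by
  refine { exists_pair_ne := ⟨⊥, ⊤, fun h => ?_⟩, eq_bot_or_eq_top := fun U => ?_ }
  · have h1 : (⊥ : Submodule k (weightSpace τ ρ a)) = ⊤ :=
      congrArg Subrepresentation.toSubmodule h
    exact h0 (Submodule.subsingleton_iff_eq_bot.mp
      ((Submodule.subsingleton_iff k).mp (subsingleton_of_bot_eq_top h1)))
  · let U' := U.toSubmodule.map (weightSpace τ ρ a).subtype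
    by_cases hU : U' = ⊥
    · left
      apply Subrepresentation.toSubmodule_injective
      exact Submodule.map_injective_of_injective Subtype.val_injective
        (hU.trans (Submodule.map_bot _).symm)
    · right
      have hU'le : U' ≤ weightSpace τ ρ a := by
        rintro _ ⟨u, -, rfl⟩
        exact u.2
      have htop := hE.iSup_map_eq_top hρ hirr U' hU'le hU
      have hP : (⨆ g : Q, U'.map (ρ (s g))) ≤ U'.comap (weightProj τ N ρ a) := by
        refine iSup_le fun g => ?_
        rintro _ ⟨u, hu, rfl⟩
        have hmem := hE.apply_mem hρ (hU'le hu) g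
        rw [Submodule.mem_comap]
        by_cases hg : χ g = 1
        · rw [hg, one_mul] at hmem
          rw [hE.weightProj_of_mem hmem]
          obtain ⟨u, hu, rfl⟩ := hu
          exact ⟨hE.weightRep hρ a ⟨g, hg⟩ u, U.apply_mem_toSubmodule _ hu, rfl⟩
        · rw [weightProj_of_mem_ne ha (by rw [mul_pow, hE.char_pow_eq_one hι, ha, one_mul])
            (fun h => hg (mul_eq_right.mp h)) hmem]
          exact U'.zero_mem
      apply Subrepresentation.toSubmodule_injective
      refine eq_top_iff.mpr fun v _ => ?_
      have hv : (v : A) ∈ ⨆ g : Q, U'.map (ρ (s g)) := by rw [htop]; trivial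
      have := hP hv
      rw [Submodule.mem_comap, hE.weightProj_of_mem v.2] at this
      obtain ⟨u, hu, huv⟩ := this
      rwa [← Subtype.ext huv]

/-- Two eigenvalues of `τ` on an irreducible representation differ by a value of `χ`. -/
lemma exists_char_of_weightSpace_ne_bot [CharZero k] (hE : IsTwistedProduct ι s τ ζ χ N)
    {ρ : Representation k E A} (hρ : IsScalarOn ι ρ) (hι : Function.Injective ι)
    (hirr : ρ.IsIrreducible) {a b : kˣ} (ha : a ^ N = 1) (hb : b ^ N = 1)
    (ha0 : weightSpace τ ρ a ≠ ⊥) (hb0 : weightSpace τ ρ b ≠ ⊥) : ∃ g, b = χ g * a := by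
  by_contra! hne
  have htop := hE.iSup_map_eq_top hρ hirr _ le_rfl ha0
  have hP : (⨆ g : Q, (weightSpace τ ρ a).map (ρ (s g))) ≤ LinearMap.ker (weightProj τ N ρ b) := by
    refine iSup_le fun g => ?_
    rintro _ ⟨u, hu, rfl⟩
    exact weightProj_of_mem_ne hb (by rw [mul_pow, hE.char_pow_eq_one hι, ha, one_mul])
      (hne g).symm (hE.apply_mem hρ hu g)
  rw [htop, top_le_iff] at hP
  refine hb0 (eq_bot_iff.mpr fun v hv => ?_)
  have : v ∈ LinearMap.ker (weightProj τ N ρ b) := by rw [hP]; trivial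
  rwa [LinearMap.mem_ker, hE.weightProj_of_mem hv] at this

/-- Restriction of an intertwining map to the eigenspaces of `τ`. -/
def restrictHom (hE : IsTwistedProduct ι s τ ζ χ N) {ρ : Representation k E A}
    (hρ : IsScalarOn ι ρ) {σ : Representation k E B} (hσ : IsScalarOn ι σ) (a : kˣ) :
    Representation.IntertwiningMap ρ σ →ₗ[k]
      Representation.IntertwiningMap (hE.weightRep hρ a) (hE.weightRep hσ a) where
  toFun f := ⟨f.toLinearMap.restrict fun v hv => by
      rw [mem_weightSpace] at hv ⊢
      change σ τ (f v) = _ • f v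
      rw [← f.isIntertwining, hv, map_smul], fun g => by
      ext v
      exact f.isIntertwining _ _ (s g) v⟩
  map_add' f g := rfl
  map_smul' c f := rfl

/-- The kernel of an intertwining map is a subrepresentation, so it is trivial or contains every
eigenspace. -/
lemma restrictHom_injective (hE : IsTwistedProduct ι s τ ζ χ N) {ρ : Representation k E A}
    (hρ : IsScalarOn ι ρ) {σ : Representation k E B} (hσ : IsScalarOn ι σ) {a : kˣ}
    (hirr : ρ.IsIrreducible) (h0 : weightSpace τ ρ a ≠ ⊥) :
    Function.Injective (hE.restrictHom hρ hσ a) := by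
  rw [injective_iff_map_eq_zero]
  intro f hf
  have hle : weightSpace τ ρ a ≤ f.ker.toSubmodule := fun v hv => by
    have := congrArg (fun φ : Representation.IntertwiningMap (hE.weightRep hρ a)
      (hE.weightRep hσ a) => (φ ⟨v, hv⟩ : B)) hf
    exact this
  rcases hirr.eq_bot_or_eq_top f.ker with h | h
  · rw [h] at hle
    exact absurd (le_bot_iff.mp hle) h0
  · refine Representation.IntertwiningMap.ext (LinearMap.ext fun v => ?_)
    have : v ∈ f.ker := by rw [h]; trivial
    exact this

/-- A homomorphism between eigenspaces extends to the sum of its conjugates by `Q`. -/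
lemma restrictHom_surjective [CharZero k] [Finite Q] (hE : IsTwistedProduct ι s τ ζ χ N)
    (hι : Function.Injective ι) {ρ : Representation k E A}
    (hρ : IsScalarOn ι ρ) {σ : Representation k E B} (hσ : IsScalarOn ι σ) {a : kˣ}
    (ha : a ^ N = 1) : Function.Surjective (hE.restrictHom hρ hσ a) := by
  classical
  intro φ
  have : Fintype Q := Fintype.ofFinite Q
  -- `ψ` is `φ` on the eigenspace for `a` and zero on the others
  let P : A →ₗ[k] weightSpace τ ρ a :=
    (weightProj τ N ρ a).codRestrict _ (hE.weightProj_mem ρ ha)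
  let ψ : A →ₗ[k] B := (weightSpace τ σ a).subtype ∘ₗ φ.toLinearMap ∘ₗ P
  have hPτ : ∀ v, P (ρ τ v) = (a : k) • P v := fun v => Subtype.ext (by
    change weightProj τ N ρ a (ρ τ v) = (a : k) • weightProj τ N ρ a v
    rw [← mem_weightSpace.mp (hE.weightProj_mem ρ ha v), weightProj_apply, weightProj_apply,
      map_smul, map_sum]
    congr 1
    refine Finset.sum_congr rfl fun n _ => ?_
    rw [map_smul, ← Module.End.mul_apply, ← Module.End.mul_apply, ← map_mul, ← map_mul,
      ← pow_succ, ← pow_succ'])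
  have hψτ : ∀ v, ψ (ρ τ v) = (a : k) • ψ v := fun v => by
    change ((φ.toLinearMap (P (ρ τ v)) : weightSpace τ σ a) : B) = _
    rw [hPτ, map_smul]
    rfl
  have hτψ : ∀ v, σ τ (ψ v) = (a : k) • ψ v := fun v => mem_weightSpace.mp (φ (P v)).2
  have hψ1 : ∀ v : weightSpace τ ρ a, ψ v = φ v := fun v => by
    have : P v = v := Subtype.ext (hE.weightProj_of_mem v.2)
    change ((φ (P v) : weightSpace τ σ a) : B) = _
    rw [this]
  have hψ0 : ∀ b v, b ^ N = 1 → b ≠ a → v ∈ weightSpace τ ρ b → ψ v = 0 := fun b v hb hab hv => by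
    have : P v = 0 := Subtype.ext (weightProj_of_mem_ne ha hb hab hv)
    change ((φ.toLinearMap (P v) : weightSpace τ σ a) : B) = _
    rw [this, map_zero]
    rfl
  let Ψ : A →ₗ[k] B := ∑ g : Q, σ (s g) ∘ₗ ψ ∘ₗ ρ (s g⁻¹)
  have hΨ : ∀ v, Ψ v = ∑ g : Q, σ (s g) (ψ (ρ (s g⁻¹) v)) := fun v => by
    simp [Ψ, LinearMap.sum_apply]
  have hs : ∀ q v, Ψ (ρ (s q) v) = σ (s q) (Ψ v) := fun q v => by
    rw [hΨ, hΨ, map_sum]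
    refine (Fintype.sum_equiv (Equiv.mulLeft q) _ _ fun g => ?_).symm
    rw [Equiv.coe_mulLeft, map_mul, map_mul, Module.End.mul_apply, mul_inv_rev,
      ← Module.End.mul_apply (ρ _) (ρ _), ← map_mul ρ, ← map_mul s, inv_mul_cancel_right]
  have hτ : ∀ v, Ψ (ρ τ v) = σ τ (Ψ v) := fun v => by
    rw [hΨ, hΨ, map_sum]
    refine Finset.sum_congr rfl fun g _ => ?_
    have e1 : s g⁻¹ * τ = ι (χ g) * (τ * s g⁻¹) := by
      rw [hE.comm, ← mul_assoc, ← map_mul, ← map_mul, mul_inv_cancel, map_one, map_one, one_mul]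
    rw [← Module.End.mul_apply (ρ _) (ρ _), ← map_mul ρ, e1, map_mul, Module.End.mul_apply, hρ,
      map_mul, Module.End.mul_apply, map_smul, map_smul, hψτ, map_smul,
      ← Module.End.mul_apply (σ _) (σ _), ← map_mul σ, hE.comm, map_mul, Module.End.mul_apply, hσ,
      map_mul, Module.End.mul_apply, hτψ, map_smul]
  have hc : ∀ c v, Ψ (ρ (ι c) v) = σ (ι c) (Ψ v) := fun c v => by rw [hρ, hσ, map_smul]
  have hall : ∀ x v, Ψ (ρ x v) = σ x (Ψ v) := by
    intro x v
    obtain ⟨c, g, n, rfl⟩ := hE.gen x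
    simp only [map_mul, Module.End.mul_apply, hc, hs]
    congr 2
    induction n with
    | zero => simp
    | succ n ih => rw [pow_succ', map_mul, Module.End.mul_apply, hτ, ih, map_mul,
        Module.End.mul_apply]
  -- on the eigenspace for `a`, only the conjugates by elements of `ker χ` contribute
  let d : ℕ := (Finset.univ.filter fun g : Q => χ g = 1).card
  have hd : (d : k) ≠ 0 := Nat.cast_ne_zero.mpr
    (Finset.card_ne_zero_of_mem (Finset.mem_filter.mpr ⟨Finset.mem_univ 1, map_one χ⟩))
  have hΨa : ∀ v : weightSpace τ ρ a, Ψ v = (d : k) • (φ v : B) := by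
    intro v
    rw [hΨ, Nat.cast_smul_eq_nsmul, ← Finset.sum_const, Finset.sum_filter]
    refine Finset.sum_congr rfl fun g _ => ?_
    have hmem := hE.apply_mem hρ v.2 g⁻¹
    split_ifs with hg
    · let h : χ.ker := ⟨g, hg⟩
      have e1 : ρ (s g⁻¹) v = (hE.weightRep hρ a h⁻¹ v : A) := rfl
      rw [e1, hψ1]
      change (hE.weightRep hσ a h (φ (hE.weightRep hρ a h⁻¹ v)) : B) = _
      rw [φ.isIntertwining, ← Module.End.mul_apply, ← map_mul, mul_inv_cancel, map_one]
      rfl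
    · rw [hψ0 _ _ (by rw [mul_pow, hE.char_pow_eq_one hι, ha, one_mul]) (fun h => hg ?_) hmem,
        map_zero]
      have := mul_eq_right.mp h
      rwa [map_inv, inv_eq_one] at this
  refine ⟨(d : k)⁻¹ • ⟨Ψ, fun x => LinearMap.ext (hall x)⟩, ?_⟩
  refine Representation.IntertwiningMap.ext (LinearMap.ext fun v => Subtype.ext ?_)
  change (d : k)⁻¹ • Ψ v = (φ v : B)
  rw [hΨa, smul_smul, inv_mul_cancel₀ hd, one_smul]

/-- Homomorphisms out of an irreducible representation are determined by any of its nonzero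
eigenspaces for `τ`. -/
lemma finrank_intertwiningMap [CharZero k] [Finite Q] (hE : IsTwistedProduct ι s τ ζ χ N)
    (hι : Function.Injective ι) {ρ : Representation k E A}
    (hρ : IsScalarOn ι ρ) {σ : Representation k E B} (hσ : IsScalarOn ι σ) {a : kˣ}
    (ha : a ^ N = 1) (hirr : ρ.IsIrreducible) (h0 : weightSpace τ ρ a ≠ ⊥) :
    Module.finrank k (Representation.IntertwiningMap ρ σ) =
      Module.finrank k (Representation.IntertwiningMap (hE.weightRep hρ a) (hE.weightRep hσ a)) :=
  (LinearEquiv.ofBijective _ ⟨hE.restrictHom_injective hρ hσ hirr h0,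
    hE.restrictHom_surjective hι hρ hσ ha⟩).finrank_eq

end IsTwistedProduct
end WeightSpaces

/-! ### Weight spaces of tensor products -/

section Tensor

variable {k : Type u} [Field k] {E Q : Type u} [Group E] [Group Q]
variable {ι : kˣ →* E} {s : Q →* E} {τ : E} {ζ : kˣ} {χ : Q →* kˣ} {N : ℕ}
variable {A W X : Type u} [AddCommGroup A] [Module k A] [AddCommGroup W] [Module k W]
  [AddCommGroup X] [Module k X]

lemma IsScalarOn.tprod {ρ : Representation k E A} (hρ : IsScalarOn ι ρ)
    (V : Representation k E W) (hVι : ∀ c w, V (ι c) w = w) : IsScalarOn ι (ρ.tprod V) := by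
  intro c x
  induction x using TensorProduct.induction_on with
  | zero => simp
  | add x y hx hy => rw [map_add, hx, hy, smul_add]
  | tmul m w =>
    rw [Representation.tprod_apply, TensorProduct.map_tmul, hρ, hVι, TensorProduct.smul_tmul']

namespace IsTwistedProduct

/-- The eigenspaces of `τ` on `ρ ⊗ V`, where `τ` acts on `V` as the scalar `b`, are those of `ρ`,
tensored with `V` and with the eigenvalue multiplied by `b`. -/
lemma finrank_intertwiningMap_tprod [CharZero k] (hE : IsTwistedProduct ι s τ ζ χ N)
    {ρ : Representation k E A} (hρ : IsScalarOn ι ρ) (V : Representation k E W)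
    (hVι : ∀ c w, V (ι c) w = w) {a b : kˣ} (ha : a ^ N = 1)
    (hVτ : ∀ w, V τ w = (b : k) • w) (α : Representation k χ.ker X) :
    Module.finrank k (Representation.IntertwiningMap α
        (hE.weightRep (hρ.tprod V hVι) (a * b))) =
      Module.finrank k (Representation.IntertwiningMap α
        ((hE.weightRep hρ a).tprod (V.comp (s.comp χ.ker.subtype)))) := by
  have hpow : ∀ n w, V (τ ^ n) w = (b : k) ^ n • w := fun n w => by
    induction n with
    | zero => simp
    | succ n ih => rw [pow_succ', map_mul, Module.End.mul_apply, ih, map_smul, hVτ, smul_smul,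
        pow_succ]
  have hproj : weightProj τ N (ρ.tprod V) (a * b) =
      TensorProduct.map (weightProj τ N ρ a) LinearMap.id := by
    ext m w
    simp only [TensorProduct.AlgebraTensorModule.curry_apply, TensorProduct.curry_apply,
      LinearMap.coe_restrictScalars, TensorProduct.map_tmul, LinearMap.id_apply]
    rw [weightProj_apply, weightProj_apply, ← TensorProduct.smul_tmul', TensorProduct.sum_tmul]
    congr 1
    refine Finset.sum_congr rfl fun n _ => ?_
    rw [Representation.tprod_apply, TensorProduct.map_tmul, hpow, TensorProduct.tmul_smul,
      smul_smul, ← mul_pow, mul_inv, Units.val_mul, mul_assoc, Units.inv_mul, mul_one,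
      TensorProduct.smul_tmul']
  let P : A →ₗ[k] weightSpace τ ρ a :=
    (weightProj τ N ρ a).codRestrict _ (hE.weightProj_mem ρ ha)
  let F₀ : (weightSpace τ ρ a) ⊗[k] W →ₗ[k] A ⊗[k] W :=
    TensorProduct.map (weightSpace τ ρ a).subtype LinearMap.id
  have hF₀ : ∀ x, F₀ x ∈ weightSpace τ (ρ.tprod V) (a * b) := by
    intro x
    induction x using TensorProduct.induction_on with
    | zero => rw [map_zero]; exact Submodule.zero_mem _
    | add x y hx hy => rw [map_add]; exact Submodule.add_mem _ hx hy
    | tmul m w =>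
      rw [mem_weightSpace]
      change TensorProduct.map (ρ τ) (V τ) ((m : A) ⊗ₜ[k] w) = _ • ((m : A) ⊗ₜ[k] w)
      rw [TensorProduct.map_tmul, hVτ, mem_weightSpace.mp m.2, TensorProduct.tmul_smul,
        ← TensorProduct.smul_tmul', smul_smul, Units.val_mul, mul_comm]
  -- the inclusion of the tensor product and the projection of the first factor are inverse
  let F := F₀.codRestrict _ hF₀
  let G : weightSpace τ (ρ.tprod V) (a * b) →ₗ[k] (weightSpace τ ρ a) ⊗[k] W :=
    TensorProduct.map P LinearMap.id ∘ₗ (weightSpace τ (ρ.tprod V) (a * b)).subtype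
  have hFG : F ∘ₗ G = LinearMap.id := by
    refine LinearMap.ext fun x => Subtype.ext ?_
    change TensorProduct.map (weightSpace τ ρ a).subtype LinearMap.id
      (TensorProduct.map P LinearMap.id (x : A ⊗[k] W)) = x
    rw [← LinearMap.comp_apply, ← TensorProduct.map_comp]
    have h1 : (weightSpace τ ρ a).subtype ∘ₗ P = weightProj τ N ρ a := rfl
    rw [h1, LinearMap.id_comp, ← hproj, hE.weightProj_of_mem x.2]
  have hGF : G ∘ₗ F = LinearMap.id := by
    change TensorProduct.map P LinearMap.id ∘ₗ
      TensorProduct.map (weightSpace τ ρ a).subtype LinearMap.id = LinearMap.id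
    rw [← TensorProduct.map_comp, LinearMap.id_comp]
    have h1 : P ∘ₗ (weightSpace τ ρ a).subtype = LinearMap.id :=
      LinearMap.ext fun v => Subtype.ext (hE.weightProj_of_mem v.2)
    rw [h1, TensorProduct.map_id]
  let e : (weightSpace τ ρ a) ⊗[k] W ≃ₗ[k] weightSpace τ (ρ.tprod V) (a * b) :=
    LinearEquiv.ofLinearMap F G hFG hGF
  refine (homTransport α α _ _ (MulEquiv.refl χ.ker) (LinearEquiv.refl k X) (fun _ _ => rfl)
    e.symm fun g x => ?_).finrank_eq
  obtain ⟨y, hy⟩ := e.surjective x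
  rw [← hy, LinearEquiv.symm_apply_apply, LinearEquiv.symm_apply_eq]
  apply Subtype.ext
  change TensorProduct.map (ρ (s g)) (V (s g)) (F₀ y) =
    F₀ (TensorProduct.map (hE.weightRep hρ a g) (V (s g)) y)
  clear hy
  induction y using TensorProduct.induction_on with
  | zero => simp
  | add x y hx hy => simp only [map_add, hx, hy]
  | tmul m w => rfl

end IsTwistedProduct

end Tensor

/-! ### Representations with a given weight space -/

section Existence

variable {k : Type u} [Field k] {E Q : Type u} [Group E] [Group Q]
variable {ι : kˣ →* E} {s : Q →* E} {τ : E} {ζ : kˣ} {χ : Q →* kˣ} {N : ℕ}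

/-- A nonzero finite-dimensional representation has an irreducible subrepresentation, for instance
any nonzero one of minimal dimension. -/
lemma exists_irreducible_subrepresentation {A : Type*} [AddCommGroup A] [Module k A]
    [Module.Finite k A] [Nontrivial A] (ρ : Representation k E A) :
    ∃ S : Subrepresentation ρ, S.toRepresentation.IsIrreducible := by
  classical
  have hex : ∃ n, ∃ S : Subrepresentation ρ, S.toSubmodule ≠ ⊥ ∧
      Module.finrank k S.toSubmodule = n := ⟨_, ⊤, top_ne_bot, rfl⟩
  obtain ⟨S, hS, hSn⟩ := Nat.find_spec hex
  refine ⟨S, { exists_pair_ne := ⟨⊥, ⊤, fun h => ?_⟩, eq_bot_or_eq_top := fun U => ?_ }⟩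
  · have h1 : (⊥ : Submodule k S.toSubmodule) = ⊤ := congrArg Subrepresentation.toSubmodule h
    exact hS (Submodule.subsingleton_iff_eq_bot.mp
      ((Submodule.subsingleton_iff k).mp (subsingleton_of_bot_eq_top h1)))
  · rw [or_iff_not_imp_left]
    intro hU
    let U' : Subrepresentation ρ :=
      { toSubmodule := U.toSubmodule.map S.toSubmodule.subtype
        apply_mem_toSubmodule := by
          rintro g _ ⟨u, hu, rfl⟩
          exact ⟨S.toRepresentation g u, U.apply_mem_toSubmodule g hu, rfl⟩ }
    have hU' : U'.toSubmodule ≠ ⊥ := fun h => hU (Subrepresentation.toSubmodule_injective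
      (Submodule.map_injective_of_injective Subtype.val_injective
        (h.trans (Submodule.map_bot _).symm)))
    have hle := Nat.find_min' hex ⟨U', hU', rfl⟩
    rw [← hSn] at hle
    have : Module.finrank k U'.toSubmodule = Module.finrank k U.toSubmodule :=
      (Submodule.equivMapOfInjective _ Subtype.val_injective _).symm.finrank_eq
    apply Subrepresentation.toSubmodule_injective
    apply Submodule.eq_top_of_finrank_eq
    exact le_antisymm (Submodule.finrank_le _) (this ▸ hle)

namespace IsTwistedProduct

lemma comm_pow_of_ker (hE : IsTwistedProduct ι s τ ζ χ N) (n : ℤ) (h : χ.ker) :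
    τ ^ n * s h = s h * τ ^ n := by
  have h1 : Commute τ (s h) := by
    have := hE.comm h
    rwa [show χ (h : Q) = 1 from h.2, map_one, one_mul] at this
  exact (h1.zpow_left n).eq

/-- The homomorphism `(c, n, h) ↦ ι c * τ ^ n * h` on `kˣ × ℤ × ker χ`. -/
def kerHom (hE : IsTwistedProduct ι s τ ζ χ N) : kˣ × Multiplicative ℤ × χ.ker →* E :=
  MonoidHom.mk' (fun x => ι x.1 * (τ ^ x.2.1.toAdd * s x.2.2)) fun x y => by
    simp only [Prod.fst_mul, Prod.snd_mul, map_mul, toAdd_mul, zpow_add, Subgroup.coe_mul]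
    rw [mul_assoc (τ ^ _) (τ ^ _), ← mul_assoc (τ ^ y.2.1.toAdd) (s _), hE.comm_pow_of_ker]
    simp only [mul_assoc]
    rw [← mul_assoc (s _) (ι _), ← hE.central, ← mul_assoc (τ ^ _) (ι _ * _),
      ← mul_assoc (τ ^ _) (ι _), ← hE.central]
    simp only [mul_assoc]

lemma kerHom_apply (hE : IsTwistedProduct ι s τ ζ χ N)
    (x : kˣ × Multiplicative ℤ × χ.ker) : hE.kerHom x = ι x.1 * (τ ^ x.2.1.toAdd * s x.2.2) := rfl

/-- The representation of `kˣ × ℤ × ker χ` on a representation of `ker χ` for which `kˣ` acts by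
scalar multiplication and `1 ∈ ℤ` acts as the scalar `a`. -/
def kerRep {Λ : Type u} [AddCommGroup Λ] [Module k Λ] (lam : Representation k χ.ker Λ) (a : kˣ) :
    Representation k (kˣ × Multiplicative ℤ × χ.ker) Λ where
  toFun x := ((x.1 * a ^ x.2.1.toAdd : kˣ) : k) • lam x.2.2
  map_one' := by simp
  map_mul' x y := by
    ext v
    simp only [Prod.fst_mul, Prod.snd_mul, toAdd_mul, zpow_add, map_mul, LinearMap.smul_apply,
      Module.End.mul_apply, map_smul, smul_smul, Units.val_mul]
    congr 1
    ring

lemma kerRep_apply {Λ : Type u} [AddCommGroup Λ] [Module k Λ] (lam : Representation k χ.ker Λ)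
    (a : kˣ) (x : kˣ × Multiplicative ℤ × χ.ker) (v : Λ) :
    kerRep lam a x v = ((x.1 * a ^ x.2.1.toAdd : kˣ) : k) • lam x.2.2 v := rfl

/-- Every irreducible representation of `ker χ` which is compatible with the relations of `E` is
an eigenspace of `τ` on an irreducible representation of `E`, namely on an irreducible
subrepresentation of the coinduced representation. -/
theorem exists_irrRep [CharZero k] [Finite Q] (hE : IsTwistedProduct ι s τ ζ χ N)
    (lam : IrrRep k χ.ker) {a : kˣ} (ha : a ^ N = 1)
    (hlam : ∀ x, hE.kerHom x = 1 → ∀ v, kerRep lam.ρ a x v = v) :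
    ∃ (M : IrrRep k E) (hM : IsScalarOn ι M.ρ), Nonempty (lam.ρ.Equiv (hE.weightRep hM a)) := by
  classical
  let φ := hE.kerHom
  let σ := kerRep lam.ρ a
  let C := Representation.coindV φ σ
  let ρ : Representation k E C := Representation.coind φ σ
  have hρ : ∀ (x : E) (f : C) (y : E), (ρ x f).1 y = f.1 (y * x) := fun x f y => rfl
  have hC : ∀ (f : C) x y, f.1 (φ x * y) = σ x (f.1 y) := fun f => f.2
  have hφι : ∀ c, φ (c, 1, 1) = ι c := fun c => by simp [φ, kerHom_apply]
  have hφτ : ∀ n : ℤ, φ (1, Multiplicative.ofAdd n, 1) = τ ^ n := fun n => by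
    simp [φ, kerHom_apply]
  have hφs : ∀ h, φ (1, 1, h) = s h := fun h => by simp [φ, kerHom_apply]
  have hι : ∀ (f : C) c x, f.1 (ι c * x) = (c : k) • f.1 x := fun f c x => by
    rw [← hφι, hC]; simp [σ, kerRep_apply]
  have hτ : ∀ (f : C) (n : ℤ) x, f.1 (τ ^ n * x) = ((a ^ n : kˣ) : k) • f.1 x := fun f n x => by
    rw [← hφτ, hC]; simp [σ, kerRep_apply]
  have hs : ∀ (f : C) (h : χ.ker) x, f.1 (s h * x) = lam.ρ h (f.1 x) := fun f h x => by
    rw [← hφs, hC]; simp [σ, kerRep_apply]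
  -- functions in the coinduced representation are determined by their values on `Q`
  have hdet : ∀ f : C, (∀ g, f.1 (s g) = 0) → f = 0 := by
    intro f hf
    refine Subtype.ext (funext fun x => ?_)
    change f.1 x = 0
    obtain ⟨c, g, n, rfl⟩ := hE.gen x
    have hcomm : ∀ n : ℕ, ∃ d, s g * τ ^ n = ι d * (τ ^ (n : ℤ) * s g) := by
      intro n
      induction n with
      | zero => exact ⟨1, by simp⟩
      | succ n ih =>
        obtain ⟨d, hd⟩ := ih
        refine ⟨d * (χ g)⁻¹, ?_⟩
        have h1 : s g * τ = ι (χ g)⁻¹ * (τ * s g) := by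
          rw [hE.comm, ← mul_assoc, ← map_mul, inv_mul_cancel, map_one, one_mul]
        rw [pow_succ, ← mul_assoc, hd, mul_assoc, mul_assoc, h1, map_mul, mul_assoc,
          ← mul_assoc (τ ^ _) (ι _), ← hE.central, Nat.cast_succ, zpow_add_one]
        simp only [mul_assoc]
    obtain ⟨d, hd⟩ := hcomm n
    rw [hd, hι, hι, hτ, hf, smul_zero, smul_zero, smul_zero]
  have : Module.Finite k C := by
    let r : C →ₗ[k] (Q → lam.carrier) :=
      { toFun := fun f g => f.1 (s g)
        map_add' := fun _ _ => rfl
        map_smul' := fun _ _ => rfl }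
    refine Module.Finite.of_injective r ((injective_iff_map_eq_zero r).mpr fun f hf => ?_)
    exact hdet f fun g => congrFun hf g
  have : Nontrivial C := by
    have := lam.nontrivial
    -- the function on the image of `φ` with value `v` at `1`, extended by zero; it is well defined
    -- since the kernel of `φ` acts trivially
    obtain ⟨v, hv⟩ := exists_ne (0 : lam.carrier)
    let f₀ : E → lam.carrier := fun x => if h : ∃ y, φ y = x then σ h.choose v else 0
    have hf₀ : ∀ y, f₀ (φ y) = σ y v := by
      intro y
      have h : ∃ y', φ y' = φ y := ⟨y, rfl⟩
      have h1 : f₀ (φ y) = σ h.choose v := dif_pos h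
      rw [h1]
      have h2 := hlam (y⁻¹ * h.choose) (by
        change φ _ = 1
        rw [map_mul, map_inv, h.choose_spec, inv_mul_cancel]) v
      change σ _ v = v at h2
      conv_rhs => rw [← h2]
      rw [← Module.End.mul_apply, ← map_mul, mul_inv_cancel_left]
    have hf₀' : ∀ x, (¬ ∃ y, φ y = x) → f₀ x = 0 := fun x h => dif_neg h
    refine ⟨⟨f₀, fun y x => ?_⟩, 0, fun h0 => hv ?_⟩
    · by_cases hx : ∃ y', φ y' = x
      · obtain ⟨y', rfl⟩ := hx
        rw [← map_mul, hf₀, hf₀, map_mul, Module.End.mul_apply]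
      · rw [hf₀' x hx, map_zero]
        refine hf₀' _ fun ⟨y', hy'⟩ => hx ⟨y⁻¹ * y', ?_⟩
        rw [map_mul, map_inv, hy', inv_mul_cancel_left]
    · have h1 : f₀ 1 = 0 := congrArg (fun f : C => f.1 1) h0
      rw [← map_one φ, hf₀, map_one] at h1
      exact h1
  obtain ⟨S, hS⟩ := exists_irreducible_subrepresentation ρ
  let M : IrrRep k E := { carrier := S.toSubmodule, ρ := S.toRepresentation, irreducible := hS }
  have hM : IsScalarOn ι M.ρ := fun c f => Subtype.ext (Subtype.ext (funext fun x => by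
    change f.1.1 (x * ι c) = (c : k) • f.1.1 x
    rw [← hE.central, hι]))
  -- evaluation at `1` identifies the eigenspace with the given representation
  let ev : Representation.IntertwiningMap (hE.weightRep hM a) lam.ρ :=
    ⟨{ toFun := fun f => f.1.1.1 1
       map_add' := fun _ _ => rfl
       map_smul' := fun _ _ => rfl }, fun h => LinearMap.ext fun f => by
        change f.1.1.1 (1 * s h) = lam.ρ h (f.1.1.1 1)
        rw [one_mul, ← mul_one (s h), hs]⟩
  have hev : ∀ f : weightSpace τ M.ρ a, ev f = f.1.1.1 1 := fun f => rfl
  have hinj : Function.Injective ev := by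
    intro f f' hff'
    rw [← sub_eq_zero]
    set d := f - f' with hd
    have hd1 : d.1.1.1 1 = 0 := by
      rw [← hev, hd, map_sub, hff', sub_self]
    have hwt : ∀ x, d.1.1.1 (x * τ) = (a : k) • d.1.1.1 x := fun x =>
      congrArg (fun f : S.toSubmodule => f.1.1 x) (mem_weightSpace.mp d.2)
    refine Subtype.ext (Subtype.ext (hdet _ fun g => ?_))
    by_cases hg : χ g = 1
    · have := hs d.1.1 ⟨g, hg⟩ 1
      rw [hd1, map_zero, mul_one] at this
      exact this
    · -- `τ` acts on the value at `s g` both by `a` and by `(χ g)⁻¹ * a`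
      have h1 := hwt (s g)
      have h2 : s g * τ = ι (χ g)⁻¹ * (τ ^ (1 : ℤ) * s g) := by
        rw [zpow_one, hE.comm, ← mul_assoc, ← map_mul, inv_mul_cancel, map_one, one_mul]
      rw [h2, hι, hτ, zpow_one, smul_comm, ← sub_eq_zero, ← smul_sub, smul_eq_zero] at h1
      have h3 := h1.resolve_left a.ne_zero
      have h4 : (((χ g)⁻¹ : kˣ) - 1 : k) • d.1.1.1 (s g) = 0 := by
        rw [sub_smul, one_smul]; exact h3
      refine (smul_eq_zero.mp h4).resolve_left fun h5 => hg ?_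
      have : (χ g)⁻¹ = 1 := Units.ext (sub_eq_zero.mp h5)
      exact inv_eq_one.mp this
  have hne : ∃ f : weightSpace τ M.ρ a, ev f ≠ 0 := by
    have hnt : Nontrivial S.toSubmodule := M.nontrivial
    -- some translate of a nonzero function is nonzero at `1`, and the projection to the eigenspace
    -- does not change the value at `1`
    obtain ⟨f, hf⟩ := exists_ne (0 : S.toSubmodule)
    obtain ⟨x, hx⟩ : ∃ x, f.1.1 x ≠ 0 := by
      by_contra! hall
      exact hf (Subtype.ext (Subtype.ext (funext hall)))
    let f' : S.toSubmodule := M.ρ x f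
    have hf' : f'.1.1 1 ≠ 0 := by
      change f.1.1 (1 * x) ≠ 0
      rwa [one_mul]
    refine ⟨⟨weightProj τ N M.ρ a f', hE.weightProj_mem M.ρ ha f'⟩, ?_⟩
    rw [hev]
    let ev' : S.toSubmodule →ₗ[k] lam.carrier :=
      { toFun := fun f => f.1.1 1
        map_add' := fun _ _ => rfl
        map_smul' := fun _ _ => rfl }
    change ev' (weightProj τ N M.ρ a f') ≠ 0
    rw [weightProj_apply, map_smul, map_sum]
    have h1 : ∀ n : ℕ, ev' (((a⁻¹ : kˣ) : k) ^ n • M.ρ (τ ^ n) f') = f'.1.1 1 := by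
      intro n
      rw [map_smul]
      change _ • f'.1.1 (1 * τ ^ n) = _
      rw [one_mul, ← mul_one (τ ^ n), ← zpow_natCast τ n, hτ, smul_smul, zpow_natCast,
        Units.val_pow_eq_pow_val, ← mul_pow, Units.inv_mul, one_pow, one_smul]
    simp only [h1, Finset.sum_const, Finset.card_range]
    have hN : (N : k) ≠ 0 := by exact_mod_cast hE.pos.ne'
    rwa [← Nat.cast_smul_eq_nsmul k, smul_smul, inv_mul_cancel₀ hN, one_smul]
  refine ⟨M, hM, ⟨Representation.Equiv.symm ?_⟩⟩
  have := lam.irreducible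
  refine ev.ofBijective ⟨hinj, (Representation.IsIrreducible.surjective_or_eq_zero ev).resolve_right
    fun h0 => ?_⟩
  obtain ⟨f, hf⟩ := hne
  exact hf (by rw [h0]; rfl)

end IsTwistedProduct
end Existence

/-! ### The McKay quiver of a central extension -/

section TwistedMcKay

variable {k : Type u} [Field k] {E : Type u} [Group E] {G₁ : Subgroup SL(2, k)}
variable {ι : kˣ →* E} {s : G₁ →* E} {τ : E} {ζ : kˣ} {χ : G₁ →* kˣ} {m : ℕ}
  {F : E →* GL (Fin 2) k}

/-- A central extension `E` of `μ_{2m} G₁` by `kˣ` with lifts `s` of `G₁` and `τ` of the primitive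
root of unity `ζ`, chosen so that the lifts of `-1` agree; the commutators with `τ` are given by
the character `χ` of `G₁`. -/
structure IsTwistedCover (ι : kˣ →* E) (s : G₁ →* E) (τ : E) (ζ : kˣ) (χ : G₁ →* kˣ) (m : ℕ)
    (F : E →* GL (Fin 2) k) : Prop where
  twisted : IsTwistedProduct ι s τ ζ χ (2 * m)
  pos : 0 < m
  injective : Function.Injective ι
  neg_mem : (-1 : SL(2, k)) ∈ G₁
  pow_half : τ ^ m = s ⟨-1, neg_mem⟩
  map_incl : ∀ c, F (ι c) = 1
  map_lift : ∀ g, F (s g) = Matrix.SpecialLinearGroup.toGL (g : SL(2, k))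
  map_root : F τ = Matrix.GeneralLinearGroup.scalar (Fin 2) ζ
  char_pow : χ ^ m = 1

lemma evenAut_zpow_val {H : Subgroup G₁} [H.Normal] (g₁ : G₁) (d : ℤ) (n : ℤ)
    (w : EvenQuiver H) :
    ((((evenAut H g₁ d).onVert : Equiv.Perm (EvenQuiver H)) ^ n) w).1.1.val =
      w.1.1.val + n * (2 * d) := by
  have h1 : ∀ w, ((evenAut H g₁ d).onVert w).1.1.val = w.1.1.val + 2 * d := fun w => rfl
  induction n using Int.induction_on with
  | zero => simp
  | succ n ih => rw [add_comm, zpow_one_add, Equiv.Perm.mul_apply, h1, ih]; ring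
  | pred n ih =>
    have h2 := h1 ((((evenAut H g₁ d).onVert : Equiv.Perm (EvenQuiver H)) ^ (-(n : ℤ) - 1)) w)
    rw [← Equiv.Perm.mul_apply, ← zpow_one_add, show (1 : ℤ) + (-(n : ℤ) - 1) = -n by ring,
      ih] at h2
    linarith

namespace IsTwistedCover

lemma root_pow_half (h : IsTwistedCover ι s τ ζ χ m F) : ζ ^ m = -1 := by
  have h1 : (ζ ^ m) ^ 2 = 1 := by rw [← pow_mul, mul_comm, h.twisted.prim.pow_eq_one]
  have h2 : ((ζ ^ m : kˣ) : k) ^ 2 = 1 := by rw [← Units.val_pow_eq_pow_val, h1, Units.val_one]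
  rcases sq_eq_one_iff.mp h2 with h3 | h3
  · have hm := h.pos
    exact absurd (Units.ext h3) (h.twisted.prim.pow_ne_one_of_pos_of_lt hm.ne' (by omega))
  · exact Units.ext h3

lemma zpow_pow_eq_one (h : IsTwistedCover ι s τ ζ χ m F) (i : ℤ) : (ζ ^ i) ^ (2 * m) = 1 := by
  rw [← zpow_natCast, ← zpow_mul, mul_comm, zpow_mul, zpow_natCast, h.twisted.prim.pow_eq_one,
    one_zpow]

lemma stdRep_incl (h : IsTwistedCover ι s τ ζ χ m F) (c : kˣ) (w : Fin 2 → k) :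
    stdRep F (ι c) w = w := by
  change Matrix.toLin' (F (ι c) : Matrix (Fin 2) (Fin 2) k) w = w
  rw [h.map_incl]; simp

lemma stdRep_root (h : IsTwistedCover ι s τ ζ χ m F) (w : Fin 2 → k) :
    stdRep F τ w = (ζ : k) • w := by
  change Matrix.toLin' (F τ : Matrix (Fin 2) (Fin 2) k) w = _
  rw [h.map_root]
  ext i
  simp [Matrix.GeneralLinearGroup.scalar]

lemma stdRep_restrict (h : IsTwistedCover ι s τ ζ χ m F) :
    (stdRep F).comp (s.comp χ.ker.subtype) = natRep χ.ker := by
  refine MonoidHom.ext fun g => ?_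
  change Matrix.toLin' (F (s g) : Matrix (Fin 2) (Fin 2) k) = _
  rw [h.map_lift]
  rfl

/-- The eigenspace of `τ` on an irreducible representation, as an irreducible representation
of `ker χ`. -/
def weightIrr [CharZero k] (h : IsTwistedCover ι s τ ζ χ m F) (M : IrrRep k E)
    (hM : IsScalarOn ι M.ρ) (i : ℤ) (h0 : weightSpace τ M.ρ (ζ ^ i) ≠ ⊥) : IrrRep k χ.ker where
  carrier := weightSpace τ M.ρ (ζ ^ i)
  ρ := h.twisted.weightRep hM (ζ ^ i)
  irreducible := h.twisted.weightRep_irreducible h.injective hM M.irreducible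
    (h.zpow_pow_eq_one i) h0

/-- The element `-1` acts on the eigenspace for `ζ ^ i` as `(-1) ^ i`, because its lift is
`τ ^ m`. -/
lemma weightRep_neg_one (h : IsTwistedCover ι s τ ζ χ m F) {M : IrrRep k E}
    (hM : IsScalarOn ι M.ρ) (i : ℤ) (g : χ.ker) (hg : ((g : G₁) : SL(2, k)) = -1)
    (v : weightSpace τ M.ρ (ζ ^ i)) :
    h.twisted.weightRep hM (ζ ^ i) g v = (((-1 : kˣ) ^ i : kˣ) : k) • v := by
  have hg' : (g : G₁) = ⟨-1, h.neg_mem⟩ := Subtype.ext hg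
  apply Subtype.ext
  rw [IsTwistedProduct.coe_weightRep_apply, hg', ← h.pow_half, pow_apply_of_mem_weightSpace v.2,
    ← Units.val_pow_eq_pow_val, ← zpow_natCast, ← zpow_mul, mul_comm, zpow_mul, zpow_natCast,
    h.root_pow_half]
  rfl

/-- The vertices of the twisted McKay quiver. -/
abbrev TwistedVertex (ι : kˣ →* E) (F : E →* GL (Fin 2) k) : Type (u + 1) :=
  FullSubquiver fun l : McK (stdRep F) => ∀ c : kˣ, ActsAs l (ι c) (c : k)

/-- The class of an irreducible representation on which `kˣ` acts by scalar multiplication. -/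
def vertexMk (F : E →* GL (Fin 2) k) (M : IrrRep k E) (hM : IsScalarOn ι M.ρ) :
    TwistedVertex ι F :=
  ⟨Quotient.mk _ M, hM⟩

lemma exists_vertexMk (v : TwistedVertex ι F) :
    ∃ (M : IrrRep k E) (hM : IsScalarOn ι M.ρ), v = vertexMk F M hM := by
  obtain ⟨v, hv⟩ := v
  obtain ⟨M, rfl⟩ := Quotient.exists_rep v
  exact ⟨M, hv, rfl⟩

lemma vertexMk_eq_iff {M M' : IrrRep k E} (hM : IsScalarOn ι M.ρ) (hM' : IsScalarOn ι M'.ρ) :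
    vertexMk F M hM = vertexMk F M' hM' ↔ Nonempty (M.ρ.Equiv M'.ρ) :=
  ⟨fun h => Quotient.exact (congrArg Subtype.val h), fun h => Subtype.ext (Quotient.sound h)⟩

/-- The relation between irreducible representations of `E` and even vertices: the vertex `(i, l)`
is related to `M` when the eigenspace of `τ` on `M` for the eigenvalue `ζ ^ i` is in the
class `l`. -/
def WeightRel (h : IsTwistedCover ι s τ ζ χ m F) (v : TwistedVertex ι F)
    (w : EvenQuiver χ.ker) : Prop :=
  ∃ (M : IrrRep k E) (hM : IsScalarOn ι M.ρ) (L : IrrRep k χ.ker), v = vertexMk F M hM ∧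
    w.1.2 = Quotient.mk _ L ∧
    Nonempty (L.ρ.Equiv (h.twisted.weightRep hM (ζ ^ w.1.1.val)))

/-- Isomorphic representations have isomorphic eigenspaces of `τ`. -/
lemma weightRep_equiv (h : IsTwistedCover ι s τ ζ χ m F) {M M' : IrrRep k E}
    (hM : IsScalarOn ι M.ρ) (hM' : IsScalarOn ι M'.ρ) (e : M.ρ.Equiv M'.ρ) (a : kˣ) :
    Nonempty ((h.twisted.weightRep hM a).Equiv (h.twisted.weightRep hM' a)) := by
  refine ⟨(h.twisted.restrictHom hM hM' a e.toIntertwiningMap).ofBijective ⟨fun v v' hv => ?_,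
    fun v => ⟨h.twisted.restrictHom hM' hM a e.symm.toIntertwiningMap v, ?_⟩⟩⟩
  · exact Subtype.ext (e.toLinearEquiv.injective (congrArg Subtype.val hv))
  · exact Subtype.ext (e.toLinearEquiv.apply_symm_apply (v : M'.carrier))

lemma weightRel_vertexMk_iff (h : IsTwistedCover ι s τ ζ χ m F) {M : IrrRep k E}
    (hM : IsScalarOn ι M.ρ) (w : EvenQuiver χ.ker) (L : IrrRep k χ.ker)
    (hL : w.1.2 = Quotient.mk _ L) : h.WeightRel (vertexMk F M hM) w ↔
      Nonempty (L.ρ.Equiv (h.twisted.weightRep hM (ζ ^ w.1.1.val))) := by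
  constructor
  · rintro ⟨M', hM', L', hv, hL', ⟨e⟩⟩
    obtain ⟨f⟩ := (vertexMk_eq_iff hM hM').mp hv
    obtain ⟨f'⟩ := h.weightRep_equiv hM' hM f.symm (ζ ^ w.1.1.val)
    obtain ⟨e'⟩ : Nonempty (L.ρ.Equiv L'.ρ) := Quotient.exact (hL.symm.trans hL')
    exact ⟨(e'.trans e).trans f'⟩
  · exact fun e => ⟨M, hM, L, rfl, hL, e⟩

lemma weightSpace_ne_bot_of_rel (h : IsTwistedCover ι s τ ζ χ m F) {M : IrrRep k E}
    (hM : IsScalarOn ι M.ρ) (w : EvenQuiver χ.ker) (hR : h.WeightRel (vertexMk F M hM) w) :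
    weightSpace τ M.ρ (ζ ^ w.1.1.val) ≠ ⊥ := by
  obtain ⟨L, hL⟩ := Quotient.exists_rep w.1.2
  obtain ⟨e⟩ := (h.weightRel_vertexMk_iff hM w L hL.symm).mp hR
  intro h0
  have := L.nontrivial
  have h1 : Nontrivial (weightSpace τ M.ρ (ζ ^ w.1.1.val)) := e.toLinearEquiv.symm.nontrivial
  exact (Submodule.nontrivial_iff_ne_bot.mp h1) h0

/-- The even vertex given by an eigenspace of `τ`. -/
def weightVertex [CharZero k] (h : IsTwistedCover ι s τ ζ χ m F) (M : IrrRep k E)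
    (hM : IsScalarOn ι M.ρ) (i : ℤ) (h0 : weightSpace τ M.ρ (ζ ^ i) ≠ ⊥) : EvenQuiver χ.ker :=
  ⟨(⟨i⟩, Quotient.mk _ (h.weightIrr M hM i h0)), fun g hg v => h.weightRep_neg_one hM i g hg v⟩

lemma weightRel_weightVertex [CharZero k] (h : IsTwistedCover ι s τ ζ χ m F) (M : IrrRep k E)
    (hM : IsScalarOn ι M.ρ) (i : ℤ) (h0 : weightSpace τ M.ρ (ζ ^ i) ≠ ⊥) :
    h.WeightRel (vertexMk F M hM) (h.weightVertex M hM i h0) :=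
  (h.weightRel_vertexMk_iff hM _ _ rfl).mpr ⟨.refl _⟩

/-- For a given integer, there is at most one vertex related to a given representation. -/
lemma weightRel_right_unique (h : IsTwistedCover ι s τ ζ χ m F) (v : TwistedVertex ι F)
    (w w' : EvenQuiver χ.ker) (hw : h.WeightRel v w) (hw' : h.WeightRel v w')
    (hi : w.1.1.val = w'.1.1.val) : w = w' := by
  obtain ⟨M, hM, rfl⟩ := exists_vertexMk v
  obtain ⟨⟨⟨i⟩, l⟩, hl⟩ := w
  obtain ⟨⟨⟨i'⟩, l'⟩, hl'⟩ := w'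
  obtain rfl : i = i' := hi
  obtain ⟨L, rfl⟩ := Quotient.exists_rep l
  obtain ⟨L', rfl⟩ := Quotient.exists_rep l'
  obtain ⟨e⟩ := (h.weightRel_vertexMk_iff hM _ L rfl).mp hw
  obtain ⟨e'⟩ := (h.weightRel_vertexMk_iff hM _ L' rfl).mp hw'
  have : (Quotient.mk _ L : Delta χ.ker) = Quotient.mk _ L' := Quotient.sound ⟨e.trans e'.symm⟩
  exact Subtype.ext (Prod.ext rfl this)

/-- Any eigenvalue of `τ` is a power of `ζ`. -/
lemma exists_weightRel_right [IsAlgClosed k] [CharZero k] (h : IsTwistedCover ι s τ ζ χ m F)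
    (v : TwistedVertex ι F) : ∃ w, h.WeightRel v w := by
  obtain ⟨M, hM, rfl⟩ := exists_vertexMk v
  have := M.nontrivial
  obtain ⟨c, hc⟩ := Module.End.exists_eigenvalue (M.ρ τ)
  obtain ⟨x, hx⟩ := hc.exists_hasEigenvector
  have hpow : c ^ (2 * m) = 1 := by
    have h1 := hx.pow_apply (2 * m)
    rw [← map_pow, h.twisted.pow, map_one, Module.End.one_apply] at h1
    exact (smul_left_injective k hx.2 (by simpa using h1)).symm
  have : NeZero (2 * m) := ⟨h.twisted.pos.ne'⟩
  obtain ⟨i, -, hi⟩ := (IsPrimitiveRoot.coe_units_iff.mpr h.twisted.prim).eq_pow_of_pow_eq_one hpow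
  refine ⟨_, h.weightRel_weightVertex M hM i fun h0 => hx.2 ?_⟩
  have hmem : x ∈ weightSpace τ M.ρ (ζ ^ (i : ℤ)) := by
    rw [mem_weightSpace, hx.apply_eq_smul, ← hi]
    simp
  rw [h0] at hmem
  exact hmem

/-- An even vertex `(i, l)` satisfies the compatibility conditions of
`IsTwistedProduct.exists_irrRep`: as `μ_{2m} ∩ G₁ = ⟨-1⟩`, they only concern `-1`. -/
lemma exists_weightRel_left [CharZero k] [Finite G₁] (h : IsTwistedCover ι s τ ζ χ m F)
    (w : EvenQuiver χ.ker) : ∃ v, h.WeightRel v w := by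
  obtain ⟨⟨⟨i⟩, l⟩, hl⟩ := w
  obtain ⟨L, rfl⟩ := Quotient.exists_rep l
  have heven : ∀ g : χ.ker, ((g : G₁) : SL(2, k)) = -1 → ∀ v, L.ρ g v =
    (((-1 : kˣ) ^ i : kˣ) : k) • v := hl
  obtain ⟨M, hM, e⟩ := h.twisted.exists_irrRep L (h.zpow_pow_eq_one i) (by
    rintro ⟨c, n, g⟩ hx v
    obtain ⟨n, rfl⟩ := Multiplicative.ofAdd.surjective n
    rw [IsTwistedProduct.kerHom_apply] at hx
    rw [IsTwistedProduct.kerRep_apply]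
    simp only [toAdd_ofAdd] at hx ⊢
    have hz : ζ ^ n ∈ rootsOfUnity (2 * m) k := (mem_rootsOfUnity _ _).mpr (h.zpow_pow_eq_one n)
    have h1 : coxeterMk m G₁ (⟨ζ ^ n, hz⟩, (g : G₁)) = 1 := by
      apply Subtype.ext
      rw [coe_coxeterMk]
      have := congrArg F hx
      rw [map_mul, map_mul, h.map_incl, one_mul, map_zpow, h.map_root, h.map_lift, map_one,
        ← map_zpow] at this
      exact this
    have hc : τ ^ n * s g = 1 → c = 1 := fun h2 => by
      rw [h2, mul_one] at hx
      exact h.injective (by rw [hx, map_one])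
    rw [← zpow_mul, mul_comm i, zpow_mul]
    rcases coxeterMk_eq_one h.neg_mem _ h1 with h2 | h2
    · have hζ : ζ ^ n = 1 := congrArg (fun p => (p.1 : kˣ)) h2
      have hg : (g : G₁) = 1 := congrArg Prod.snd h2
      obtain ⟨j, hj⟩ := (h.twisted.prim.zpow_eq_one_iff_dvd n).mp hζ
      rw [hζ, hc (by rw [hg, map_one, hj, zpow_mul, zpow_natCast, h.twisted.pow]; simp),
        show g = 1 from Subtype.ext hg]
      simp
    · have hζ : ζ ^ n = -1 := congrArg (fun p => (p.1 : kˣ)) h2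
      have hg : (g : G₁) = ⟨-1, h.neg_mem⟩ := congrArg Prod.snd h2
      have h3 : ζ ^ (n - m) = 1 := by
        rw [zpow_sub, hζ, zpow_natCast, h.root_pow_half, mul_inv_cancel]
      obtain ⟨j, hj⟩ := (h.twisted.prim.zpow_eq_one_iff_dvd _).mp h3
      have h4 : τ ^ n = τ ^ m := by
        rw [show n = ((2 * m : ℕ) : ℤ) * j + m by linarith, zpow_add, zpow_mul, zpow_natCast,
          h.twisted.pow, one_zpow, one_mul, zpow_natCast]
      rw [hζ, hc (by rw [h4, hg, ← h.pow_half, ← pow_add, ← two_mul, h.twisted.pow]),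
        heven g (congrArg Subtype.val hg), smul_smul, one_mul, ← Units.val_mul, ← mul_zpow]
      simp)
  exact ⟨vertexMk F M hM, (h.weightRel_vertexMk_iff hM _ L rfl).mpr e⟩

/-- An isomorphism of eigenspaces of `τ` extends to an isomorphism of irreducible representations,
by Schur's lemma. -/
lemma weightRel_left_unique [CharZero k] [Finite G₁] (h : IsTwistedCover ι s τ ζ χ m F)
    (v v' : TwistedVertex ι F) (w : EvenQuiver χ.ker) (hv : h.WeightRel v w)
    (hv' : h.WeightRel v' w) : v = v' := by
  obtain ⟨M, hM, rfl⟩ := exists_vertexMk v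
  obtain ⟨M', hM', rfl⟩ := exists_vertexMk v'
  obtain ⟨L, hL⟩ := Quotient.exists_rep w.1.2
  obtain ⟨e⟩ := (h.weightRel_vertexMk_iff hM w L hL.symm).mp hv
  obtain ⟨e'⟩ := (h.weightRel_vertexMk_iff hM' w L hL.symm).mp hv'
  obtain ⟨f, hf⟩ := h.twisted.restrictHom_surjective h.injective hM hM'
    (h.zpow_pow_eq_one w.1.1.val) (e.symm.trans e').toIntertwiningMap
  have := M.irreducible
  have := M'.irreducible
  rw [vertexMk_eq_iff]
  refine ⟨f.ofBijective ((Representation.IsIrreducible.bijective_or_eq_zero f).resolve_right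
    fun h0 => ?_)⟩
  obtain ⟨x, hx⟩ := (Submodule.ne_bot_iff _).mp (h.weightSpace_ne_bot_of_rel hM w hv)
  have h1 : (e.symm.trans e').toLinearEquiv ⟨x, hx.1⟩ = 0 := by
    change (e.symm.trans e').toIntertwiningMap ⟨x, hx.1⟩ = 0
    rw [← hf, h0, map_zero]
    rfl
  exact hx.2 (congrArg Subtype.val ((LinearEquiv.map_eq_zero_iff _).mp h1))

/-- Conjugation by `g₁` shifts the eigenvalues of `τ` by `χ g₁`. -/
lemma weightRel_map (h : IsTwistedCover ι s τ ζ χ m F) (g₁ : G₁) (d : ℕ)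
    (hg₁ : χ g₁ = ζ ^ (2 * d)) (v : TwistedVertex ι F) (w : EvenQuiver χ.ker)
    (hR : h.WeightRel v w) : h.WeightRel v ((evenAut χ.ker g₁ (d : ℤ)).onVert w) := by
  obtain ⟨M, hM, rfl⟩ := exists_vertexMk v
  obtain ⟨⟨⟨i⟩, l⟩, hl⟩ := w
  obtain ⟨L, rfl⟩ := Quotient.exists_rep l
  obtain ⟨e⟩ := (h.weightRel_vertexMk_iff hM _ L rfl).mp hR
  refine (h.weightRel_vertexMk_iff hM _ (L.twist (MulAut.conjNormal g₁)) rfl).mpr ?_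
  change Nonempty ((L.twist (MulAut.conjNormal g₁)).ρ.Equiv
    (h.twisted.weightRep hM (ζ ^ (i + 2 * (d : ℤ)))))
  have hζ : χ g₁ * ζ ^ i = ζ ^ (i + 2 * (d : ℤ)) := by
    rw [hg₁, zpow_add, mul_comm, ← zpow_natCast ζ (2 * d)]
    norm_cast
  have hζ' : χ g₁⁻¹ * ζ ^ (i + 2 * (d : ℤ)) = ζ ^ i := by
    rw [← hζ, map_inv, inv_mul_cancel_left]
  let S : weightSpace τ M.ρ (ζ ^ i) ≃ₗ[k] weightSpace τ M.ρ (ζ ^ (i + 2 * (d : ℤ))) :=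
    { toFun := fun v => ⟨M.ρ (s g₁) v, hζ ▸ h.twisted.apply_mem hM v.2 g₁⟩
      map_add' := fun v v' => Subtype.ext (map_add (M.ρ (s g₁)) (v : M.carrier) v')
      map_smul' := fun c v => Subtype.ext (map_smul (M.ρ (s g₁)) c (v : M.carrier))
      invFun := fun v => ⟨M.ρ (s g₁⁻¹) v, hζ' ▸ h.twisted.apply_mem hM v.2 g₁⁻¹⟩
      left_inv := fun v => Subtype.ext (by
        change M.ρ (s g₁⁻¹) (M.ρ (s g₁) v) = v
        rw [← Module.End.mul_apply, ← map_mul, ← map_mul, inv_mul_cancel, map_one, map_one,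
          Module.End.one_apply])
      right_inv := fun v => Subtype.ext (by
        change M.ρ (s g₁) (M.ρ (s g₁⁻¹) v) = v
        rw [← Module.End.mul_apply, ← map_mul, ← map_mul, mul_inv_cancel, map_one, map_one,
          Module.End.one_apply]) }
  refine ⟨.mk (e.toLinearEquiv.trans S) fun g => LinearMap.ext fun v => Subtype.ext ?_⟩
  change M.ρ (s g₁) (e (L.ρ ((MulAut.conjNormal g₁).symm g) v) : M.carrier) =
    M.ρ (s g) (M.ρ (s g₁) (e v : M.carrier))
  have h1 : (e (L.ρ ((MulAut.conjNormal g₁).symm g) v) : M.carrier) =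
      M.ρ (s ((MulAut.conjNormal g₁).symm g : χ.ker)) (e v : M.carrier) :=
    congrArg Subtype.val (e.toIntertwiningMap.isIntertwining _ _ _ v)
  rw [h1, ← Module.End.mul_apply, ← Module.End.mul_apply, ← map_mul, ← map_mul, ← map_mul,
    ← map_mul, MulAut.conjNormal_symm_apply]
  congr 3
  group

lemma orderOf_char_dvd (h : IsTwistedCover ι s τ ζ χ m F) : orderOf χ ∣ m :=
  orderOf_dvd_of_pow_eq_one h.char_pow

lemma div_orderOf_pos (h : IsTwistedCover ι s τ ζ χ m F) : 0 < m / orderOf χ :=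
  Nat.div_pos (Nat.le_of_dvd h.pos h.orderOf_char_dvd)
    (Nat.pos_of_dvd_of_pos h.orderOf_char_dvd h.pos)

/-- The even vertices related to a representation form one orbit: the integers of two of them
differ by a multiple of `2m/e`, since the values of `χ` are powers of `χ g₁`. -/
lemma exists_int_of_weightRel [CharZero k] (h : IsTwistedCover ι s τ ζ χ m F)
    (v : TwistedVertex ι F) (w w' : EvenQuiver χ.ker) (hw : h.WeightRel v w)
    (hw' : h.WeightRel v w') :
    ∃ n : ℤ, w'.1.1.val = w.1.1.val + n * (2 * ((m / orderOf χ : ℕ) : ℤ)) := by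
  obtain ⟨M, hM, rfl⟩ := exists_vertexMk v
  obtain ⟨g, hg⟩ := h.twisted.exists_char_of_weightSpace_ne_bot hM h.injective M.irreducible
    (h.zpow_pow_eq_one w.1.1.val) (h.zpow_pow_eq_one w'.1.1.val)
    (h.weightSpace_ne_bot_of_rel hM w hw) (h.weightSpace_ne_bot_of_rel hM w' hw')
  have hm : 2 * m = 2 * (m / orderOf χ) * orderOf χ := by
    rw [mul_assoc, Nat.div_mul_cancel h.orderOf_char_dvd]
  have hprim : IsPrimitiveRoot (ζ ^ (2 * (m / orderOf χ))) (orderOf χ) :=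
    h.twisted.prim.pow h.twisted.pos hm
  have hχ : χ g ^ orderOf χ = 1 := by
    rw [← MonoidHom.pow_apply, pow_orderOf_eq_one, MonoidHom.one_apply]
  have : NeZero (orderOf χ) := ⟨(Nat.pos_of_dvd_of_pos h.orderOf_char_dvd h.pos).ne'⟩
  obtain ⟨j, -, hj⟩ := (IsPrimitiveRoot.coe_units_iff.mpr hprim).eq_pow_of_pow_eq_one
    (ξ := ((χ g : kˣ) : k)) (by rw [← Units.val_pow_eq_pow_val, hχ, Units.val_one])
  have hj' : (ζ ^ (2 * (m / orderOf χ))) ^ j = χ g := Units.ext (by simpa using hj)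
  have h1 : ζ ^ (w'.1.1.val - (w.1.1.val + ((2 * (m / orderOf χ) * j : ℕ) : ℤ))) = 1 := by
    rw [zpow_sub, hg, zpow_add, zpow_natCast, pow_mul, hj', mul_comm, mul_comm (χ g),
      inv_mul_cancel]
  obtain ⟨t, ht⟩ := (h.twisted.prim.zpow_eq_one_iff_dvd _).mp h1
  refine ⟨j + orderOf χ * t, ?_⟩
  rw [hm] at ht
  push_cast at ht ⊢
  linarith

/-- The number of arrows out of a representation, in terms of eigenspaces of `τ`. -/
lemma multRep_eq [CharZero k] [Finite G₁] (h : IsTwistedCover ι s τ ζ χ m F)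
    (M M' : IrrRep k E) (hM : IsScalarOn ι M.ρ) (hM' : IsScalarOn ι M'.ρ) (j : ℤ)
    (h0 : weightSpace τ M'.ρ (ζ ^ (j + 1)) ≠ ⊥) :
    multRep (stdRep F) M M' = Module.finrank k (Representation.IntertwiningMap
      (h.twisted.weightRep hM' (ζ ^ (j + 1)))
      ((h.twisted.weightRep hM (ζ ^ j)).tprod (natRep χ.ker))) := by
  rw [multRep, h.twisted.finrank_intertwiningMap h.injective hM' (hM.tprod _ h.stdRep_incl)
    (h.zpow_pow_eq_one (j + 1)) M'.irreducible h0, ← h.stdRep_restrict,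
    ← h.twisted.finrank_intertwiningMap_tprod hM (stdRep F) h.stdRep_incl (h.zpow_pow_eq_one j)
      h.stdRep_root, ← zpow_add_one]

/-- Only one vertex related to `v` has arrows to `w'`: its integer has to be one less than that
of `w'`. If the eigenspace for the corresponding eigenvalue vanishes, there are no arrows. -/
lemma nonempty_arrows_equiv [CharZero k] [Finite G₁] (h : IsTwistedCover ι s τ ζ χ m F)
    (v v' : TwistedVertex ι F) (w' : EvenQuiver χ.ker) (hR : h.WeightRel v' w') :
    Nonempty ((v ⟶ v') ≃ {p : Σ w, (w ⟶ w') // h.WeightRel v p.1}) := by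
  obtain ⟨M, hM, rfl⟩ := exists_vertexMk v
  obtain ⟨M', hM', rfl⟩ := exists_vertexMk v'
  obtain ⟨⟨⟨j'⟩, l'⟩, hl'⟩ := w'
  obtain ⟨j, rfl⟩ : ∃ j, j' = j + 1 := ⟨j' - 1, by ring⟩
  obtain ⟨L', rfl⟩ := Quotient.exists_rep l'
  set w' : EvenQuiver χ.ker := ⟨(⟨j + 1⟩, Quotient.mk _ L'), hl'⟩ with hw'
  obtain ⟨e'⟩ := (h.weightRel_vertexMk_iff hM' _ L' rfl).mp hR
  have h0' := h.weightSpace_ne_bot_of_rel hM' _ hR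
  have hval : ∀ w : EvenQuiver χ.ker, (w ⟶ w') → w.1.1.val = j := fun w a => by
    have h1 : j + 1 = w.1.1.val + 1 := a.1.down
    linarith
  have hcard := h.multRep_eq M M' hM hM' j h0'
  by_cases h0 : weightSpace τ M.ρ (ζ ^ j) = ⊥
  · have hempty : multRep (stdRep F) M M' = 0 := by
      rw [hcard]
      have : Subsingleton (weightSpace τ M.ρ (ζ ^ j)) := by rw [h0]; infer_instance
      have hs : Subsingleton (Representation.IntertwiningMap
          (h.twisted.weightRep hM' (ζ ^ (j + 1)))
          ((h.twisted.weightRep hM (ζ ^ j)).tprod (natRep χ.ker))) :=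
        ⟨fun f f' => Representation.IntertwiningMap.ext
          (LinearMap.ext fun x => Subsingleton.elim _ _)⟩
      exact Module.finrank_zero_of_subsingleton
    have e1 : IsEmpty (vertexMk F M hM ⟶ vertexMk F M' hM') := by
      change IsEmpty (Fin (multRep (stdRep F) M M'))
      rw [hempty]
      infer_instance
    have e2 : IsEmpty {p : Σ w, (w ⟶ w') // h.WeightRel (vertexMk F M hM) p.1} := by
      refine ⟨fun ⟨⟨w, a⟩, hw⟩ => ?_⟩
      have h1 := h.weightSpace_ne_bot_of_rel hM w hw
      rw [hval w a] at h1
      exact h1 h0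
    exact ⟨Equiv.equivOfIsEmpty _ _⟩
  · let w := h.weightVertex M hM j h0
    have hw := h.weightRel_weightVertex M hM j h0
    have hmult : multRep (stdRep F) M M' = multRep (natRep χ.ker) (h.weightIrr M hM j h0) L' := by
      rw [hcard]
      exact multRep_congr (natRep χ.ker) (h.weightIrr M hM j h0) (h.weightIrr M' hM' (j + 1) h0')
        (h.weightIrr M hM j h0) L' (Setoid.refl _) ⟨e'.symm⟩
    let e1 : (vertexMk F M hM ⟶ vertexMk F M' hM') ≃ (w ⟶ w') :=
      { toFun := fun a => (⟨rfl⟩, Fin.cast hmult a)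
        invFun := fun a => Fin.cast hmult.symm a.2
        left_inv := fun a => rfl
        right_inv := fun a => rfl }
    let f : (w ⟶ w') → {p : Σ w, (w ⟶ w') // h.WeightRel (vertexMk F M hM) p.1} :=
      fun a => ⟨⟨w, a⟩, hw⟩
    refine ⟨e1.trans (Equiv.ofBijective f ⟨fun a b hab => ?_, ?_⟩)⟩
    · have := congrArg Subtype.val hab
      simpa [f] using this
    · rintro ⟨⟨w₂, a⟩, hw₂⟩
      obtain rfl := h.weightRel_right_unique _ w₂ w hw₂ hw (hval w₂ a)
      exact ⟨a, rfl⟩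

/-- The McKay quiver of a twisted cover is the quotient of the even part of `ℤ × Δ_H`, `H = ker χ`,
by the shift by `2m/e` combined with conjugation by `g₁`. -/
theorem nonempty_quiverIso [IsAlgClosed k] [CharZero k] [Finite G₁]
    (h : IsTwistedCover ι s τ ζ χ m F) (g₁ : G₁) (hg₁ : χ g₁ = ζ ^ (2 * (m / orderOf χ))) :
    Nonempty (QuiverIso (TwistedVertex ι F)
      (QuotQuiver (evenAut χ.ker g₁ ((m / orderOf χ : ℕ) : ℤ)))) := by
  have hmap := h.weightRel_map g₁ _ hg₁
  refine nonempty_quiverIso_quotQuiver _ h.WeightRel h.exists_weightRel_right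
    h.exists_weightRel_left h.weightRel_left_unique (fun v w w' hw hw' => ?_) hmap
    (fun w n hn => ?_) h.nonempty_arrows_equiv
  · obtain ⟨n, hn⟩ := h.exists_int_of_weightRel v w w' hw hw'
    refine ⟨n, h.weightRel_right_unique v _ _ ?_ hw' ?_⟩
    · rwa [QuiverIso.rel_zpow_iff _ h.WeightRel h.exists_weightRel_left h.weightRel_left_unique
        hmap]
    · rw [evenAut_zpow_val, hn]
  · have h1 := evenAut_zpow_val g₁ ((m / orderOf χ : ℕ) : ℤ) n w
    rw [hn] at h1
    have h2 : n * (2 * ((m / orderOf χ : ℕ) : ℤ)) = 0 := by linarith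
    have := h.div_orderOf_pos
    rcases mul_eq_zero.mp h2 with h3 | h3
    · exact h3
    · omega

end IsTwistedCover
end TwistedMcKay

/-! ### The extension of `μ_{2m} G₁` defined by a cocycle -/

section CoxeterExtension

variable {k : Type u} [Field k] {m : ℕ} {G₁ : Subgroup SL(2, k)}

/-- The lifts of `G₁` and of a primitive root of unity of order `2m` exhibit the central extension
of `μ_{2m} G₁` with commutator pairing `η` as a twisted cover. -/
lemma exists_isTwistedCover [IsAlgClosed k] [CharZero k] [Finite G₁] (hm : 0 < m)
    (hneg : (-1 : SL(2, k)) ∈ G₁)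
    (η : rootsOfUnity m k →* ((G₁ ⧸ negOneSubgroup G₁) →* kˣ))
    (α : groupCohomology.cocycles₂ (unitsRep (coxeterGroup m G₁)))
    (h : groupCohomology.H2π _ α = pairingClass hneg (Additive.ofMul η))
    (ζ : kˣ) (hζ : IsPrimitiveRoot ζ (2 * m)) (w : rootsOfUnity m k) (hw : (w : kˣ) = ζ ^ 2) :
    ∃ (s : G₁ →* CentralExt α) (τ : CentralExt α), IsTwistedCover (CentralExt.incl α) s τ ζ
      ((η w).comp (QuotientGroup.mk' (negOneSubgroup G₁))) m
      ((coxeterGroup m G₁).subtype.comp (CentralExt.proj α)) := by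
  have hE := CentralExt.isCentralExtension α
  obtain ⟨s, t, hs, ht, hst⟩ := exists_lifts hm hneg α
  let z : rootsOfUnity (2 * m) k := ⟨ζ, hζ.pow_eq_one⟩
  have hz : rootSq k m z = w := Subtype.ext hw.symm
  have : NeZero (2 * m) := ⟨by omega⟩
  have hprim : IsPrimitiveRoot z (2 * m) := IsPrimitiveRoot.coe_submonoidClass_iff.mp hζ
  have hhalf : z ^ m = rootNegOne k m := by
    refine (rootSq_eq_one (z ^ m) ?_).resolve_left
      (hprim.pow_ne_one_of_pos_of_lt hm.ne' (by omega))
    refine Subtype.ext ?_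
    change (ζ ^ m) ^ 2 = 1
    rw [← pow_mul, mul_comm, hζ.pow_eq_one]
  refine ⟨s, t z, ⟨⟨by omega, hζ, hE.central, fun g => ?_, ?_, fun x => ?_⟩, hm, hE.injective, hneg,
    ?_, ?_, fun g => ?_, ?_, ?_⟩⟩
  · rw [commutator_of_pairingClass hneg η α h z g (t z) (s g) (ht z) (hs g), rootPairing, hz]
    rfl
  · rw [← map_pow, hprim.pow_eq_one, map_one]
  · obtain ⟨⟨y, g⟩, hy⟩ := coxeterMk_surjective (CentralExt.proj α x)
    obtain ⟨n, -, hn⟩ := hζ.eq_pow_of_mem_rootsOfUnity y.2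
    have hn' : z ^ n = y := Subtype.ext hn
    obtain ⟨c, hc⟩ := hE.exists_incl (x * (s g * t z ^ n)⁻¹) (by
      rw [map_mul, map_inv, map_mul, ← map_pow, hs, ht, hn', ← hy, ← map_mul, mul_inv_eq_one]
      simp)
    exact ⟨c, g, n, by rw [hc, inv_mul_cancel_right]⟩
  · rw [← map_pow, hhalf, hst]
  · exact fun c => congrArg Subtype.val (hE.map_incl c)
  · refine (congrArg Subtype.val (hs g)).trans ?_
    rw [coe_coxeterMk]
    simp
  · refine (congrArg Subtype.val (ht z)).trans ?_
    rw [coe_coxeterMk]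
    simp [z]
  · have h1 : η w ^ m = 1 := (map_pow η w m).symm.trans (by
      rw [show w ^ m = 1 from Subtype.ext w.2, map_one])
    refine MonoidHom.ext fun g => ?_
    exact DFunLike.congr_fun h1 (QuotientGroup.mk g)

end CoxeterExtension

end McKayGL2

end

theorem mainTheorem6 {k : Type u} [Field k] [IsAlgClosed k] [CharZero k]
    (G₁ : Subgroup SL(2, k)) [Finite G₁] (hG₁ : ∃ x y : G₁, x * y ≠ y * x)
    (m : ℕ) (hm : 0 < m) :
    ∃ Φ : McKayGL2.HTwo (McKayGL2.coxeterGroup m G₁) ≃+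
        Additive (rootsOfUnity m k →* ((G₁ ⧸ McKayGL2.negOneSubgroup G₁) →* kˣ)),
      ∀ α : groupCohomology.cocycles₂ (McKayGL2.unitsRep (McKayGL2.coxeterGroup m G₁)),
      ∀ η : rootsOfUnity m k →* ((G₁ ⧸ McKayGL2.negOneSubgroup G₁) →* kˣ),
        Φ (groupCohomology.H2π _ α) = Additive.ofMul η →
        (∀ (z : rootsOfUnity (2 * m) k) (w : rootsOfUnity m k) (g : G₁)
            (x y : McKayGL2.CentralExt α),
            (w : kˣ) = (z : kˣ) ^ 2 →
            (McKayGL2.CentralExt.proj α x : GL (Fin 2) k) =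
              Matrix.GeneralLinearGroup.scalar (Fin 2) (z : kˣ) →
            (McKayGL2.CentralExt.proj α y : GL (Fin 2) k) =
              Matrix.SpecialLinearGroup.toGL (g : SL(2, k)) →
            x * y = McKayGL2.CentralExt.incl α (η w (QuotientGroup.mk g)) * (y * x)) ∧
        ∀ (ζ : kˣ) (w : rootsOfUnity m k) (χ : G₁ →* kˣ) (g₁ : G₁),
          IsPrimitiveRoot ζ (2 * m) →
          (w : kˣ) = ζ ^ 2 →
          χ = (η w).comp (QuotientGroup.mk' (McKayGL2.negOneSubgroup G₁)) →
          χ g₁ = ζ ^ (2 * (m / orderOf χ)) →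
          ((g₁ : SL(2, k))) ^ orderOf χ = -1 →
          Nonempty (McKayGL2.QuiverIso (McKayGL2.McKTwisted α)
            (McKayGL2.QuotQuiver
              (McKayGL2.evenAut χ.ker g₁ ((m / orderOf χ : ℕ) : ℤ)))) := by
  have hneg := McKayGL2.neg_one_mem_of_nonabelian G₁ hG₁
  refine ⟨McKayGL2.pairingEquiv hm hneg, fun α η hη => ?_⟩
  have hα : groupCohomology.H2π _ α = McKayGL2.pairingClass hneg (Additive.ofMul η) :=
    (AddEquiv.symm_apply_eq _).mp hη
  refine ⟨fun z w g x y hw hx hy => ?_, fun ζ w χ g₁ hζ hw hχ hg₁ _ => ?_⟩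
  · obtain rfl : McKayGL2.rootSq k m z = w := Subtype.ext hw.symm
    refine McKayGL2.commutator_of_pairingClass hneg η α hα z g x y (Subtype.ext ?_)
      (Subtype.ext ?_)
    · rw [hx, McKayGL2.coe_coxeterMk]
      simp
    · rw [hy, McKayGL2.coe_coxeterMk]
      simp
  · obtain ⟨s, τ, h⟩ := McKayGL2.exists_isTwistedCover hm hneg η α hα ζ hζ w hw
    rw [← hχ] at h
    exact h.nonempty_quiverIso g₁ hg₁
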